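/- **Proposition (Poisson commutativity).** Let $\gamma,\delta\in\mathbb C$ with $0<\operatorname{Im}\gamma<\operatorname{Im}\delta$, put $q=e^{2\pi i\gamma}$, $p=e^{2\pi i\delta}$, and let $\varepsilon\in\mathbb C$ be a constant. Let $$\vartheta_1(x)=-i\,p^{1/8}e^{\pi i x}\sum_{n\in\mathbb Z}(-1)^n p^{n(n+1)/2}e^{2\pi i n x},\qquad p^{1/8}=e^{\pi i\delta/4},\qquad \vartheta_1'=\vartheta_1'(0).$$ Let $\mathcal A$ be the algebra of formal power series over $\mathbb C$ in commuting variables $\lambda_n$ $(n\in\mathbb Z\setminus\{0\})$ in which only finitely many weights occur, where $\lambda_n$ has weight $n$; it is the completion of the polynomial algebra generated by the $\lambda_n$. It is a Poisson algebra under $$\{F,G\}=\sum_{n\ne0}\frac{(1-q^n)(1-p^nq^{-n})}{1-p^n}\,\frac{\partial F}{\partial\lambda_n}\frac{\partial G}{\partial\lambda_{-n}}$$ (for each monomial, only finitely many $n$ contribute to its coefficient), so that $\{\lambda_n,\lambda_m\}=\frac{(1-q^n)(1-p^nq^{-n})}{1-p^n}\,\delta_{n+m,0}$. For real $x$ set $$\eta(x)=\varepsilon\exp\Bigl(\sum_{n\neq0}\lambda_n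 e^{-2\pi i n x}\Bigr),$$ a formal power series in the $\lambda_n$, and for $n=1,2,\dots$ let $$I_n=\frac{(-1)^{n-1}}{n!}\,\frac{(\vartheta_1')^{n-1}\vartheta_1(n\gamma)}{(2\pi i)^{n-1}\vartheta_1(\gamma)^n}\int_{-1/2}^{1/2}\!\!\cdots\int_{-1/2}^{1/2}\prod_{1\le i<j\le n}\frac{\vartheta_1(x_i-x_j)^2}{\vartheta_1(x_i-x_j+\gamma)\,\vartheta_1(x_i-x_j-\gamma)}\;\eta(x_1)\cdots\eta(x_n)\,dx_1\cdots dx_n ,$$ the integral being taken coefficient by coefficient; $I_n$ is an element of $\mathcal A$ (of weight $0$). Then for all positive integers $k$ and $l$, $$\{I_k,I_l\}=0 .$$ -/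

import Mathlib

open Complex MeasureTheory Filter

noncomputable section

namespace EllipticILW

/-! ### The theta function -/

/-- The theta function `ϑ₁(x; δ) = -i p^{1/8} e^{πix} ∑_{n ∈ ℤ} (-1)^n p^{n(n+1)/2} e^{2πinx}`
with `p = e^{2πiδ}`, where `p^{1/8} = e^{πiδ/4}` and `p^{n(n+1)/2} = e^{πiδn(n+1)}`. -/
def theta (δ x : ℂ) : ℂ :=
  -I * cexp (Real.pi * I * δ / 4) * cexp (Real.pi * I * x) *
    ∑' n : ℤ, (-1 : ℂ) ^ n * cexp (Real.pi * I * δ * n * (n + 1)) * cexp (2 * Real.pi * I * n * x)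

lemma theta_add_int (δ x : ℂ) (k : ℤ) :
    theta δ (x + k) = cexp (Real.pi * I * k) * theta δ x := by
  unfold theta
  have h : ∀ n : ℤ, cexp (2 * Real.pi * I * n * (x + k)) = cexp (2 * Real.pi * I * n * x) := by
    intro n
    rw [show 2 * Real.pi * I * n * (x + k) = 2 * Real.pi * I * n * x
      + ((n * k : ℤ) : ℂ) * (2 * Real.pi * I) by push_cast; ring, Complex.exp_add,
      Complex.exp_int_mul_two_pi_mul_I, mul_one]
  simp only [h]
  rw [mul_add, Complex.exp_add]
  ring

/-! ### The Poisson algebra -/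

/-- The index set `ℤ ∖ {0}` of the generators. -/
abbrev Mode : Type := {n : ℤ // n ≠ 0}

/-- The index `-n`. -/
def Mode.opp (n : Mode) : Mode := ⟨-n.1, neg_ne_zero.mpr n.2⟩

@[simp] lemma Mode.coe_opp (n : Mode) : (n.opp : ℤ) = -n := rfl

@[simp] lemma Mode.opp_opp (n : Mode) : n.opp.opp = n := Subtype.ext (neg_neg _)

/-- The structure constant `(1 - q^n)(1 - p^n q^{-n}) / (1 - p^n)` with `q = e^{2πiγ}` and
`p = e^{2πiδ}`. -/
def structConst (γ δ : ℂ) (n : ℤ) : ℂ :=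
  (1 - cexp (2 * Real.pi * I * γ) ^ n) *
      (1 - cexp (2 * Real.pi * I * δ) ^ n * cexp (2 * Real.pi * I * γ) ^ (-n)) /
    (1 - cexp (2 * Real.pi * I * δ) ^ n)

lemma structConst_neg (γ δ : ℂ) (n : ℤ) : structConst γ δ (-n) = -structConst γ δ n := by
  unfold structConst
  have hq : cexp (2 * Real.pi * I * γ) ^ n ≠ 0 := zpow_ne_zero _ (Complex.exp_ne_zero _)
  have hp : cexp (2 * Real.pi * I * δ) ^ n ≠ 0 := zpow_ne_zero _ (Complex.exp_ne_zero _)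
  simp only [neg_neg, zpow_neg]
  generalize cexp (2 * Real.pi * I * γ) ^ n = a at *
  generalize cexp (2 * Real.pi * I * δ) ^ n = b at *
  by_cases hb : b = 1
  · simp [hb]
  · have h1 : 1 - b ≠ 0 := sub_ne_zero.mpr (Ne.symm hb)
    have h2 : 1 - b⁻¹ ≠ 0 := by
      rw [sub_ne_zero]; intro h; exact hb (inv_eq_one.mp h.symm)
    rw [← neg_div, div_eq_div_iff h2 h1]
    field_simp
    ring

/-- Formal power series in the generators `λ_n`, `n ∈ ℤ ∖ {0}`. -/
abbrev Series : Type := MvPowerSeries Mode ℂ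

/-- The weight of a monomial, for which `λ_n` has weight `n`. -/
def wt : (Mode →₀ ℕ) →+ ℤ := Finsupp.weight fun n : Mode => (n : ℤ)

@[simp] lemma wt_single (n : Mode) : wt (Finsupp.single n 1) = n := by
  simp [wt, Finsupp.weight_apply]

/-- The completed algebra generated by the `λ_n`: formal power series in the `λ_n` in which only
finitely many weights occur (infinitely many monomials of the same weight are allowed). -/
def PoissonAlg : Subalgebra ℂ Series where
  carrier := {F | {w | ∃ m, MvPowerSeries.coeff m F ≠ 0 ∧ wt m = w}.Finite}
  mul_mem' := by
    classical
    intro F G hF hG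
    refine (hF.add hG).subset ?_
    rintro w ⟨m, hm, rfl⟩
    rw [MvPowerSeries.coeff_mul] at hm
    obtain ⟨⟨a, b⟩, hab, h⟩ := Finset.exists_ne_zero_of_sum_ne_zero hm
    rw [Finset.HasAntidiagonal.mem_antidiagonal] at hab
    refine ⟨wt a, ⟨a, left_ne_zero_of_mul h, rfl⟩, wt b, ⟨b, right_ne_zero_of_mul h, rfl⟩, ?_⟩
    simp only at hab ⊢
    rw [← map_add, hab]
  add_mem' := by
    intro F G hF hG
    refine (hF.union hG).subset ?_
    rintro w ⟨m, hm, rfl⟩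
    by_contra hw
    simp only [Set.mem_union, Set.mem_ofPred_eq, not_or, not_exists, not_and] at hw
    have h1 : MvPowerSeries.coeff m F = 0 := by
      by_contra h; exact hw.1 m h rfl
    have h2 : MvPowerSeries.coeff m G = 0 := by
      by_contra h; exact hw.2 m h rfl
    exact hm (by rw [map_add, h1, h2, add_zero])
  algebraMap_mem' := by
    classical
    intro r
    refine (Set.finite_singleton (0 : ℤ)).subset ?_
    rintro w ⟨m, hm, rfl⟩
    rw [MvPowerSeries.algebraMap_apply, MvPowerSeries.coeff_C] at hm
    by_cases h : m = 0
    · simp [h]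
    · simp [h] at hm

/-- The generator `λ_n`. -/
def gen (n : Mode) : PoissonAlg :=
  ⟨MvPowerSeries.X n, by
    classical
    refine (Set.finite_singleton (n : ℤ)).subset ?_
    rintro w ⟨m, hm, rfl⟩
    rw [MvPowerSeries.coeff_X] at hm
    by_cases h : m = Finsupp.single n 1
    · simp [h]
    · simp [h] at hm⟩

/-- The Poisson bracket `{F, G} = ∑_n c_n (∂F/∂λ_n) (∂G/∂λ_{-n})`, where `c_n` is the structure
constant. Each coefficient is a finite sum when only finitely many weights occur in `F`, see
`finite_support_bracketTerm`. -/
def bracketFun (γ δ : ℂ) (F G : Series) : Series := fun m =>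
  ∑ᶠ n : Mode, structConst γ δ n *
    MvPowerSeries.coeff m (MvPowerSeries.pderiv ℂ n F * MvPowerSeries.pderiv ℂ n.opp G)

lemma coeff_bracketFun (γ δ : ℂ) (F G : Series) (m : Mode →₀ ℕ) :
    MvPowerSeries.coeff m (bracketFun γ δ F G) =
      ∑ᶠ n : Mode, structConst γ δ n *
        MvPowerSeries.coeff m (MvPowerSeries.pderiv ℂ n F * MvPowerSeries.pderiv ℂ n.opp G) :=
  rfl

lemma finite_modes {F : Series} (hF : F ∈ PoissonAlg) (m : Mode →₀ ℕ) :
    {n : Mode | ∃ a ≤ m, MvPowerSeries.coeff a (MvPowerSeries.pderiv ℂ n F) ≠ 0}.Finite := by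
  have hS : {w | ∃ m, MvPowerSeries.coeff m F ≠ 0 ∧ wt m = w}.Finite := hF
  have hT : (wt '' Set.Iic m).Finite := (Set.finite_Iic m).image _
  refine Set.Finite.of_finite_image (f := Subtype.val) ((hS.sub hT).subset ?_)
    Subtype.val_injective.injOn
  rintro _ ⟨n, ⟨a, ha, h⟩, rfl⟩
  rw [MvPowerSeries.coeff_pderiv] at h
  refine ⟨_, ⟨_, left_ne_zero_of_mul h, rfl⟩, _, ⟨a, ha, rfl⟩, ?_⟩
  simp

lemma coeff_mul_eq_zero {n : Mode} {F G : Series} {m : Mode →₀ ℕ}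
    (h : ∀ a ≤ m, MvPowerSeries.coeff a (MvPowerSeries.pderiv ℂ n F) = 0) :
    MvPowerSeries.coeff m (MvPowerSeries.pderiv ℂ n F * G) = 0 := by
  classical
  rw [MvPowerSeries.coeff_mul]
  refine Finset.sum_eq_zero fun x hx => ?_
  rw [h x.1 (le_iff_exists_add.mpr ⟨x.2, (Finset.HasAntidiagonal.mem_antidiagonal.mp hx).symm⟩),
    zero_mul]

lemma finite_support_bracketTerm (γ δ : ℂ) {F : Series} (hF : F ∈ PoissonAlg) (G : Series)
    (m : Mode →₀ ℕ) :
    (Function.support fun n : Mode => structConst γ δ n * MvPowerSeries.coeff m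
      (MvPowerSeries.pderiv ℂ n F * MvPowerSeries.pderiv ℂ n.opp G)).Finite := by
  refine (finite_modes hF m).subset fun n hn => ?_
  by_contra h
  simp only [Set.mem_ofPred_eq, not_exists, not_and, not_not] at h
  exact hn (by simp only [coeff_mul_eq_zero h, mul_zero])

/-- The bracket restricted to finitely many modes. -/
def bracketFin (γ δ : ℂ) (s : Finset Mode) (F G : Series) : Series :=
  ∑ n ∈ s, structConst γ δ n • (MvPowerSeries.pderiv ℂ n F * MvPowerSeries.pderiv ℂ n.opp G)

lemma eventually_bracketFin (γ δ : ℂ) {F : Series} (hF : F ∈ PoissonAlg) (G : Series)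
    (Gs : Finset Mode → Series)
    (hG : ∀ m, ∀ᶠ s in atTop, MvPowerSeries.coeff m G = MvPowerSeries.coeff m (Gs s))
    (m : Mode →₀ ℕ) :
    ∀ᶠ s in atTop, MvPowerSeries.coeff m (bracketFun γ δ F G) =
      MvPowerSeries.coeff m (bracketFin γ δ s F (Gs s)) := by
  classical
  set T := (finite_modes hF m).toFinset with hT
  have hz : ∀ n ∉ T, ∀ a ≤ m, MvPowerSeries.coeff a (MvPowerSeries.pderiv ℂ n F) = 0 := by
    intro n hn a ha
    by_contra h
    exact hn ((Set.Finite.mem_toFinset _).mpr ⟨a, ha, h⟩)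
  have h1 : ∀ᶠ s in atTop, ∀ n ∈ T, ∀ x ∈ Finset.HasAntidiagonal.antidiagonal m,
      MvPowerSeries.coeff (x.2 + Finsupp.single n.opp 1) G =
        MvPowerSeries.coeff (x.2 + Finsupp.single n.opp 1) (Gs s) := by
    rw [eventually_all_finset]
    intro n _
    rw [eventually_all_finset]
    intro x _
    exact hG _
  filter_upwards [h1, eventually_ge_atTop T] with s hs hTs
  rw [coeff_bracketFun, bracketFin, map_sum,
    finsum_eq_sum_of_support_subset (s := s)]
  · refine Finset.sum_congr rfl fun n _ => ?_
    rw [map_smul, smul_eq_mul]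
    by_cases hn : n ∈ T
    · rw [MvPowerSeries.coeff_mul, MvPowerSeries.coeff_mul]
      congr 1
      refine Finset.sum_congr rfl fun x hx => ?_
      rw [MvPowerSeries.coeff_pderiv _ x.2, MvPowerSeries.coeff_pderiv _ x.2, hs n hn x hx]
    · rw [coeff_mul_eq_zero (hz n hn), coeff_mul_eq_zero (hz n hn)]
  · intro n hn
    by_contra h
    exact hn (by simp only [coeff_mul_eq_zero (hz n fun h' => h (hTs h')), mul_zero])

lemma bracketFun_mem (γ δ : ℂ) {F G : Series} (hF : F ∈ PoissonAlg) (hG : G ∈ PoissonAlg) :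
    bracketFun γ δ F G ∈ PoissonAlg := by
  classical
  have hS : {w | ∃ m, MvPowerSeries.coeff m F ≠ 0 ∧ wt m = w}.Finite := hF
  have hT : {w | ∃ m, MvPowerSeries.coeff m G ≠ 0 ∧ wt m = w}.Finite := hG
  refine (hS.add hT).subset ?_
  rintro w ⟨m, hm, rfl⟩
  rw [coeff_bracketFun] at hm
  obtain ⟨n, hn⟩ : ∃ n : Mode, structConst γ δ n * MvPowerSeries.coeff m
      (MvPowerSeries.pderiv ℂ n F * MvPowerSeries.pderiv ℂ n.opp G) ≠ 0 := by
    by_contra! h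
    exact hm (by simp only [h, finsum_zero])
  have hn := right_ne_zero_of_mul hn
  rw [MvPowerSeries.coeff_mul] at hn
  obtain ⟨⟨a, b⟩, hab, h⟩ := Finset.exists_ne_zero_of_sum_ne_zero hn
  rw [Finset.HasAntidiagonal.mem_antidiagonal] at hab
  simp only [MvPowerSeries.coeff_pderiv] at h hab
  refine ⟨_, ⟨_, left_ne_zero_of_mul (left_ne_zero_of_mul h), rfl⟩,
    _, ⟨_, left_ne_zero_of_mul (right_ne_zero_of_mul h), rfl⟩, ?_⟩
  simp only [map_add, wt_single, Mode.coe_opp, ← hab]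
  ring

/-- The Poisson bracket on the completed algebra, as a bilinear map. -/
def poissonBracket (γ δ : ℂ) : PoissonAlg →ₗ[ℂ] PoissonAlg →ₗ[ℂ] PoissonAlg :=
  LinearMap.mk₂ ℂ (fun F G => ⟨bracketFun γ δ F G, bracketFun_mem γ δ F.2 G.2⟩)
    (by
      intro F F' G
      ext m
      simp only [AddMemClass.coe_add, map_add, coeff_bracketFun]
      rw [← finsum_add_distrib (finite_support_bracketTerm γ δ F.2 _ m)
        (finite_support_bracketTerm γ δ F'.2 _ m)]
      exact finsum_congr fun n => by rw [add_mul, map_add, mul_add])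
    (by
      intro c F G
      ext m
      simp only [SetLike.val_smul, map_smul, coeff_bracketFun, smul_eq_mul]
      rw [mul_finsum]
      exact finsum_congr fun n => by rw [Derivation.map_smul, smul_mul_assoc, map_smul, smul_eq_mul]; ring)
    (by
      intro F G G'
      ext m
      simp only [AddMemClass.coe_add, map_add, coeff_bracketFun]
      rw [← finsum_add_distrib (finite_support_bracketTerm γ δ F.2 _ m)
        (finite_support_bracketTerm γ δ F.2 _ m)]
      exact finsum_congr fun n => by rw [mul_add, map_add, mul_add])
    (by
      intro c F G
      ext m
      simp only [SetLike.val_smul, map_smul, coeff_bracketFun, smul_eq_mul]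
      rw [mul_finsum]
      exact finsum_congr fun n => by rw [Derivation.map_smul, mul_smul_comm, map_smul, smul_eq_mul]; ring)

lemma coe_poissonBracket (γ δ : ℂ) (F G : PoissonAlg) :
    (poissonBracket γ δ F G : Series) = bracketFun γ δ F G := rfl

/-- The defining relation of the generators. -/
lemma poissonBracket_gen (γ δ : ℂ) (n m : Mode) :
    poissonBracket γ δ (gen n) (gen m) =
      algebraMap ℂ PoissonAlg (if (n : ℤ) + m = 0 then structConst γ δ n else 0) := by
  classical
  ext d
  rw [coe_poissonBracket, coeff_bracketFun]
  simp only [gen]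
  rw [finsum_eq_single _ n]
  · rw [MvPowerSeries.pderiv_X_self, one_mul, MvPowerSeries.pderiv_X]
    have : n.opp = m ↔ (n : ℤ) + m = 0 := by
      rw [Subtype.ext_iff, Mode.coe_opp]; omega
    rw [SubalgebraClass.coe_algebraMap, MvPowerSeries.algebraMap_apply, MvPowerSeries.coeff_C,
      Pi.single_apply]
    by_cases h : (n : ℤ) + m = 0
    · rw [if_pos h, if_pos (this.mpr h).symm, MvPowerSeries.coeff_one]
      split_ifs <;> simp
    · rw [if_neg h, if_neg fun h' => h (this.mp h'.symm)]
      simp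
  · intro k hk
    rw [MvPowerSeries.pderiv_X_of_ne hk.symm, zero_mul, map_zero, mul_zero]

lemma poissonBracket_leibniz (γ δ : ℂ) (F G H : PoissonAlg) :
    poissonBracket γ δ F (G * H) =
      poissonBracket γ δ F G * H + G * poissonBracket γ δ F H := by
  classical
  ext m
  have key : ∀ᶠ s in atTop, MvPowerSeries.coeff m (bracketFun γ δ F (G * H)) =
      MvPowerSeries.coeff m (bracketFin γ δ s F G * (H : Series) +
        (G : Series) * bracketFin γ δ s F H) := by
    filter_upwards [eventually_bracketFin γ δ F.2 (G * H : Series) (fun _ => (G * H : Series))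
      (fun _ => Eventually.of_forall fun _ => rfl) m] with s hs
    rw [hs]
    congr 1
    simp only [bracketFin, Finset.sum_mul, Finset.mul_sum, ← Finset.sum_add_distrib]
    refine Finset.sum_congr rfl fun n _ => ?_
    rw [Derivation.leibniz]
    simp only [smul_eq_mul, MvPowerSeries.smul_eq_C_mul]
    ring
  have hcongr : ∀ K : PoissonAlg, ∀ᶠ s in atTop, ∀ x ∈ Finset.HasAntidiagonal.antidiagonal m,
      MvPowerSeries.coeff x.1 (bracketFun γ δ F K) =
        MvPowerSeries.coeff x.1 (bracketFin γ δ s F K) ∧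
      MvPowerSeries.coeff x.2 (bracketFun γ δ F K) =
        MvPowerSeries.coeff x.2 (bracketFin γ δ s F K) := by
    intro K
    rw [eventually_all_finset]
    intro x _
    exact (eventually_bracketFin γ δ F.2 K (fun _ => K)
      (fun _ => Eventually.of_forall fun _ => rfl) x.1).and
      (eventually_bracketFin γ δ F.2 K (fun _ => K)
      (fun _ => Eventually.of_forall fun _ => rfl) x.2)
  obtain ⟨s, h1, h2, h3⟩ := (key.and ((hcongr G).and (hcongr H))).exists
  simp only [AddMemClass.coe_add, MulMemClass.coe_mul, coe_poissonBracket]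
  rw [h1, map_add, map_add]
  simp only [MvPowerSeries.coeff_mul]
  congr 1
  · exact Finset.sum_congr rfl fun x hx => by rw [(h2 x hx).1]
  · exact Finset.sum_congr rfl fun x hx => by rw [(h3 x hx).2]

lemma sum_opp {M : Type*} [AddCommMonoid M] {s : Finset Mode} (hs : ∀ n ∈ s, n.opp ∈ s)
    (f : Mode → M) : ∑ n ∈ s, f n.opp = ∑ n ∈ s, f n :=
  Finset.sum_bij' (fun n _ => n.opp) (fun n _ => n.opp) hs hs (by simp) (by simp) (by simp)

lemma exists_opp_closed {P : Finset Mode → Prop} (h : ∀ᶠ s in atTop, P s) :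
    ∃ s, P s ∧ ∀ n ∈ s, n.opp ∈ s := by
  classical
  obtain ⟨t, ht⟩ := eventually_atTop.mp h
  refine ⟨t ∪ t.image Mode.opp, ht _ Finset.subset_union_left, fun n hn => ?_⟩
  rw [Finset.mem_union, Finset.mem_image] at hn ⊢
  rcases hn with hn | ⟨k, hk, rfl⟩
  · exact Or.inr ⟨n, hn, rfl⟩
  · exact Or.inl (by simpa using hk)

lemma poissonBracket_antisymm (γ δ : ℂ) (F G : PoissonAlg) :
    poissonBracket γ δ F G = -poissonBracket γ δ G F := by
  ext m
  have hF := eventually_bracketFin γ δ F.2 G (fun _ => G)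
    (fun _ => Eventually.of_forall fun _ => rfl) m
  have hG := eventually_bracketFin γ δ G.2 F (fun _ => F)
    (fun _ => Eventually.of_forall fun _ => rfl) m
  obtain ⟨s, ⟨h1, h2⟩, hs⟩ := exists_opp_closed (hF.and hG)
  rw [NegMemClass.coe_neg, map_neg, coe_poissonBracket, coe_poissonBracket, h1, h2, ← map_neg]
  congr 1
  simp only [bracketFin]
  rw [← sum_opp hs, ← Finset.sum_neg_distrib]
  refine Finset.sum_congr rfl fun n _ => ?_
  rw [Mode.coe_opp, structConst_neg, Mode.opp_opp, neg_smul, mul_comm]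

lemma pderiv_comm (n k : Mode) (F : Series) :
    MvPowerSeries.pderiv ℂ n (MvPowerSeries.pderiv ℂ k F) =
      MvPowerSeries.pderiv ℂ k (MvPowerSeries.pderiv ℂ n F) := by
  ext m
  by_cases h : n = k
  · rw [h]
  · simp only [MvPowerSeries.coeff_pderiv, Finsupp.add_apply,
      Finsupp.single_eq_of_ne h, Finsupp.single_eq_of_ne (Ne.symm h), add_zero]
    rw [add_right_comm]
    ring

lemma bracketFin_jacobi (γ δ : ℂ) {s : Finset Mode} (hs : ∀ n ∈ s, n.opp ∈ s) (F G H : Series) :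
    bracketFin γ δ s F (bracketFin γ δ s G H) + bracketFin γ δ s G (bracketFin γ δ s H F) +
      bracketFin γ δ s H (bracketFin γ δ s F G) = 0 := by
  let a (F G H : Series) : Series := ∑ n ∈ s, ∑ k ∈ s,
    MvPowerSeries.C (structConst γ δ n * structConst γ δ k) * (MvPowerSeries.pderiv ℂ n F *
      MvPowerSeries.pderiv ℂ n.opp (MvPowerSeries.pderiv ℂ k G) *
      MvPowerSeries.pderiv ℂ k.opp H)
  let b (F G H : Series) : Series := ∑ n ∈ s, ∑ k ∈ s,
    MvPowerSeries.C (structConst γ δ n * structConst γ δ k) * (MvPowerSeries.pderiv ℂ n F *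
      MvPowerSeries.pderiv ℂ k G *
      MvPowerSeries.pderiv ℂ n.opp (MvPowerSeries.pderiv ℂ k.opp H))
  have hab : ∀ F G H, bracketFin γ δ s F (bracketFin γ δ s G H) = a F G H + b F G H := by
    intro F G H
    simp only [bracketFin, a, b, map_sum, ← Finset.sum_add_distrib, Finset.mul_sum,
      Finset.smul_sum]
    refine Finset.sum_congr rfl fun n _ => Finset.sum_congr rfl fun k _ => ?_
    rw [Derivation.map_smul, Derivation.leibniz]
    simp only [smul_eq_mul, MvPowerSeries.smul_eq_C_mul, map_mul]
    ring
  have hanti : ∀ F G H, a G H F = -b F G H := by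
    intro F G H
    simp only [a, b]
    rw [Finset.sum_comm, ← sum_opp hs, ← Finset.sum_neg_distrib]
    refine Finset.sum_congr rfl fun n _ => ?_
    rw [← Finset.sum_neg_distrib]
    refine Finset.sum_congr rfl fun k _ => ?_
    rw [Mode.coe_opp, structConst_neg, Mode.opp_opp, pderiv_comm k.opp n.opp]
    simp only [map_mul, map_neg]
    ring
  rw [hab, hab, hab, hanti F G H, hanti G H F, hanti H F G]
  ring

lemma poissonBracket_jacobi (γ δ : ℂ) (F G H : PoissonAlg) :
    poissonBracket γ δ F (poissonBracket γ δ G H) +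
      poissonBracket γ δ G (poissonBracket γ δ H F) +
      poissonBracket γ δ H (poissonBracket γ δ F G) = 0 := by
  ext m
  have key : ∀ F G H : PoissonAlg, ∀ᶠ s in atTop,
      MvPowerSeries.coeff m (bracketFun γ δ F (bracketFun γ δ G H)) =
        MvPowerSeries.coeff m (bracketFin γ δ s F (bracketFin γ δ s G H)) := fun F G H =>
    eventually_bracketFin γ δ F.2 _ _ (eventually_bracketFin γ δ G.2 H (fun _ => H)
      (fun _ => Eventually.of_forall fun _ => rfl)) m
  obtain ⟨s, ⟨h1, h2, h3⟩, hs⟩ :=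
    exists_opp_closed ((key F G H).and ((key G H F).and (key H F G)))
  simp only [AddMemClass.coe_add, coe_poissonBracket, map_add, ZeroMemClass.coe_zero]
  rw [h1, h2, h3, ← map_add, ← map_add, bracketFin_jacobi γ δ hs]

/-! ### The field `η` and the integrals `I_n` -/

/-- The formal series `∑_{n ≠ 0} λ_n e^{-2πinx}` (for each monomial, at most one term of the sum
contributes). -/
def logField (x : ℝ) : Series := fun m =>
  ∑ᶠ n : Mode, cexp (-(2 * Real.pi * I * (n : ℤ) * x)) *
    MvPowerSeries.coeff m (MvPowerSeries.X n : Series)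

lemma coeff_logField_single (x : ℝ) (n : Mode) :
    MvPowerSeries.coeff (Finsupp.single n 1) (logField x) =
      cexp (-(2 * Real.pi * I * (n : ℤ) * x)) := by
  classical
  change ∑ᶠ k : Mode, _ = _
  rw [finsum_eq_single _ n, MvPowerSeries.coeff_X, if_pos rfl, mul_one]
  intro k hk
  rw [MvPowerSeries.coeff_X, if_neg, mul_zero]
  intro h
  exact hk (Finsupp.single_left_injective one_ne_zero h).symm

lemma coeff_logField_of_ne (x : ℝ) {m : Mode →₀ ℕ} (hm : ∀ n, m ≠ Finsupp.single n 1) :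
    MvPowerSeries.coeff m (logField x) = 0 := by
  classical
  change ∑ᶠ k : Mode, _ = _
  refine finsum_eq_zero_of_forall_eq_zero fun n => ?_
  rw [MvPowerSeries.coeff_X, if_neg (hm n), mul_zero]

/-- `η(x) = ε exp (∑_{n ≠ 0} λ_n e^{-2πinx})`, a formal power series in the `λ_n`. -/
def eta (ε : ℂ) (x : ℝ) : Series :=
  ε • (PowerSeries.exp ℂ).subst (logField x)

lemma hasSubst_logField (x : ℝ) : PowerSeries.HasSubst (logField x) := by
  refine PowerSeries.HasSubst.of_constantCoeff_zero ?_
  rw [← MvPowerSeries.coeff_zero_eq_constantCoeff_apply]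
  refine coeff_logField_of_ne x fun n h => ?_
  exact one_ne_zero (Finsupp.single_eq_zero.mp h.symm)

/-- The kernel `∏_{i<j} ϑ₁(x_i - x_j)² / (ϑ₁(x_i - x_j + γ) ϑ₁(x_i - x_j - γ))`. -/
def kernel (γ δ : ℂ) {n : ℕ} (x : Fin n → ℝ) : ℂ :=
  ∏ i, ∏ j ∈ Finset.Ioi i, theta δ (x i - x j) ^ 2 /
    (theta δ (x i - x j + γ) * theta δ (x i - x j - γ))

/-- The constant `(-1)^{n-1} (1/n!) ϑ₁'(0)^{n-1} ϑ₁(nγ) / ((2πi)^{n-1} ϑ₁(γ)^n)`, for `n ≥ 1`. -/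
def prefactor (γ δ : ℂ) (n : ℕ) : ℂ :=
  (-1) ^ (n - 1) * (1 / (n.factorial : ℂ)) *
    (deriv (theta δ) 0 ^ (n - 1) * theta δ (n * γ) /
      ((2 * Real.pi * I) ^ (n - 1) * theta δ γ ^ n))

/-- The quantity `I_n` as a formal power series in the `λ_m`; the multiple integral over
`[-1/2, 1/2]^n` of the series-valued integrand is taken coefficient by coefficient. -/
def hamiltonianSeries (γ δ ε : ℂ) (n : ℕ) : Series := fun m =>
  prefactor γ δ n *
    ∫ x : Fin n → ℝ in Set.univ.pi fun _ => Set.Ioc (-1 / 2 : ℝ) (1 / 2),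
      kernel γ δ x * MvPowerSeries.coeff m (∏ i, eta ε (x i))

/-! ### The series `I_n` lie in the Poisson algebra: they have weight zero -/

/-- Translation by `t` multiplies `λ_n` by `e^{-2πint}`. -/
lemma eta_add (ε : ℂ) (x t : ℝ) :
    eta ε (x + t) =
      MvPowerSeries.rescale (fun n : Mode => cexp (-(2 * Real.pi * I * (n : ℤ) * t))) (eta ε x) := by
  set r : Mode → ℂ := fun n => cexp (-(2 * Real.pi * I * (n : ℤ) * t)) with hr
  have hL : logField (x + t) = MvPowerSeries.rescale r (logField x) := by
    ext m
    rw [MvPowerSeries.coeff_rescale]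
    by_cases h : ∃ n, m = Finsupp.single n 1
    · obtain ⟨n, rfl⟩ := h
      rw [coeff_logField_single, coeff_logField_single, Finsupp.prod_single_index (by simp),
        pow_one, hr, ← Complex.exp_add]
      congr 1
      push_cast
      ring
    · push Not at h
      rw [coeff_logField_of_ne _ h, coeff_logField_of_ne _ h, mul_zero]
  ext m
  rw [MvPowerSeries.coeff_rescale, eta, eta, map_smul, map_smul,
    PowerSeries.coeff_subst (hasSubst_logField _), PowerSeries.coeff_subst (hasSubst_logField _),
    smul_eq_mul, smul_eq_mul, mul_left_comm]
  congr 1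
  rw [mul_finsum]
  refine finsum_congr fun d => ?_
  rw [hL, ← map_pow, MvPowerSeries.coeff_rescale, smul_eq_mul, smul_eq_mul]
  ring

lemma coeff_prod_eta_add {n : ℕ} (ε : ℂ) (x : Fin n → ℝ) (t : ℝ) (m : Mode →₀ ℕ) :
    MvPowerSeries.coeff m (∏ i, eta ε (x i + t)) =
      cexp (-(2 * Real.pi * I * (wt m) * t)) * MvPowerSeries.coeff m (∏ i, eta ε (x i)) := by
  simp only [eta_add, ← map_prod, MvPowerSeries.coeff_rescale]
  congr 1
  simp only [wt, Finsupp.weight_apply, Finsupp.prod, Finsupp.sum, ← Complex.exp_nat_mul,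
    ← Complex.exp_sum]
  congr 1
  push_cast
  rw [Finset.mul_sum, Finset.sum_mul, ← Finset.sum_neg_distrib]
  refine Finset.sum_congr rfl fun k _ => ?_
  simp only [nsmul_eq_mul]
  push_cast
  ring

lemma eta_add_int (ε : ℂ) (x : ℝ) (k : ℤ) : eta ε (x + k) = eta ε x := by
  rw [eta_add]
  have : (fun n : Mode => cexp (-(2 * Real.pi * I * (n : ℤ) * ((k : ℝ) : ℂ)))) = 1 := by
    funext n
    rw [Pi.one_apply, show -(2 * Real.pi * I * (n : ℤ) * ((k : ℝ) : ℂ)) =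
      ((-(n * k) : ℤ) : ℂ) * (2 * Real.pi * I) by push_cast; ring,
      Complex.exp_int_mul_two_pi_mul_I]
  rw [this, MvPowerSeries.rescale_one, RingHom.id_apply]

lemma kernel_add_int (γ δ : ℂ) {n : ℕ} (x : Fin n → ℝ) (k : Fin n → ℤ) :
    kernel γ δ (fun i => x i + k i) = kernel γ δ x := by
  unfold kernel
  refine Finset.prod_congr rfl fun i _ => Finset.prod_congr rfl fun j _ => ?_
  have h0 : (((x i + k i : ℝ) : ℂ) - ((x j + k j : ℝ) : ℂ)) =
      ((x i : ℂ) - x j) + ((k i - k j : ℤ) : ℂ) := by push_cast; ring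
  have h1 : ((x i : ℂ) - x j) + ((k i - k j : ℤ) : ℂ) + γ =
      ((x i : ℂ) - x j + γ) + ((k i - k j : ℤ) : ℂ) := by ring
  have h2 : ((x i : ℂ) - x j) + ((k i - k j : ℤ) : ℂ) - γ =
      ((x i : ℂ) - x j - γ) + ((k i - k j : ℤ) : ℂ) := by ring
  rw [h0, h1, h2, theta_add_int, theta_add_int, theta_add_int]
  have hc : cexp (Real.pi * I * ((k i - k j : ℤ) : ℂ)) ≠ 0 := Complex.exp_ne_zero _
  rw [show ∀ c a b d : ℂ, (c * a) ^ 2 / ((c * b) * (c * d)) = (c ^ 2 * a ^ 2) / (c ^ 2 * (b * d)) by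
    intros; congr 1 <;> ring, mul_div_mul_left _ _ (pow_ne_zero 2 hc)]

lemma kernel_add (γ δ : ℂ) {n : ℕ} (x : Fin n → ℝ) (t : ℝ) :
    kernel γ δ (fun i => x i + t) = kernel γ δ x := by
  unfold kernel
  refine Finset.prod_congr rfl fun i _ => Finset.prod_congr rfl fun j _ => ?_
  have h0 : (((x i + t : ℝ) : ℂ) - ((x j + t : ℝ) : ℂ)) = ((x i : ℂ) - x j) := by push_cast; ring
  rw [h0]

/-- Vectors with integer coordinates. -/
def intLattice (n : ℕ) : AddSubgroup (Fin n → ℝ) :=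
  ((Int.castAddHom ℝ).compLeft (Fin n)).range

lemma isAddFundamentalDomain_box (n : ℕ) (v : ℝ) :
    IsAddFundamentalDomain (intLattice n)
      (Set.univ.pi fun _ : Fin n => Set.Ioc v (v + 1)) volume := by
  refine IsAddFundamentalDomain.mk'
    (MeasurableSet.univ_pi fun _ => measurableSet_Ioc).nullMeasurableSet fun x => ?_
  choose k hk huniq using fun i => existsUnique_add_zsmul_mem_Ioc (zero_lt_one' ℝ) (x i) v
  refine ⟨⟨fun i => (k i : ℝ), k, rfl⟩, ?_, ?_⟩
  · intro i _
    have := hk i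
    simp only [zsmul_eq_mul, mul_one] at this
    change (k i : ℝ) + x i ∈ _
    rwa [add_comm (k i : ℝ)]
  · rintro ⟨_, k', rfl⟩ h
    ext i
    have h' : ((k' i : ℤ) : ℝ) + x i ∈ Set.Ioc v (v + 1) := h i trivial
    have := huniq i (k' i) (by simpa [add_comm] using h')
    change ((k' i : ℤ) : ℝ) = (k i : ℝ)
    rw [this]

instance (n : ℕ) : Countable (intLattice n) := by
  have : Countable (Set.range ((Int.castAddHom ℝ).compLeft (Fin n))) :=
    (Set.countable_range _).to_subtype
  exact this

lemma integral_box_translate {n : ℕ} (f : (Fin n → ℝ) → ℂ)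
    (hf : ∀ (x : Fin n → ℝ) (k : Fin n → ℤ), f (fun i => x i + k i) = f x) (t : ℝ) :
    ∫ x in Set.univ.pi fun _ => Set.Ioc (-1 / 2 : ℝ) (1 / 2), f (fun i => x i + t) =
      ∫ x in Set.univ.pi fun _ => Set.Ioc (-1 / 2 : ℝ) (1 / 2), f x := by
  have h1 := (measurePreserving_add_right (volume : Measure (Fin n → ℝ))
    (fun _ => t)).setIntegral_preimage_emb
    (MeasurableEquiv.addRight (fun _ : Fin n => t)).measurableEmbedding f
    (Set.univ.pi fun _ => Set.Ioc (-1 / 2 + t : ℝ) (1 / 2 + t))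
  have h2 : ((fun x : Fin n → ℝ => x + fun _ => t) ⁻¹'
      (Set.univ.pi fun _ => Set.Ioc (-1 / 2 + t : ℝ) (1 / 2 + t))) =
      Set.univ.pi fun _ => Set.Ioc (-1 / 2 : ℝ) (1 / 2) := by
    ext x
    simp
  rw [h2] at h1
  refine Eq.trans h1 ?_
  have e1 : (1 / 2 + t : ℝ) = (-1 / 2 + t) + 1 := by ring
  have e2 : (1 / 2 : ℝ) = -1 / 2 + 1 := by norm_num
  rw [e1]
  conv_rhs => rw [e2]
  refine (isAddFundamentalDomain_box n _).setIntegral_eq (isAddFundamentalDomain_box n _) ?_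
  rintro ⟨_, k, rfl⟩ x
  rw [← hf x k]
  congr 1
  funext i
  exact add_comm _ _

lemma coeff_hamiltonianSeries_of_wt_ne (γ δ ε : ℂ) (n : ℕ) {m : Mode →₀ ℕ} (hm : wt m ≠ 0) :
    MvPowerSeries.coeff m (hamiltonianSeries γ δ ε n) = 0 := by
  set f : (Fin n → ℝ) → ℂ := fun x => kernel γ δ x * MvPowerSeries.coeff m (∏ i, eta ε (x i))
    with hf
  change prefactor γ δ n *
    (∫ x in Set.univ.pi fun _ => Set.Ioc (-1 / 2 : ℝ) (1 / 2), f x) = 0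
  set J := ∫ x in Set.univ.pi fun _ => Set.Ioc (-1 / 2 : ℝ) (1 / 2), f x with hJ
  have hper : ∀ (x : Fin n → ℝ) (k : Fin n → ℤ), f (fun i => x i + k i) = f x := by
    intro x k
    simp only [hf, kernel_add_int, eta_add_int]
  set t : ℝ := 1 / (2 * wt m) with ht
  have hexp : cexp (-(2 * Real.pi * I * (wt m) * t)) = -1 := by
    have : (wt m : ℂ) ≠ 0 := by exact_mod_cast hm
    rw [show -(2 * Real.pi * I * (wt m) * (t : ℂ)) = -(Real.pi * I) by
      rw [ht]; push_cast; field_simp, Complex.exp_neg, Complex.exp_pi_mul_I]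
    norm_num
  have h := integral_box_translate f hper t
  have h' : ∀ x : Fin n → ℝ, f (fun i => x i + t) = -1 * f x := by
    intro x
    simp only [hf, kernel_add, coeff_prod_eta_add, hexp]
    ring
  simp only [h'] at h
  rw [integral_const_mul, ← hJ] at h
  have : J = 0 := by linear_combination (-1 / 2 : ℂ) * h
  rw [this, mul_zero]

/-- The quantity `I_n`, as an element of the Poisson algebra. -/
def hamiltonian (γ δ ε : ℂ) (n : ℕ) : PoissonAlg :=
  ⟨hamiltonianSeries γ δ ε n, by
    refine (Set.finite_singleton (0 : ℤ)).subset ?_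
    rintro w ⟨m, hm, rfl⟩
    by_contra h
    exact hm (coeff_hamiltonianSeries_of_wt_ne γ δ ε n h)⟩

end EllipticILW

end

/-!
Differentiating `η` multiplies it by a character, so a coefficient of `{I_k, I_l}` is a finite sum
over the modes `n` of integrals over `k + l` variables. In it the structure constants only enter
through `∑ n, c_n e(-n (x_i - x_j))`, summed over `i` among the first `k` variables and `j` among
the last `l`. Insert `r ^ |n|` and let `r → 1` from below. The regularised series `K_r (x_i - x_j)`
converges, away from the diagonal, to a difference of logarithmic derivatives of `ϑ₁`, up to a
constant factor.

The coefficients of `η` are symmetric, so the integrand may be symmetrised: with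
`v x = ϑ₁ x / ϑ₁ (x + γ)` it becomes the sum over all blocks `I` of `k` variables of the product of
the `v (x_i - x_j)` within `I` and within its complement, times `∑ i ∈ I, j ∉ I, K_r (x_i - x_j)`.
In the limit `r → 1` this sum vanishes identically. It is the derivative, at shift zero, of the
elliptic identity saying that a sum over blocks `I` of products over `i ∈ I`, `j ∉ I` is unchanged
when all differences `z_i - z_j` are reversed, which follows from Liouville's theorem by induction
on the number of variables.

The limit passes under the integral because `K_r u` is at most a constant times `1 / |1 - e u|`,
while exchanging `x_i` and `x_j` changes the sign of `K_r (x_i - x_j)`. What multiplies it is thus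
the difference of a Lipschitz function and its reflection, which cancels the singularity.
-/

noncomputable section

namespace EllipticILW

open Topology

/-! ### Doubly periodic functions -/

/-- The lattice generated by `1` and `δ`. -/
def lattice (δ : ℂ) : AddSubgroup ℂ := AddSubgroup.closure {1, δ}

lemma mem_lattice {δ x : ℂ} : x ∈ lattice δ ↔ ∃ m n : ℤ, (m : ℂ) + n * δ = x := by
  simp [lattice, AddSubgroup.mem_closure_pair]

lemma int_mem_lattice (δ : ℂ) (m : ℤ) : (m : ℂ) ∈ lattice δ :=
  mem_lattice.mpr ⟨m, 0, by simp⟩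

lemma periodic_of_mem_lattice {δ : ℂ} {α : Type*} {h : ℂ → α} (hone : h.Periodic 1)
    (hδ : h.Periodic δ) {l : ℂ} (hl : l ∈ lattice δ) : h.Periodic l := by
  induction hl using AddSubgroup.closure_induction with
  | mem l hl =>
    rcases hl with rfl | rfl
    exacts [hone, hδ]
  | zero => exact fun x => by rw [add_zero]
  | add _ _ _ _ ha hb => exact ha.add_period hb
  | neg _ _ ha => exact ha.neg

lemma exists_eq_ofReal_add_ofReal_mul {δ : ℂ} (hδ : δ.im ≠ 0) (x : ℂ) :
    ∃ a b : ℝ, x = a + b * δ :=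
  ⟨x.re - x.im / δ.im * δ.re, x.im / δ.im, Complex.ext (by simp) (by simp [hδ])⟩

lemma map_add_right_nhdsNE (x l : ℂ) : map (· + l) (𝓝[≠] x) = 𝓝[≠] (x + l) :=
  (Homeomorph.addRight l).map_punctured_nhds_eq x

lemma eq_zero_of_mem_lattice_of_norm_lt {δ l : ℂ} (hl : l ∈ lattice δ) (hone : ‖l‖ < 1)
    (him : ‖l‖ < |δ.im|) : l = 0 := by
  obtain ⟨m, n, rfl⟩ := mem_lattice.mp hl
  have hn : n = 0 := by
    have h := (Complex.abs_im_le_norm _).trans_lt him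
    have hδ : 0 < |δ.im| := (norm_nonneg _).trans_lt him
    simp only [add_im, intCast_im, mul_im, intCast_re, zero_mul, add_zero, zero_add,
      abs_mul] at h
    rw [mul_lt_iff_lt_one_left hδ] at h
    exact Int.abs_lt_one_iff.mp (by exact_mod_cast h)
  subst hn
  rw [Int.cast_zero, zero_mul, add_zero, Complex.norm_intCast] at hone
  have hm : m = 0 := Int.abs_lt_one_iff.mp (by exact_mod_cast hone)
  simp [hm]

lemma eventually_notMem_lattice {δ : ℂ} (hδ : δ.im ≠ 0) (x : ℂ) :
    ∀ᶠ y in 𝓝[≠] x, y ∉ lattice δ := by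
  set r := min 1 |δ.im| / 2
  have hr : 0 < r := half_pos (lt_min one_pos (abs_pos.mpr hδ))
  have hsub : ((lattice δ : Set ℂ) ∩ Metric.ball x r).Subsingleton := by
    rintro y ⟨hy, hyr⟩ z ⟨hz, hzr⟩
    have hyz : ‖y - z‖ < min 1 |δ.im| := by
      rw [← dist_eq_norm, ← add_halves (min 1 |δ.im|)]
      exact (dist_triangle_right y z x).trans_lt (add_lt_add hyr hzr)
    exact sub_eq_zero.mp (eq_zero_of_mem_lattice_of_norm_lt (sub_mem hy hz)
      (lt_min_iff.mp hyz).1 (lt_min_iff.mp hyz).2)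
  have hfin := (hsub.finite.subset (Set.sdiff_subset (t := {x}))).isClosed.isOpen_compl.mem_nhds
    (fun h => h.2 rfl : x ∈ (_ \ {x} : Set ℂ)ᶜ)
  filter_upwards [nhdsWithin_le_nhds hfin, nhdsWithin_le_nhds (Metric.ball_mem_nhds x hr),
    self_mem_nhdsWithin] with y hy hyr hyx hyl
  exact hy ⟨⟨hyl, hyr⟩, hyx⟩

lemma eventually_notMem_lattice_sub {δ : ℂ} (hδ : δ.im ≠ 0) (x c : ℂ) :
    ∀ᶠ y in 𝓝[≠] x, y - c ∉ lattice δ := by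
  have h := eventually_notMem_lattice hδ (x + -c)
  rwa [← map_add_right_nhdsNE, eventually_map] at h

section DoublyPeriodic

variable {E : Type*} [NormedAddCommGroup E] {h : ℂ → E} {S : Set ℂ} {δ : ℂ}

lemma limUnder_nhdsNE_eq_of_continuousAt {x : ℂ} (hx : ContinuousAt h x) :
    limUnder (𝓝[≠] x) h = h x :=
  (hx.tendsto.mono_left nhdsWithin_le_nhds).limUnder_eq

lemma periodic_limUnder_nhdsNE {l : ℂ} (hl : h.Periodic l) :
    (fun x => limUnder (𝓝[≠] x) h).Periodic l := by
  intro x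
  change lim (map h (𝓝[≠] (x + l))) = lim (map h (𝓝[≠] x))
  rw [← map_add_right_nhdsNE, map_map, show h ∘ (· + l) = h from funext hl]

variable [NormedSpace ℂ E]

lemma isLittleO_inv_sub_of_tendsto_smul {x : ℂ}
    (hlim : Tendsto (fun y => (y - x) • h y) (𝓝[≠] x) (𝓝 0)) :
    (fun y => h y - h x) =o[𝓝[≠] x] fun y => (y - x)⁻¹ := by
  have hconst : Tendsto (fun y => (y - x) • h x) (𝓝[≠] x) (𝓝 0) := by
    have : Tendsto (fun y => (y - x) • h x) (𝓝 x) (𝓝 ((x - x) • h x)) :=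
      (show Continuous fun y : ℂ => (y - x) • h x by fun_prop).tendsto x
    rw [sub_self, zero_smul] at this
    exact this.mono_left nhdsWithin_le_nhds
  have hsub : (fun y => (y - x) • (h y - h x)) =o[𝓝[≠] x] fun _ => (1 : ℂ) :=
    (Asymptotics.isLittleO_one_iff ℂ).mpr (by simpa only [smul_sub, sub_zero] using hlim.sub hconst)
  refine ((Asymptotics.isBigO_refl (fun y => (y - x)⁻¹) _).smul_isLittleO hsub).congr' ?_
    (.of_forall fun y => by simp)
  filter_upwards [self_mem_nhdsWithin] with y hy
  rw [inv_smul_smul₀ (sub_ne_zero.mpr hy)]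

lemma tendsto_sub_smul_of_continuousAt {x : ℂ} (hx : ContinuousAt h x) :
    Tendsto (fun y => (y - x) • h y) (𝓝[≠] x) (𝓝 0) := by
  have : Tendsto (fun y => (y - x) • h y) (𝓝 x) (𝓝 ((x - x) • h x)) :=
    ((continuous_id.sub continuous_const).tendsto x).smul hx.tendsto
  rw [sub_self, zero_smul] at this
  exact this.mono_left nhdsWithin_le_nhds

lemma differentiable_limUnder_nhdsNE [CompleteSpace E] (hS : ∀ x, ∀ᶠ y in 𝓝[≠] x, y ∉ S)
    (hd : ∀ x ∉ S, DifferentiableAt ℂ h x)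
    (hlim : ∀ x ∈ S, Tendsto (fun y => (y - x) • h y) (𝓝[≠] x) (𝓝 0)) :
    Differentiable ℂ fun x => limUnder (𝓝[≠] x) h := by
  intro x
  have hlim_x : Tendsto (fun y => (y - x) • h y) (𝓝[≠] x) (𝓝 0) := by
    by_cases hx : x ∈ S
    · exact hlim x hx
    · exact tendsto_sub_smul_of_continuousAt (hd x hx).continuousAt
  obtain ⟨U, hU, hUo, hxU⟩ := eventually_nhds_iff.mp (eventually_nhdsWithin_iff.mp (hS x))
  have hupdate := differentiableOn_update_limUnder_of_isLittleO (hUo.mem_nhds hxU)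
    (fun y hy => (hd y (hU y hy.1 hy.2)).differentiableWithinAt)
    (isLittleO_inv_sub_of_tendsto_smul hlim_x)
  refine (hupdate.differentiableAt (hUo.mem_nhds hxU)).congr_of_eventuallyEq ?_
  filter_upwards [hUo.mem_nhds hxU] with y hy
  rcases eq_or_ne y x with rfl | hyx
  · rw [Function.update_self]
  · rw [Function.update_of_ne hyx]
    exact limUnder_nhdsNE_eq_of_continuousAt (hd y (hU y hy hyx)).continuousAt

lemma isBounded_range_of_doublyPeriodic {α : Type*} [PseudoMetricSpace α] {h : ℂ → α}
    (hδ : δ.im ≠ 0) (hc : Continuous h) (hone : h.Periodic 1) (hper : h.Periodic δ) :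
    Bornology.IsBounded (Set.range h) := by
  have hcell : IsCompact ((fun ab : ℝ × ℝ => h (ab.1 + ab.2 * δ)) ''
      (Set.Icc 0 1 ×ˢ Set.Icc 0 1)) :=
    (isCompact_Icc.prod isCompact_Icc).image (hc.comp (by fun_prop))
  refine hcell.isBounded.subset ?_
  rintro _ ⟨x, rfl⟩
  obtain ⟨a, b, rfl⟩ := exists_eq_ofReal_add_ofReal_mul hδ x
  refine ⟨(Int.fract a, Int.fract b), ⟨⟨Int.fract_nonneg _, (Int.fract_lt_one _).le⟩,
    ⟨Int.fract_nonneg _, (Int.fract_lt_one _).le⟩⟩, ?_⟩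
  have hl : ((⌊a⌋ : ℤ) : ℂ) + (⌊b⌋ : ℤ) * δ ∈ lattice δ := mem_lattice.mpr ⟨_, _, rfl⟩
  change h ((Int.fract a : ℝ) + (Int.fract b : ℝ) * δ) = h (a + b * δ)
  rw [← periodic_of_mem_lattice hone hper hl, Int.fract, Int.fract]
  congr 1
  push_cast
  ring

lemma eq_of_differentiable_of_doublyPeriodic (hδ : δ.im ≠ 0) (hd : Differentiable ℂ h)
    (hone : h.Periodic 1) (hper : h.Periodic δ) (x y : ℂ) : h x = h y :=
  hd.apply_eq_apply_of_bounded (isBounded_range_of_doublyPeriodic hδ hd.continuous hone hper) x y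

lemma eq_of_doublyPeriodic_of_removable [CompleteSpace E] (hδ : δ.im ≠ 0)
    (hS : ∀ x, ∀ᶠ y in 𝓝[≠] x, y ∉ S) (hd : ∀ x ∉ S, DifferentiableAt ℂ h x)
    (hone : h.Periodic 1) (hper : h.Periodic δ)
    (hlim : ∀ x ∈ S, Tendsto (fun y => (y - x) • h y) (𝓝[≠] x) (𝓝 0))
    {x y : ℂ} (hx : x ∉ S) (hy : y ∉ S) : h x = h y := by
  have hext := eq_of_differentiable_of_doublyPeriodic hδ
    (differentiable_limUnder_nhdsNE hS hd hlim)
    (periodic_limUnder_nhdsNE hone) (periodic_limUnder_nhdsNE hper) x y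
  rwa [limUnder_nhdsNE_eq_of_continuousAt (hd x hx).continuousAt,
    limUnder_nhdsNE_eq_of_continuousAt (hd y hy).continuousAt] at hext

end DoublyPeriodic

/-! ### Infinite `q`-Pochhammer symbols -/

/-- The character `e(x) = e^{2πix}`, in which all exponential factors are written. -/
def e : ℂ → ℂ := Function.Periodic.qParam 1

lemma e_eq_cexp (x : ℂ) : e x = cexp (2 * Real.pi * I * x) := by
  rw [e, Function.Periodic.qParam, ofReal_one, div_one]

lemma e_ne_zero (x : ℂ) : e x ≠ 0 := Function.Periodic.qParam_ne_zero x

lemma e_add (x y : ℂ) : e (x + y) = e x * e y := by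
  simp only [e_eq_cexp, mul_add, Complex.exp_add]

lemma e_neg (x : ℂ) : e (-x) = (e x)⁻¹ := by
  simp only [e_eq_cexp, mul_neg, Complex.exp_neg]

lemma e_sub (x y : ℂ) : e (x - y) = e x / e y := by
  rw [sub_eq_add_neg, e_add, e_neg, div_eq_mul_inv]

lemma e_zero : e 0 = 1 := by simp [e_eq_cexp]

lemma e_eq_one_iff {x : ℂ} : e x = 1 ↔ ∃ n : ℤ, x = n := by
  rw [e_eq_cexp, Complex.exp_eq_one_iff]
  refine exists_congr fun n => ?_
  rw [mul_comm (n : ℂ), mul_right_inj' Complex.two_pi_I_ne_zero]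

lemma e_int (n : ℤ) : e n = 1 := e_eq_one_iff.mpr ⟨n, rfl⟩

lemma e_one : e 1 = 1 := by simpa using e_int 1

lemma e_int_mul (n : ℤ) (x : ℂ) : e (n * x) = e x ^ n := by
  rw [e_eq_cexp, e_eq_cexp, ← Complex.exp_int_mul, mul_left_comm]

lemma e_nat_mul (n : ℕ) (x : ℂ) : e (n * x) = e x ^ n := by
  exact_mod_cast e_int_mul n x

lemma norm_e_lt_one {x : ℂ} (hx : 0 < x.im) : ‖e x‖ < 1 :=
  Function.Periodic.norm_qParam_lt_one one_pos hx

lemma norm_e_ofReal (x : ℝ) : ‖e x‖ = 1 := by simp [e, Function.Periodic.norm_qParam]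

lemma differentiable_e : Differentiable ℂ e := Function.Periodic.differentiable_qParam

lemma hasDerivAt_e (x : ℂ) : HasDerivAt e (2 * Real.pi * I * e x) x := by
  have h : HasDerivAt (fun y => cexp (2 * Real.pi * I * y))
      (cexp (2 * Real.pi * I * x) * (2 * Real.pi * I * 1)) x :=
    ((hasDerivAt_id x).const_mul _).cexp
  rw [← funext e_eq_cexp, ← e_eq_cexp, mul_one, mul_comm] at h
  exact h

/-- The infinite `q`-Pochhammer symbol `(z; p)_∞`. -/
def qPochhammer (p z : ℂ) : ℂ := ∏' m : ℕ, (1 - p ^ m * z)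

/-- The Lambert series `-z (d/dz) log (z; p)_∞`, written termwise. -/
def lambertSeries (p z : ℂ) : ℂ := ∑' m : ℕ, p ^ m * z / (1 - p ^ m * z)

section QPochhammer

variable {p : ℂ} (hp : ‖p‖ < 1)
include hp

lemma summable_norm_neg_pow_mul (z : ℂ) : Summable fun m : ℕ => ‖-(p ^ m * z)‖ := by
  simp only [norm_neg, norm_mul, norm_pow]
  exact (summable_geometric_of_lt_one (norm_nonneg _) hp).mul_right _

lemma norm_pow_mul_lt_one {z : ℂ} (hz : ‖z‖ < 1) (m : ℕ) : ‖p ^ m * z‖ < 1 := by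
  rw [norm_mul, norm_pow]
  exact mul_lt_one_of_nonneg_of_lt_one_right (pow_le_one₀ (norm_nonneg _) hp.le) (norm_nonneg _) hz

lemma multipliable_one_sub_pow_mul (z : ℂ) : Multipliable fun m : ℕ => 1 - p ^ m * z := by
  simp only [sub_eq_add_neg]
  exact multipliable_one_add_of_summable (summable_norm_neg_pow_mul hp z)

lemma qPochhammer_eq_one_sub_mul (z : ℂ) :
    qPochhammer p z = (1 - z) * qPochhammer p (p * z) := by
  have hshift : ∀ m : ℕ, 1 - p ^ m * (p * z) = 1 - p ^ (m + 1) * z := fun m => by ring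
  have hmul : Multipliable fun m : ℕ => 1 - p ^ (m + 1) * z :=
    (multipliable_one_sub_pow_mul hp (p * z)).congr hshift
  have hsplit := tprod_eq_zero_mul' (f := fun m : ℕ => 1 - p ^ m * z) hmul
  rw [pow_zero, one_mul] at hsplit
  rw [qPochhammer, hsplit, qPochhammer, tprod_congr hshift]

lemma multipliableLocallyUniformlyOn_one_sub_pow_mul :
    MultipliableLocallyUniformlyOn (fun (m : ℕ) z => 1 - p ^ m * z) Set.univ := by
  use fun z => ∏' m : ℕ, (1 - p ^ m * z)
  simp_rw [sub_eq_add_neg]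
  apply hasProdLocallyUniformlyOn_of_forall_compact isOpen_univ
  intro K _ hcK
  obtain ⟨R, hR⟩ := hcK.isBounded.exists_norm_le
  have hsum := (summable_geometric_of_lt_one (norm_nonneg _) hp).mul_right R
  refine hsum.hasProdUniformlyOn_nat_one_add hcK (.of_forall fun n x hx => ?_)
    (fun _ => by fun_prop)
  rw [norm_neg, norm_mul, norm_pow]
  exact mul_le_mul_of_nonneg_left (hR x hx) (by positivity)

lemma differentiable_qPochhammer : Differentiable ℂ (qPochhammer p) := by
  rw [← differentiableOn_univ]
  have hprod := (multipliableLocallyUniformlyOn_one_sub_pow_mul hp).hasProdLocallyUniformlyOn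
  exact hprod.differentiableOn
    (.of_forall fun _ => by simpa [Finset.prod_fn] using
      DifferentiableOn.finsetProd (fun _ _ => by fun_prop)) isOpen_univ

lemma qPochhammer_ne_zero_iff {z : ℂ} : qPochhammer p z ≠ 0 ↔ ∀ m : ℕ, p ^ m * z ≠ 1 := by
  constructor
  · intro h m hm
    exact h (hasProd_zero_of_exists_eq_zero ⟨m, by rw [hm, sub_self]⟩).tprod_eq
  · intro h
    unfold qPochhammer
    simp_rw [sub_eq_add_neg]
    refine tprod_one_add_ne_zero_of_summable (fun m h0 => h m ?_) (summable_norm_neg_pow_mul hp z)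
    linear_combination -h0

lemma qPochhammer_ne_zero_of_norm_lt {z : ℂ} (hz : ‖z‖ < 1) : qPochhammer p z ≠ 0 := by
  refine (qPochhammer_ne_zero_iff hp).mpr fun m h => ?_
  exact (norm_pow_mul_lt_one hp hz m).ne (by rw [h, norm_one])

lemma summable_lambertSeries (z : ℂ) : Summable fun m : ℕ => p ^ m * z / (1 - p ^ m * z) := by
  refine Summable.of_norm_bounded_eventually_nat
    (g := fun m => 2 * ‖-(p ^ m * z)‖) ((summable_norm_neg_pow_mul hp z).mul_left 2) ?_
  have hzero : Tendsto (fun m : ℕ => ‖-(p ^ m * z)‖) atTop (𝓝 0) :=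
    (summable_norm_neg_pow_mul hp z).tendsto_atTop_zero
  filter_upwards [hzero.eventually_lt_const (show (0 : ℝ) < 1 / 2 by norm_num)] with m hm
  rw [norm_neg] at hm ⊢
  have hden : 1 / 2 ≤ ‖1 - p ^ m * z‖ := by
    have := norm_sub_norm_le (1 : ℂ) (p ^ m * z)
    rw [norm_one] at this
    linarith
  rw [norm_div, div_le_iff₀ (by linarith)]
  nlinarith [norm_nonneg (p ^ m * z)]

lemma lambertSeries_eq_div_add (z : ℂ) :
    lambertSeries p z = z / (1 - z) + lambertSeries p (p * z) := by
  unfold lambertSeries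
  rw [(summable_lambertSeries hp z).tsum_eq_zero_add]
  simp only [pow_zero, one_mul, pow_succ, mul_assoc]

lemma mul_logDeriv_qPochhammer {z : ℂ} (hz : qPochhammer p z ≠ 0) :
    z * logDeriv (qPochhammer p) z = -lambertSeries p z := by
  have hne := (qPochhammer_ne_zero_iff hp).mp hz
  have hfactor : ∀ m : ℕ, logDeriv (fun z => 1 - p ^ m * z) z = -(p ^ m / (1 - p ^ m * z)) := by
    intro m
    have : HasDerivAt (fun z : ℂ => 1 - p ^ m * z) (-(p ^ m * 1)) z :=
      ((hasDerivAt_id z).const_mul (p ^ m)).const_sub 1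
    rw [logDeriv_apply, this.deriv]
    ring
  have hmul : ∀ m : ℕ, z * logDeriv (fun z => 1 - p ^ m * z) z =
      -(p ^ m * z / (1 - p ^ m * z)) := fun m => by rw [hfactor]; ring
  have hsum : Summable fun m : ℕ => logDeriv (fun z => 1 - p ^ m * z) z := by
    rcases eq_or_ne z 0 with rfl | hz0
    · simp only [hfactor, mul_zero, sub_zero, div_one]
      exact (summable_geometric_of_norm_lt_one hp).neg
    · rw [← summable_mul_left_iff hz0]
      simp only [hmul]
      exact (summable_lambertSeries hp z).neg
  have hlog : logDeriv (qPochhammer p) z = ∑' m : ℕ, logDeriv (fun z => 1 - p ^ m * z) z :=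
    logDeriv_tprod_eq_tsum isOpen_univ (Set.mem_univ z)
      (f := fun (m : ℕ) z => 1 - p ^ m * z) (fun m h => hne m (by linear_combination -h))
      (fun _ => by fun_prop) hsum (multipliableLocallyUniformlyOn_one_sub_pow_mul hp) hz
  rw [hlog, ← tsum_mul_left]
  simp only [hmul, tsum_neg]
  rfl

lemma summable_pow_mul_pow_succ {z : ℂ} (hz : ‖z‖ < 1) :
    Summable fun x : ℕ × ℕ => (p ^ x.1 * z) ^ (x.2 + 1) := by
  have hbound : Summable fun x : ℕ × ℕ => ‖p‖ ^ x.1 * (‖z‖ ^ x.2 * ‖z‖) :=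
    (summable_geometric_of_lt_one (norm_nonneg _) hp).mul_of_nonneg
      ((summable_geometric_of_lt_one (norm_nonneg _) hz).mul_right _)
      (fun _ => by positivity) (fun _ => by positivity)
  refine Summable.of_norm_bounded hbound fun x => ?_
  rw [norm_pow, norm_mul, norm_pow, mul_pow, pow_succ ‖z‖]
  refine mul_le_mul_of_nonneg_right ?_ (by positivity)
  exact pow_le_of_le_one (by positivity) (pow_le_one₀ (norm_nonneg _) hp.le) x.2.succ_ne_zero

-- Both sides are iterated sums of the double series `∑_{m ≥ 0, n ≥ 1} p^{mn} z^n`.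
lemma hasSum_lambertSeries {z : ℂ} (hz : ‖z‖ < 1) :
    HasSum (fun n : ℕ => z ^ (n + 1) / (1 - p ^ (n + 1))) (lambertSeries p z) := by
  have hdouble := (summable_pow_mul_pow_succ hp hz).hasSum
  have hrow : ∀ m : ℕ, HasSum (fun n : ℕ => (p ^ m * z) ^ (n + 1))
      (p ^ m * z / (1 - p ^ m * z)) := fun m => by
    simpa only [pow_succ', div_eq_mul_inv] using
      (hasSum_geometric_of_norm_lt_one (norm_pow_mul_lt_one hp hz m)).mul_left (p ^ m * z)
  have hcol : ∀ n : ℕ, HasSum (fun m : ℕ => (p ^ m * z) ^ (n + 1))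
      (z ^ (n + 1) / (1 - p ^ (n + 1))) := fun n => by
    have hn : ‖p ^ (n + 1)‖ < 1 := by
      rw [norm_pow]; exact pow_lt_one₀ (norm_nonneg _) hp n.succ_ne_zero
    have hgeom := (hasSum_geometric_of_norm_lt_one hn).mul_left (z ^ (n + 1))
    rw [← div_eq_mul_inv] at hgeom
    refine hgeom.congr_fun fun m => ?_
    rw [mul_pow, ← pow_mul, ← pow_mul, mul_comm m, mul_comm]
  rw [lambertSeries, (hdouble.prod_fiberwise hrow).tsum_eq]
  exact ((Equiv.prodComm ℕ ℕ).hasSum_iff.mpr hdouble).prod_fiberwise hcol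

end QPochhammer

/-! ### Odd theta functions -/

/-- Entire odd functions with the quasi-periodicity of the first theta function and simple zeros
exactly at the lattice points. -/
structure IsOddTheta (δ : ℂ) (f : ℂ → ℂ) : Prop where
  differentiable : Differentiable ℂ f
  odd : f.Odd
  antiperiodic : f.Antiperiodic 1
  add_tau : ∀ x, f (x + δ) = -(cexp (-(Real.pi * I * δ)) * (e x)⁻¹ * f x)
  eq_zero_iff : ∀ x, f x = 0 ↔ x ∈ lattice δ
  deriv_ne_zero : deriv f 0 ≠ 0

namespace IsOddTheta

variable {δ : ℂ} {f : ℂ → ℂ} (hf : IsOddTheta δ f)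
include hf

lemma ne_zero {x : ℂ} (hx : x ∉ lattice δ) : f x ≠ 0 := fun h => hx ((hf.eq_zero_iff x).mp h)

lemma map_zero : f 0 = 0 := (hf.eq_zero_iff 0).mpr (zero_mem _)

lemma tendsto_div : Tendsto (fun x => f x / x) (𝓝[≠] 0) (𝓝 (deriv f 0)) := by
  have hslope := hasDerivAt_iff_tendsto_slope_zero.mp (hf.differentiable 0).hasDerivAt
  refine hslope.congr fun x => ?_
  rw [zero_add, hf.map_zero, sub_zero, smul_eq_mul, inv_mul_eq_div]

lemma tendsto_mul_inv : Tendsto (fun x => x * (f x)⁻¹) (𝓝[≠] 0) (𝓝 (deriv f 0)⁻¹) := by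
  refine (hf.tendsto_div.inv₀ hf.deriv_ne_zero).congr fun x => ?_
  rw [inv_div, div_eq_mul_inv]

lemma const_mul {c : ℂ} (hc : c ≠ 0) : IsOddTheta δ (fun x => c * f x) where
  differentiable := hf.differentiable.const_mul c
  odd x := by simp only [hf.odd x, mul_neg]
  antiperiodic x := by simp only [hf.antiperiodic x, mul_neg]
  add_tau x := by rw [hf.add_tau]; ring
  eq_zero_iff x := by rw [mul_eq_zero_iff_left hc, hf.eq_zero_iff]
  deriv_ne_zero := by
    rw [deriv_const_mul _ (hf.differentiable 0)]
    exact mul_ne_zero hc hf.deriv_ne_zero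

end IsOddTheta

lemma tendsto_sub_mul_of_periodic {h : ℂ → ℂ} {l x a : ℂ} (hl : h.Periodic l)
    (hx : Tendsto (fun y => (y - x) * h y) (𝓝[≠] x) (𝓝 a)) :
    Tendsto (fun y => (y - (x + l)) * h y) (𝓝[≠] (x + l)) (𝓝 a) := by
  rw [← map_add_right_nhdsNE, tendsto_map'_iff]
  refine hx.congr fun y => ?_
  rw [Function.comp_apply, hl, add_sub_add_right_eq_sub]

-- The quotient is doubly periodic, and its only possible pole is cancelled by `g 0 = 0`.
lemma IsOddTheta.exists_eq_const_mul {δ : ℂ} (hδ : δ.im ≠ 0) {f g : ℂ → ℂ}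
    (hf : IsOddTheta δ f) (hg : Differentiable ℂ g) (hodd : g.Odd) (hone : g.Antiperiodic 1)
    (htau : ∀ x, g (x + δ) = -(cexp (-(Real.pi * I * δ)) * (e x)⁻¹ * g x)) :
    ∃ c : ℂ, g = fun x => c * f x := by
  have hper_one : (fun x => g x / f x).Periodic 1 := fun x => by
    simp only [hone x, hf.antiperiodic x, neg_div_neg_eq]
  have hper_tau : (fun x => g x / f x).Periodic δ := fun x => by
    simp only [htau, hf.add_tau, neg_div_neg_eq]
    exact mul_div_mul_left _ _ (mul_ne_zero (Complex.exp_ne_zero _) (inv_ne_zero (e_ne_zero x)))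
  have hlim_zero : Tendsto (fun y => (y - 0) * (g y / f y)) (𝓝[≠] 0) (𝓝 0) := by
    have h := hf.tendsto_mul_inv.mul ((hg.continuous.tendsto 0).mono_left nhdsWithin_le_nhds)
    rw [hodd.map_zero, mul_zero] at h
    refine h.congr fun y => ?_
    rw [sub_zero, mul_assoc, inv_mul_eq_div]
  have hlim : ∀ l ∈ lattice δ, Tendsto (fun y => (y - l) • (g y / f y)) (𝓝[≠] l) (𝓝 0) := by
    intro l hl
    simpa only [zero_add, smul_eq_mul] using
      tendsto_sub_mul_of_periodic (periodic_of_mem_lattice hper_one hper_tau hl) hlim_zero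
  obtain ⟨x₀, hx₀⟩ := (eventually_notMem_lattice hδ 0).exists
  have hquot : ∀ x ∉ lattice δ, g x = g x₀ / f x₀ * f x := fun x hx => by
    rw [← div_eq_iff (hf.ne_zero hx)]
    exact eq_of_doublyPeriodic_of_removable hδ (S := lattice δ) (eventually_notMem_lattice hδ)
      (fun y hy => (hg y).div (hf.differentiable y) (hf.ne_zero hy)) hper_one hper_tau hlim hx hx₀
  refine ⟨g x₀ / f x₀, funext fun x => ?_⟩
  have hleft : Tendsto g (𝓝[≠] x) (𝓝 (g x)) := hg.continuous.tendsto' _ _ rfl |>.mono_left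
    nhdsWithin_le_nhds
  have hright : Tendsto (fun y => g x₀ / f x₀ * f y) (𝓝[≠] x) (𝓝 (g x₀ / f x₀ * f x)) :=
    (hf.differentiable.const_mul _).continuous.continuousAt.mono_left nhdsWithin_le_nhds
  refine tendsto_nhds_unique (hleft.congr' ?_) hright
  filter_upwards [eventually_notMem_lattice hδ x] with y hy
  exact hquot y hy

/-- The product side of the Jacobi triple product for `ϑ₁`, up to a constant factor:
`e^{-πix} (e^{2πix}; p)_∞ (p e^{-2πix}; p)_∞`. -/
def oddProd (δ x : ℂ) : ℂ :=
  cexp (-(Real.pi * I * x)) * qPochhammer (e δ) (e x) * qPochhammer (e δ) (e δ / e x)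

lemma cexp_neg_pi_mul (x : ℂ) :
    cexp (-(Real.pi * I * x)) = cexp (Real.pi * I * x) * (e x)⁻¹ := by
  rw [e_eq_cexp, ← Complex.exp_neg, ← Complex.exp_add]
  ring_nf

section OddProd

variable {δ : ℂ} (hδ : 0 < δ.im)
include hδ

lemma qPochhammer_mul_e_mul_qPochhammer_inv (x : ℂ) :
    qPochhammer (e δ) (e δ * e x) * qPochhammer (e δ) (e x)⁻¹ =
      -(e x)⁻¹ * (qPochhammer (e δ) (e x) * qPochhammer (e δ) (e δ / e x)) := by
  have hp := norm_e_lt_one hδ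
  rw [qPochhammer_eq_one_sub_mul hp (e x), qPochhammer_eq_one_sub_mul hp (e x)⁻¹,
    ← div_eq_mul_inv]
  have := e_ne_zero x
  field_simp
  ring

lemma differentiable_qPochhammer_div_e : Differentiable ℂ fun x => qPochhammer (e δ) (e δ / e x) :=
  (differentiable_qPochhammer (norm_e_lt_one hδ)).comp
    ((differentiable_const _).div differentiable_e e_ne_zero)

lemma differentiable_oddProd : Differentiable ℂ (oddProd δ) :=
  ((by fun_prop : Differentiable ℂ fun x : ℂ => cexp (-(Real.pi * I * x))).mul
    ((differentiable_qPochhammer (norm_e_lt_one hδ)).comp differentiable_e)).mul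
    (differentiable_qPochhammer_div_e hδ)

lemma qPochhammer_e_eq_zero_iff (x : ℂ) :
    qPochhammer (e δ) (e x) = 0 ↔ ∃ m : ℕ, ∃ n : ℤ, m * δ + x = n := by
  rw [← not_iff_not, ← Ne, qPochhammer_ne_zero_iff (norm_e_lt_one hδ)]
  push Not
  refine forall_congr' fun m => ?_
  rw [← e_nat_mul, ← e_add, Ne, e_eq_one_iff, not_exists]

lemma oddProd_eq_zero_iff (x : ℂ) : oddProd δ x = 0 ↔ x ∈ lattice δ := by
  have hfactor : oddProd δ x = 0 ↔
      qPochhammer (e δ) (e x) = 0 ∨ qPochhammer (e δ) (e (δ - x)) = 0 := by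
    simp only [oddProd, mul_eq_zero, Complex.exp_ne_zero, false_or, e_sub]
  rw [hfactor, qPochhammer_e_eq_zero_iff hδ, qPochhammer_e_eq_zero_iff hδ, mem_lattice]
  constructor
  · rintro (⟨m, n, h⟩ | ⟨m, n, h⟩)
    · exact ⟨n, -m, by push_cast; linear_combination -h⟩
    · exact ⟨-n, m + 1, by push_cast; linear_combination h⟩
  · rintro ⟨m, n, h⟩
    rcases le_or_gt n 0 with hn | hn
    · obtain ⟨k, rfl⟩ := Int.exists_eq_neg_ofNat hn
      exact Or.inl ⟨k, m, by push_cast at h; linear_combination -h⟩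
    · obtain ⟨k, rfl⟩ := Int.eq_succ_of_zero_lt hn
      exact Or.inr ⟨k, -m, by push_cast at h ⊢; linear_combination h⟩

lemma deriv_oddProd_zero :
    deriv (oddProd δ) 0 = -(2 * Real.pi * I) * qPochhammer (e δ) (e δ) ^ 2 := by
  set g : ℂ → ℂ := fun x => cexp (-(Real.pi * I * x)) * qPochhammer (e δ) (e δ * e x) *
    qPochhammer (e δ) (e δ / e x)
  have hfactor : oddProd δ = fun x => (1 - e x) * g x := by
    funext x
    rw [oddProd, qPochhammer_eq_one_sub_mul (norm_e_lt_one hδ) (e x)]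
    ring
  have hg : Differentiable ℂ g :=
    ((by fun_prop : Differentiable ℂ fun x : ℂ => cexp (-(Real.pi * I * x))).mul
      ((differentiable_qPochhammer (norm_e_lt_one hδ)).comp (differentiable_e.const_mul _))).mul
      (differentiable_qPochhammer_div_e hδ)
  have hvalue : g 0 = qPochhammer (e δ) (e δ) ^ 2 := by
    simp only [g, e_zero, mul_zero, neg_zero, Complex.exp_zero, mul_one, div_one, one_mul, sq]
  have hderiv : deriv (fun x => (1 - e x) * g x) 0 = _ :=
    (((hasDerivAt_e 0).const_sub 1).mul (hg 0).hasDerivAt).deriv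
  rw [hfactor, hderiv, hvalue, e_zero, sub_self, zero_mul, add_zero, mul_one]

lemma isOddTheta_oddProd : IsOddTheta δ (oddProd δ) where
  differentiable := differentiable_oddProd hδ
  odd x := by
    have hinv := qPochhammer_mul_e_mul_qPochhammer_inv hδ x
    rw [oddProd, oddProd, e_neg, div_inv_eq_mul, mul_assoc,
      mul_comm (qPochhammer (e δ) (e x)⁻¹), hinv, mul_neg, neg_neg, cexp_neg_pi_mul]
    ring
  antiperiodic x := by
    have hexp : cexp (-(Real.pi * I * (x + 1))) = -cexp (-(Real.pi * I * x)) := by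
      rw [mul_add, neg_add, Complex.exp_add, mul_one, Complex.exp_neg (Real.pi * I),
        Complex.exp_pi_mul_I, inv_neg, inv_one, mul_neg_one]
    rw [oddProd, oddProd, hexp, e_add, e_one, mul_one]
    ring
  add_tau x := by
    have hinv := qPochhammer_mul_e_mul_qPochhammer_inv hδ x
    have hexp : cexp (-(Real.pi * I * (x + δ))) =
        cexp (-(Real.pi * I * δ)) * cexp (-(Real.pi * I * x)) := by
      rw [← Complex.exp_add]; congr 1; ring
    rw [oddProd, oddProd, hexp, add_comm x, e_add, div_mul_cancel_left₀ (e_ne_zero δ),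
      mul_assoc, hinv]
    ring
  eq_zero_iff := oddProd_eq_zero_iff hδ
  deriv_ne_zero := by
    have hp := norm_e_lt_one hδ
    rw [deriv_oddProd_zero hδ]
    exact mul_ne_zero (neg_ne_zero.mpr two_pi_I_ne_zero)
      (pow_ne_zero 2 (qPochhammer_ne_zero_of_norm_lt hp hp))

end OddProd

/-! ### The theta function as an odd theta function -/

lemma theta_eq_jacobiTheta₂ (δ x : ℂ) : theta δ x =
    -I * cexp (Real.pi * I * δ / 4) * cexp (Real.pi * I * x) *
      jacobiTheta₂ (x + 1 / 2 + δ / 2) δ := by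
  rw [theta, jacobiTheta₂]
  congr 1
  refine tsum_congr fun n => ?_
  rw [jacobiTheta₂_term, ← Complex.exp_pi_mul_I, ← Complex.exp_int_mul, ← Complex.exp_add,
    ← Complex.exp_add]
  congr 1
  ring

lemma theta_antiperiodic (δ : ℂ) : (theta δ).Antiperiodic 1 := fun x => by
  have h := theta_add_int δ x 1
  rwa [Int.cast_one, mul_one, Complex.exp_pi_mul_I, neg_one_mul] at h

lemma theta_add_tau (δ x : ℂ) :
    theta δ (x + δ) = -(cexp (-(Real.pi * I * δ)) * (e x)⁻¹ * theta δ x) := by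
  have hexp : cexp (Real.pi * I * (x + δ)) *
      cexp (-Real.pi * I * (δ + 2 * (x + 1 / 2 + δ / 2))) =
      -(cexp (-(Real.pi * I * δ)) * (e x)⁻¹ * cexp (Real.pi * I * x)) := by
    rw [← e_neg, e_eq_cexp, ← Complex.exp_add, ← Complex.exp_add, ← Complex.exp_add,
      neg_eq_neg_one_mul (cexp _), ← Complex.exp_neg_pi_mul_I, ← Complex.exp_add]
    congr 1
    ring
  rw [theta_eq_jacobiTheta₂, theta_eq_jacobiTheta₂,
    show x + δ + 1 / 2 + δ / 2 = x + 1 / 2 + δ / 2 + δ by ring, jacobiTheta₂_add_left']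
  linear_combination (-I * cexp (Real.pi * I * δ / 4) *
    jacobiTheta₂ (x + 1 / 2 + δ / 2) δ) * hexp

lemma theta_odd (δ : ℂ) : (theta δ).Odd := fun x => by
  have hexp : cexp (Real.pi * I * x) *
      cexp (-Real.pi * I * (δ + 2 * (-(-x + 1 / 2 + δ / 2) + 1))) =
      -cexp (Real.pi * I * -x) := by
    rw [← Complex.exp_add, neg_eq_neg_one_mul (cexp _), ← Complex.exp_neg_pi_mul_I,
      ← Complex.exp_add]
    congr 1
    ring
  rw [theta_eq_jacobiTheta₂, theta_eq_jacobiTheta₂, ← jacobiTheta₂_neg_left,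
    ← jacobiTheta₂_add_left,
    show x + 1 / 2 + δ / 2 = -(-x + 1 / 2 + δ / 2) + 1 + δ by ring, jacobiTheta₂_add_left']
  linear_combination (-I * cexp (Real.pi * I * δ / 4) *
    jacobiTheta₂ (-(-x + 1 / 2 + δ / 2) + 1) δ) * hexp

lemma intervalIntegral_jacobiTheta₂_term (n : ℤ) (τ : ℂ) :
    ∫ x in (0 : ℝ)..1, jacobiTheta₂_term n x τ = if n = 0 then 1 else 0 := by
  split_ifs with hn
  · simp [hn, jacobiTheta₂_term]
  · have hexp : ∀ x : ℝ, jacobiTheta₂_term n x τ =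
        cexp (Real.pi * I * n ^ 2 * τ) * cexp ((2 * Real.pi * I * n) * x) := fun x => by
      rw [jacobiTheta₂_term, add_comm, Complex.exp_add]
    simp only [hexp]
    rw [intervalIntegral.integral_const_mul,
      integral_exp_mul_complex (mul_ne_zero two_pi_I_ne_zero (Int.cast_ne_zero.mpr hn)),
      ofReal_one, ofReal_zero, mul_one, mul_zero, Complex.exp_zero, mul_comm _ (n : ℂ),
      Complex.exp_int_mul_two_pi_mul_I, sub_self, zero_div, mul_zero]

section Theta

variable {δ : ℂ} (hδ : 0 < δ.im)
include hδ

lemma intervalIntegral_jacobiTheta₂ : ∫ x in (0 : ℝ)..1, jacobiTheta₂ x δ = 1 := by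
  have hcont : ∀ n : ℤ, Continuous fun x : ℝ => jacobiTheta₂_term n x δ := fun n => by
    unfold jacobiTheta₂_term
    fun_prop
  have hnorm : ∀ (n : ℤ) (x : ℝ), ‖jacobiTheta₂_term n x δ‖ = ‖jacobiTheta₂_term n 0 δ‖ := by
    intro n x
    rw [norm_jacobiTheta₂_term, norm_jacobiTheta₂_term, ofReal_im, zero_im]
  have hsum : HasSum (fun n : ℤ => ∫ x in (0 : ℝ)..1, jacobiTheta₂_term n x δ)
      (∫ x in (0 : ℝ)..1, jacobiTheta₂ x δ) := by
    refine intervalIntegral.hasSum_integral_of_dominated_convergence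
      (fun n _ => ‖jacobiTheta₂_term n 0 δ‖) (fun n => (hcont n).aestronglyMeasurable)
      (fun n => .of_forall fun x _ => (hnorm n x).le)
      (.of_forall fun _ _ => ((summable_jacobiTheta₂_term_iff 0 δ).mpr hδ).norm)
      intervalIntegrable_const (.of_forall fun x _ => hasSum_jacobiTheta₂_term x hδ)
  simp only [intervalIntegral_jacobiTheta₂_term] at hsum
  exact hsum.unique (hasSum_ite_eq 0 1)

lemma differentiable_theta : Differentiable ℂ (theta δ) := by
  rw [funext (theta_eq_jacobiTheta₂ δ)]
  intro x
  have hθ : DifferentiableAt ℂ (fun x => jacobiTheta₂ (x + 1 / 2 + δ / 2) δ) x :=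
    (differentiableAt_jacobiTheta₂_fst _ hδ).comp x (by fun_prop)
  fun_prop

lemma theta_ne_zero : theta δ ≠ 0 := by
  intro hzero
  have hθ : ∀ x : ℂ, jacobiTheta₂ x δ = 0 := fun x => by
    have h := congrFun hzero (x - 1 / 2 - δ / 2)
    rw [theta_eq_jacobiTheta₂, show x - 1 / 2 - δ / 2 + 1 / 2 + δ / 2 = x by ring] at h
    simpa using h
  have hint := intervalIntegral_jacobiTheta₂ hδ
  simp [hθ] at hint

lemma exists_theta_eq_const_mul_oddProd : ∃ c ≠ 0, theta δ = fun x => c * oddProd δ x := by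
  obtain ⟨c, hc⟩ := (isOddTheta_oddProd hδ).exists_eq_const_mul hδ.ne' (differentiable_theta hδ)
    (theta_odd δ) (theta_antiperiodic δ) (theta_add_tau δ)
  refine ⟨c, fun hc_zero => theta_ne_zero hδ ?_, hc⟩
  rw [hc, hc_zero]
  exact funext fun x => zero_mul _

lemma isOddTheta_theta : IsOddTheta δ (theta δ) := by
  obtain ⟨c, hc, hθ⟩ := exists_theta_eq_const_mul_oddProd hδ
  rw [hθ]
  exact (isOddTheta_oddProd hδ).const_mul hc

lemma logDeriv_theta (x : ℂ) : logDeriv (theta δ) x = logDeriv (oddProd δ) x := by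
  obtain ⟨c, hc, hθ⟩ := exists_theta_eq_const_mul_oddProd hδ
  rw [hθ, logDeriv_const_mul x c hc]

end Theta

/-! ### A symmetric-function identity for elliptic functions -/

lemma tendsto_neg_nhdsNE_zero : Tendsto (fun x : ℂ => -x) (𝓝[≠] 0) (𝓝[≠] 0) := by
  have h := ((Homeomorph.neg ℂ).map_punctured_nhds_eq 0).le
  rwa [Homeomorph.coe_neg, neg_zero] at h

lemma tendsto_sub_nhdsNE_zero (c : ℂ) : Tendsto (fun x : ℂ => x - c) (𝓝[≠] c) (𝓝[≠] 0) := by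
  simp only [sub_eq_add_neg]
  exact (map_add_right_nhdsNE c (-c)).le.trans_eq (by rw [add_neg_cancel])

/-- Elliptic functions with at most simple poles, located at `0` and `-β`, which are symmetric
under `x ↦ -x - β` and have residue `ρ` at `0`. -/
structure IsTwoPole (δ β ρ : ℂ) (v : ℂ → ℂ) : Prop where
  periodic_one : v.Periodic 1
  periodic_tau : v.Periodic δ
  differentiableAt : ∀ x, x ∉ lattice δ → x + β ∉ lattice δ → DifferentiableAt ℂ v x
  reflect : ∀ x, v (-x - β) = v x
  tendsto_zero : Tendsto (fun x => x * v x) (𝓝[≠] 0) (𝓝 ρ)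

lemma IsTwoPole.neg {δ β ρ : ℂ} {v : ℂ → ℂ} (hv : IsTwoPole δ β ρ v) :
    IsTwoPole δ (-β) (-ρ) fun x => v (-x) where
  periodic_one x := by simp only [neg_add']; exact hv.periodic_one.sub_eq (-x)
  periodic_tau x := by simp only [neg_add']; exact hv.periodic_tau.sub_eq (-x)
  differentiableAt x hx hxβ := by
    refine (hv.differentiableAt (-x) (neg_mem_iff.not.mpr hx) ?_).comp x differentiableAt_id.neg
    rwa [← neg_mem_iff, neg_add, neg_neg]
  reflect x := by
    rw [← hv.reflect]
    ring_nf
  tendsto_zero := by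
    refine (hv.tendsto_zero.comp tendsto_neg_nhdsNE_zero).neg.congr fun x => ?_
    rw [Function.comp_apply, neg_mul, neg_neg]

section SplitSum

variable {ι : Type*}

/-- The configurations `z` on `s` are in general position with respect to shifts by multiples of
`β`; the range `|m| ≤ 2` is what the comparison of two poles of `v(x - z_i)` requires. -/
def Generic (δ β : ℂ) (s : Finset ι) (z : ι → ℂ) : Prop :=
  ∀ i ∈ s, ∀ j ∈ s, i ≠ j → ∀ m ∈ Finset.Icc (-2 : ℤ) 2, z i - z j + m * β ∉ lattice δ

/-- The positions `x` at which some `v(x - z_b)` or `v(z_b - x)`, `b ∈ s`, may have a pole. -/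
def collisionSet (δ β : ℂ) (s : Finset ι) (z : ι → ℂ) : Set ℂ :=
  {x | ∃ b ∈ s, ∃ m ∈ Finset.Icc (-1 : ℤ) 1, x - (z b + m * β) ∈ lattice δ}

lemma notMem_collisionSet {δ β : ℂ} {s : Finset ι} {z : ι → ℂ} {x : ℂ} :
    x ∉ collisionSet δ β s z ↔
      ∀ b ∈ s, ∀ m ∈ Finset.Icc (-1 : ℤ) 1, x - (z b + m * β) ∉ lattice δ := by
  simp only [collisionSet, Set.mem_ofPred_eq, not_exists, not_and]

lemma collisionSet_neg (δ β : ℂ) (s : Finset ι) (z : ι → ℂ) :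
    collisionSet δ (-β) s z = collisionSet δ β s z := by
  ext x
  refine exists_congr fun b => and_congr_right fun _ => (Equiv.neg ℤ).exists_congr fun m => ?_
  simp only [Equiv.neg_apply, Finset.mem_Icc, Int.cast_neg, neg_mul, mul_neg]
  exact and_congr_left' (by omega)

lemma eventually_notMem_collisionSet {δ : ℂ} (hδ : δ.im ≠ 0) (β : ℂ) (s : Finset ι) (z : ι → ℂ)
    (x : ℂ) : ∀ᶠ y in 𝓝[≠] x, y ∉ collisionSet δ β s z := by
  simp only [notMem_collisionSet, eventually_all_finset]
  exact fun b _ m _ => eventually_notMem_lattice_sub hδ x _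

namespace Generic

variable {δ β : ℂ} {s t : Finset ι} {z : ι → ℂ}

lemma mono (h : Generic δ β s z) (hts : t ⊆ s) : Generic δ β t z :=
  fun i hi j hj => h i (hts hi) j (hts hj)

lemma neg (h : Generic δ β s z) : Generic δ (-β) s z := by
  intro i hi j hj hij m hm
  rw [Finset.mem_Icc] at hm
  have := h i hi j hj hij (-m) (by rw [Finset.mem_Icc]; omega)
  rwa [Int.cast_neg, neg_mul, ← mul_neg] at this

lemma add_notMem_collisionSet [DecidableEq ι] {b : ι} (h : Generic δ β (insert b t) z)
    (hb : b ∉ t) {k : ℤ} (hk : k ∈ Finset.Icc (-1 : ℤ) 1) :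
    z b + k * β ∉ collisionSet δ β t z := by
  rw [notMem_collisionSet]
  intro j hj m hm
  rw [Finset.mem_Icc] at hk hm
  have := h b (Finset.mem_insert_self b t) j (Finset.mem_insert_of_mem hj)
    (ne_of_mem_of_not_mem hj hb).symm (k - m) (by rw [Finset.mem_Icc]; omega)
  convert this using 2
  push_cast
  ring

lemma notMem_collisionSet [DecidableEq ι] {b : ι} (h : Generic δ β (insert b t) z)
    (hb : b ∉ t) : z b ∉ collisionSet δ β t z := by
  simpa using h.add_notMem_collisionSet hb (k := 0) (by simp)

end Generic

namespace IsTwoPole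

variable {δ β ρ : ℂ} {v : ℂ → ℂ} (hv : IsTwoPole δ β ρ v)
include hv

lemma periodic {l : ℂ} (hl : l ∈ lattice δ) : v.Periodic l :=
  periodic_of_mem_lattice hv.periodic_one hv.periodic_tau hl

lemma differentiableAt_comp_sub_const {s : Finset ι} {z : ι → ℂ} {x : ℂ}
    (hx : x ∉ collisionSet δ β s z) {j : ι} (hj : j ∈ s) :
    DifferentiableAt ℂ (fun x => v (x - z j)) x := by
  rw [notMem_collisionSet] at hx
  have hzero := hx j hj 0 (by simp)
  have hneg := hx j hj (-1) (by simp)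
  refine (hv.differentiableAt _ ?_ ?_).comp x (differentiableAt_id.sub_const _)
  · simpa using hzero
  · convert hneg using 1
    simp [sub_add_eq_sub_sub]

lemma differentiableAt_comp_const_sub {s : Finset ι} {z : ι → ℂ} {x : ℂ}
    (hx : x ∉ collisionSet δ β s z) {j : ι} (hj : j ∈ s) :
    DifferentiableAt ℂ (fun x => v (z j - x)) x := by
  rw [← collisionSet_neg] at hx
  simpa only [neg_sub] using hv.neg.differentiableAt_comp_sub_const hx hj

end IsTwoPole

variable [DecidableEq ι]

/-- The cross product `∏_{i ∈ I, j ∈ s ∖ I} v(z_i - z_j)` of a splitting of `s`. -/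
def splitProd (v : ℂ → ℂ) (z : ι → ℂ) (s I : Finset ι) : ℂ :=
  ∏ i ∈ I, ∏ j ∈ s \ I, v (z i - z j)

/-- The symmetrised sum `∑_{I ⊆ s} c_{|I|} ∏_{i ∈ I, j ∈ s ∖ I} v(z_i - z_j)` over all splittings
of `s`; the weights `c` single out the cardinalities of interest. -/
def splitSum (v : ℂ → ℂ) (c : ℕ → ℂ) (s : Finset ι) (z : ι → ℂ) : ℂ :=
  ∑ I ∈ s.powerset, c I.card * splitProd v z s I

/-- The antisymmetrisation of `splitSum` under `v(x) ↦ v(-x)`. -/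
def splitDiff (v : ℂ → ℂ) (c : ℕ → ℂ) (s : Finset ι) (z : ι → ℂ) : ℂ :=
  splitSum v c s z - splitSum (fun x => v (-x)) c s z

section SplitProd

variable (v : ℂ → ℂ) (c : ℕ → ℂ) {z z' : ι → ℂ} {s I : Finset ι} {a : ι}

lemma splitProd_congr (hz : ∀ i ∈ s, z i = z' i) (hI : I ⊆ s) :
    splitProd v z s I = splitProd v z' s I :=
  Finset.prod_congr rfl fun i hi => Finset.prod_congr rfl fun j hj => by
    rw [hz i (hI hi), hz j (Finset.mem_sdiff.mp hj).1]

lemma splitSum_congr (hz : ∀ i ∈ s, z i = z' i) : splitSum v c s z = splitSum v c s z' :=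
  Finset.sum_congr rfl fun _ hI => by rw [splitProd_congr v hz (Finset.mem_powerset.mp hI)]

lemma splitProd_insert_of_subset (z : ι → ℂ) (ha : a ∉ s) (hI : I ⊆ s) :
    splitProd v z (insert a s) I = (∏ i ∈ I, v (z i - z a)) * splitProd v z s I := by
  rw [splitProd, splitProd, Finset.insert_sdiff_of_notMem _ fun h => ha (hI h),
    ← Finset.prod_mul_distrib]
  refine Finset.prod_congr rfl fun i _ => Finset.prod_insert fun h => ?_
  exact ha (Finset.mem_sdiff.mp h).1

lemma splitProd_insert_insert (z : ι → ℂ) (ha : a ∉ s) (hI : I ⊆ s) :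
    splitProd v z (insert a s) (insert a I) =
      (∏ j ∈ s \ I, v (z a - z j)) * splitProd v z s I := by
  rw [splitProd, splitProd, Finset.insert_sdiff_insert, Finset.sdiff_insert_of_notMem ha,
    Finset.prod_insert fun h => ha (hI h)]

lemma splitSum_const_sub (w : ℂ) (s : Finset ι) (z : ι → ℂ) :
    splitSum v c s (fun i => w - z i) = splitSum (fun x => v (-x)) c s z := by
  simp only [splitSum, splitProd, sub_sub_sub_cancel_left, neg_sub]

lemma splitDiff_const_sub (w : ℂ) (s : Finset ι) (z : ι → ℂ) :
    splitDiff v c s (fun i => w - z i) = -splitDiff v c s z := by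
  simp only [splitDiff, splitSum_const_sub, neg_neg, neg_sub]

lemma splitSum_insert_update (z : ι → ℂ) (ha : a ∉ s) (x : ℂ) :
    splitSum v c (insert a s) (Function.update z a x) =
      ∑ I ∈ s.powerset, (c I.card * ∏ i ∈ I, v (z i - x) +
        c (I.card + 1) * ∏ j ∈ s \ I, v (x - z j)) * splitProd v z s I := by
  have hne : ∀ i ∈ s, Function.update z a x i = z i := fun i hi =>
    Function.update_of_ne (ne_of_mem_of_not_mem hi ha) _ _
  rw [splitSum, Finset.sum_powerset_insert ha, ← Finset.sum_add_distrib]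
  refine Finset.sum_congr rfl fun I hI => ?_
  rw [Finset.mem_powerset] at hI
  have hprod_left : ∏ j ∈ s \ I, v (x - Function.update z a x j) = ∏ j ∈ s \ I, v (x - z j) :=
    Finset.prod_congr rfl fun j hj => by rw [hne j (Finset.mem_sdiff.mp hj).1]
  have hprod_right : ∏ i ∈ I, v (Function.update z a x i - x) = ∏ i ∈ I, v (z i - x) :=
    Finset.prod_congr rfl fun i hi => by rw [hne i (hI hi)]
  rw [splitProd_insert_of_subset v _ ha hI, splitProd_insert_insert v _ ha hI,
    Finset.card_insert_of_notMem fun h => ha (hI h), splitProd_congr v hne hI,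
    Function.update_self, hprod_left, hprod_right]
  ring

end SplitProd

-- Only the splittings separating `a` from `b` contribute to the residue at `z_a = x₀`.
lemma tendsto_sub_mul_splitSum_update {v : ℂ → ℂ} {z : ι → ℂ} {a b : ι} {t : Finset ι}
    (ha : a ∉ insert b t) (hb : b ∉ t) (c : ℕ → ℂ) {x₀ r₁ r₂ : ℂ}
    (hleft : ∀ j ∈ t, ContinuousAt (fun x => v (x - z j)) x₀)
    (hright : ∀ j ∈ t, ContinuousAt (fun x => v (z j - x)) x₀)
    (hr₁ : Tendsto (fun x => (x - x₀) * v (x - z b)) (𝓝[≠] x₀) (𝓝 r₁))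
    (hr₂ : Tendsto (fun x => (x - x₀) * v (z b - x)) (𝓝[≠] x₀) (𝓝 r₂)) :
    Tendsto (fun x => (x - x₀) *
        splitSum v c (insert a (insert b t)) (Function.update z a x)) (𝓝[≠] x₀)
      (𝓝 (∑ J ∈ t.powerset, c (J.card + 1) * splitProd v z t J *
        (r₂ * (∏ j ∈ t \ J, v (z b - z j)) * (∏ i ∈ J, v (z i - x₀)) +
          r₁ * (∏ j ∈ t \ J, v (x₀ - z j)) * (∏ i ∈ J, v (z i - z b))))) := by
  have hzero : Tendsto (fun x : ℂ => x - x₀) (𝓝[≠] x₀) (𝓝 0) :=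
    (tendsto_sub_nhdsNE_zero x₀).mono_right nhdsWithin_le_nhds
  simp only [splitSum_insert_update v c z ha, Finset.sum_powerset_insert hb,
    ← Finset.sum_add_distrib, Finset.mul_sum]
  refine tendsto_finsetSum _ fun J hJ => ?_
  rw [Finset.mem_powerset] at hJ
  have hbJ : b ∉ J := fun h => hb (hJ h)
  have hprod_left : Tendsto (fun x => ∏ j ∈ t \ J, v (x - z j)) (𝓝[≠] x₀)
      (𝓝 (∏ j ∈ t \ J, v (x₀ - z j))) :=
    tendsto_finsetProd _ fun j hj => (hleft j (Finset.mem_sdiff.mp hj).1).tendsto.mono_left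
      nhdsWithin_le_nhds
  have hprod_right : Tendsto (fun x => ∏ i ∈ J, v (z i - x)) (𝓝[≠] x₀)
      (𝓝 (∏ i ∈ J, v (z i - x₀))) :=
    tendsto_finsetProd _ fun j hj => (hright j (hJ hj)).tendsto.mono_left nhdsWithin_le_nhds
  have hlim :=
    (((hzero.mul hprod_right).const_mul (c J.card)).add
      ((hr₁.mul hprod_left).const_mul (c (J.card + 1)))).mul_const
        ((∏ i ∈ J, v (z i - z b)) * splitProd v z t J) |>.add <|
    (((hr₂.mul hprod_right).const_mul (c (J.card + 1))).add
      ((hzero.mul hprod_left).const_mul (c (J.card + 2)))).mul_const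
        ((∏ j ∈ t \ J, v (z b - z j)) * splitProd v z t J)
  refine (hlim.congr fun x => ?_).trans (le_of_eq ?_)
  · rw [splitProd_insert_of_subset v z hb hJ, splitProd_insert_insert v z hb hJ,
      Finset.card_insert_of_notMem hbJ, Finset.prod_insert hbJ, Finset.insert_sdiff_insert,
      Finset.sdiff_insert_of_notMem hb, Finset.insert_sdiff_of_notMem _ hbJ,
      Finset.prod_insert fun h => hb (Finset.mem_sdiff.mp h).1]
    ring
  · congr 1
    ring

namespace IsTwoPole

section Residues

variable {δ β ρ : ℂ} {v : ℂ → ℂ} (hv : IsTwoPole δ β ρ v) {z : ι → ℂ} {a b : ι} {t : Finset ι}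
  (c : ℕ → ℂ)
include hv

variable (ha : a ∉ insert b t) (hb : b ∉ t) (hz : Generic δ β (insert b t) z)
include ha hb hz

lemma tendsto_sub_mul_splitSum_self :
    Tendsto (fun x => (x - z b) *
      splitSum v c (insert a (insert b t)) (Function.update z a x)) (𝓝[≠] z b) (𝓝 0) := by
  have hcoll := hz.notMem_collisionSet hb
  have hright : Tendsto (fun x => (x - z b) * v (x - z b)) (𝓝[≠] z b) (𝓝 ρ) :=
    hv.tendsto_zero.comp (tendsto_sub_nhdsNE_zero (z b))
  have hleft : Tendsto (fun x => (x - z b) * v (z b - x)) (𝓝[≠] z b) (𝓝 (-ρ)) := by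
    refine (hv.neg.tendsto_zero.comp (tendsto_sub_nhdsNE_zero (z b))).congr fun x => ?_
    rw [Function.comp_apply, neg_sub]
  refine (tendsto_sub_mul_splitSum_update ha hb c
    (fun j hj => (hv.differentiableAt_comp_sub_const hcoll hj).continuousAt)
    (fun j hj => (hv.differentiableAt_comp_const_sub hcoll hj).continuousAt)
    hright hleft).trans (le_of_eq ?_)
  congr 1
  refine Finset.sum_eq_zero fun J _ => ?_
  ring

variable (hβ : β ∉ lattice δ) (hβ_two : 2 * β ∉ lattice δ)
include hβ hβ_two

lemma tendsto_sub_mul_splitSum_sub :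
    Tendsto (fun x => (x - (z b - β)) *
      splitSum v c (insert a (insert b t)) (Function.update z a x)) (𝓝[≠] (z b - β))
      (𝓝 (-ρ * (∏ j ∈ t, v (z j - z b)) * splitSum v (fun n => c (n + 1)) t z)) := by
  have hcoll : z b - β ∉ collisionSet δ β t z := by
    simpa [sub_eq_add_neg] using hz.add_notMem_collisionSet hb (k := -1) (by simp)
  have hpole : Tendsto (fun x => (x - (z b - β)) * v (x - z b)) (𝓝[≠] (z b - β)) (𝓝 (-ρ)) := by
    refine (hv.neg.tendsto_zero.comp (tendsto_sub_nhdsNE_zero (z b - β))).congr fun x => ?_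
    rw [Function.comp_apply, ← hv.reflect (x - z b)]
    ring_nf
  have hregular : Tendsto (fun x => (x - (z b - β)) * v (z b - x)) (𝓝[≠] (z b - β)) (𝓝 0) := by
    refine tendsto_sub_smul_of_continuousAt (DifferentiableAt.continuousAt (𝕜 := ℂ) ?_)
    refine (hv.differentiableAt _ ?_ ?_).comp _ (differentiableAt_id.const_sub _)
    · rwa [sub_sub_cancel]
    · rwa [sub_sub_cancel, ← two_mul]
  refine (tendsto_sub_mul_splitSum_update ha hb c
    (fun j hj => (hv.differentiableAt_comp_sub_const hcoll hj).continuousAt)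
    (fun j hj => (hv.differentiableAt_comp_const_sub hcoll hj).continuousAt)
    hpole hregular).trans (le_of_eq ?_)
  have hreflect : ∀ j, v (z b - β - z j) = v (z j - z b) := fun j => by
    rw [← hv.reflect]
    ring_nf
  congr 1
  rw [splitSum, Finset.mul_sum]
  refine Finset.sum_congr rfl fun J hJ => ?_
  simp only [hreflect]
  rw [← Finset.prod_sdiff (Finset.mem_powerset.mp hJ)]
  ring

lemma tendsto_sub_mul_splitSum_add :
    Tendsto (fun x => (x - (z b + β)) *
      splitSum v c (insert a (insert b t)) (Function.update z a x)) (𝓝[≠] (z b + β))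
      (𝓝 (ρ * (∏ j ∈ t, v (z b - z j)) * splitSum v (fun n => c (n + 1)) t z)) := by
  have hcoll : z b + β ∉ collisionSet δ β t z := by
    simpa using hz.add_notMem_collisionSet hb (k := 1) (by simp)
  have hpole : Tendsto (fun x => (x - (z b + β)) * v (z b - x)) (𝓝[≠] (z b + β)) (𝓝 ρ) := by
    refine (hv.tendsto_zero.comp (tendsto_sub_nhdsNE_zero (z b + β))).congr fun x => ?_
    rw [Function.comp_apply, ← hv.reflect (z b - x)]
    ring_nf
  have hregular : Tendsto (fun x => (x - (z b + β)) * v (x - z b)) (𝓝[≠] (z b + β)) (𝓝 0) := by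
    refine tendsto_sub_smul_of_continuousAt (DifferentiableAt.continuousAt (𝕜 := ℂ) ?_)
    refine (hv.differentiableAt _ ?_ ?_).comp _ (differentiableAt_id.sub_const _)
    · rwa [add_sub_cancel_left]
    · rwa [add_sub_cancel_left, ← two_mul]
  refine (tendsto_sub_mul_splitSum_update ha hb c
    (fun j hj => (hv.differentiableAt_comp_sub_const hcoll hj).continuousAt)
    (fun j hj => (hv.differentiableAt_comp_const_sub hcoll hj).continuousAt)
    hregular hpole).trans (le_of_eq ?_)
  have hreflect : ∀ j, v (z j - (z b + β)) = v (z b - z j) := fun j => by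
    rw [← hv.reflect]
    ring_nf
  congr 1
  rw [splitSum, Finset.mul_sum]
  refine Finset.sum_congr rfl fun J hJ => ?_
  simp only [hreflect]
  rw [← Finset.prod_sdiff (Finset.mem_powerset.mp hJ)]
  ring

lemma tendsto_sub_mul_splitDiff
    (ih : splitDiff v (fun n => c (n + 1)) t z = 0) {k : ℤ} (hk : k ∈ Finset.Icc (-1 : ℤ) 1) :
    Tendsto (fun x => (x - (z b + k * β)) *
      splitDiff v c (insert a (insert b t)) (Function.update z a x))
      (𝓝[≠] (z b + k * β)) (𝓝 0) := by
  have hβ_neg : -β ∉ lattice δ := neg_mem_iff.not.mpr hβ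
  have hβ_two_neg : 2 * -β ∉ lattice δ := by rwa [mul_neg, neg_mem_iff]
  have hcases : k = -1 ∨ k = 0 ∨ k = 1 := by rw [Finset.mem_Icc] at hk; omega
  rw [splitDiff, sub_eq_zero] at ih
  simp only [splitDiff, mul_sub]
  rcases hcases with rfl | rfl | rfl
  · have hlim := (hv.tendsto_sub_mul_splitSum_sub c ha hb hz hβ hβ_two).sub
      ((sub_eq_add_neg (z b) β).symm ▸
        hv.neg.tendsto_sub_mul_splitSum_add c ha hb hz.neg hβ_neg hβ_two_neg)
    rw [← ih] at hlim
    simpa only [Int.cast_neg, Int.cast_one, neg_mul, one_mul, ← sub_eq_add_neg, neg_sub,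
      sub_self] using hlim
  · have hlim := (hv.tendsto_sub_mul_splitSum_self c ha hb hz).sub
      (hv.neg.tendsto_sub_mul_splitSum_self c ha hb hz.neg)
    simpa only [Int.cast_zero, zero_mul, add_zero, sub_zero] using hlim
  · have hlim := (hv.tendsto_sub_mul_splitSum_add c ha hb hz hβ hβ_two).sub
      (sub_neg_eq_add (z b) β ▸
        hv.neg.tendsto_sub_mul_splitSum_sub c ha hb hz.neg hβ_neg hβ_two_neg)
    rw [← ih] at hlim
    simpa only [Int.cast_one, one_mul, neg_neg, neg_sub, sub_self] using hlim

end Residues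

variable {δ β ρ : ℂ} {v : ℂ → ℂ} (hv : IsTwoPole δ β ρ v)
include hv

lemma periodic_splitSum_update (c : ℕ → ℂ) {s : Finset ι} (z : ι → ℂ) {a : ι} (ha : a ∉ s)
    {l : ℂ} (hl : l ∈ lattice δ) :
    (fun x => splitSum v c (insert a s) (Function.update z a x)).Periodic l := by
  intro x
  simp only [splitSum_insert_update v c z ha, sub_add_eq_sub_sub, add_sub_right_comm x l,
    (hv.periodic hl).sub_eq, hv.periodic hl _]

lemma periodic_splitDiff_update (c : ℕ → ℂ) {s : Finset ι} (z : ι → ℂ) {a : ι} (ha : a ∉ s)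
    {l : ℂ} (hl : l ∈ lattice δ) :
    (fun x => splitDiff v c (insert a s) (Function.update z a x)).Periodic l :=
  (hv.periodic_splitSum_update c z ha hl).sub (hv.neg.periodic_splitSum_update c z ha hl)

lemma differentiableAt_splitSum_update (c : ℕ → ℂ) {s : Finset ι} {z : ι → ℂ} {a : ι}
    (ha : a ∉ s) {x : ℂ} (hx : x ∉ collisionSet δ β s z) :
    DifferentiableAt ℂ (fun x => splitSum v c (insert a s) (Function.update z a x)) x := by
  simp only [splitSum_insert_update v c z ha]
  refine DifferentiableAt.fun_sum fun I hI => (DifferentiableAt.add ?_ ?_).mul_const _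
  · exact (DifferentiableAt.fun_finsetProd fun i hi =>
      hv.differentiableAt_comp_const_sub hx (Finset.mem_powerset.mp hI hi)).const_mul _
  · exact (DifferentiableAt.fun_finsetProd fun j hj =>
      hv.differentiableAt_comp_sub_const hx (Finset.mem_sdiff.mp hj).1).const_mul _

lemma differentiableAt_splitDiff_update (c : ℕ → ℂ) {s : Finset ι} {z : ι → ℂ} {a : ι}
    (ha : a ∉ s) {x : ℂ} (hx : x ∉ collisionSet δ β s z) :
    DifferentiableAt ℂ (fun x => splitDiff v c (insert a s) (Function.update z a x)) x :=
  (hv.differentiableAt_splitSum_update c ha hx).sub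
    (hv.neg.differentiableAt_splitSum_update c ha (by rwa [collisionSet_neg]))

variable (hδ : δ.im ≠ 0) (hβ : β ∉ lattice δ) (hβ_two : 2 * β ∉ lattice δ)
include hδ hβ hβ_two

lemma splitDiff_update_eq {s : Finset ι}
    (ih : ∀ t ⊂ s, ∀ (c : ℕ → ℂ) z, Generic δ β t z → splitDiff v c t z = 0)
    (c : ℕ → ℂ) {z : ι → ℂ} {a : ι} (ha : a ∉ s) (hz : Generic δ β s z) {x y : ℂ}
    (hx : x ∉ collisionSet δ β s z) (hy : y ∉ collisionSet δ β s z) :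
    splitDiff v c (insert a s) (Function.update z a x) =
      splitDiff v c (insert a s) (Function.update z a y) := by
  have hper {l : ℂ} (hl : l ∈ lattice δ) := hv.periodic_splitDiff_update c z ha hl
  refine eq_of_doublyPeriodic_of_removable hδ (eventually_notMem_collisionSet hδ β s z)
    (fun x hx => hv.differentiableAt_splitDiff_update c ha hx)
    (hper (by simpa using int_mem_lattice δ 1)) (hper (mem_lattice.mpr ⟨0, 1, by simp⟩)) ?_ hx hy
  rintro x ⟨b, hb, m, hm, hl⟩
  obtain ⟨t, hbt, rfl⟩ : ∃ t, b ∉ t ∧ insert b t = s :=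
    ⟨s.erase b, Finset.notMem_erase b s, Finset.insert_erase hb⟩
  have hvanish := ih t (Finset.ssubset_insert hbt) (fun n => c (n + 1)) z
    (hz.mono (Finset.subset_insert _ _))
  have hlim := hv.tendsto_sub_mul_splitDiff c ha hbt hz hβ hβ_two hvanish hm
  have hshift := tendsto_sub_mul_of_periodic (hper hl) hlim
  rwa [add_sub_cancel] at hshift

lemma splitDiff_piecewise {s : Finset ι}
    (ih : ∀ t ⊂ s, ∀ (c : ℕ → ℂ) z, Generic δ β t z → splitDiff v c t z = 0)
    (c : ℕ → ℂ) {z z' : ι → ℂ} (hz : ∀ u : Finset ι, Generic δ β s (u.piecewise z' z))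
    {u : Finset ι} (hu : u ⊆ s) : splitDiff v c s (u.piecewise z' z) = splitDiff v c s z := by
  induction u using Finset.induction_on with
  | empty => rw [Finset.piecewise_empty]
  | insert a u _ ihu =>
    rw [Finset.insert_subset_iff] at hu
    obtain ⟨t, hat, rfl⟩ : ∃ t, a ∉ t ∧ insert a t = s :=
      ⟨s.erase a, Finset.notMem_erase a s, Finset.insert_erase hu.1⟩
    have hcoll : z' a ∉ collisionSet δ β t (u.piecewise z' z) := by
      have h := (hz (insert a u)).notMem_collisionSet hat
      rw [Finset.piecewise_insert, Function.update_self, notMem_collisionSet] at h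
      rw [notMem_collisionSet]
      intro b hb m hm
      have := h b hb m hm
      rwa [Function.update_of_ne (ne_of_mem_of_not_mem hb hat)] at this
    have hmove := hv.splitDiff_update_eq hδ hβ hβ_two
      (fun t' ht' => ih t' (ht'.trans (Finset.ssubset_insert hat))) c hat
      ((hz u).mono (Finset.subset_insert a t)) hcoll ((hz u).notMem_collisionSet hat)
    rw [Finset.piecewise_insert, hmove, Function.update_eq_self, ihu hu.2]

omit hv hβ hβ_two in
lemma exists_generic_piecewise_const_sub {s : Finset ι} {z : ι → ℂ} (hz : Generic δ β s z) :
    ∃ w : ℂ, ∀ u : Finset ι, Generic δ β s (u.piecewise (fun i => w - z i) z) := by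
  have hev : ∀ᶠ w in 𝓝[≠] (0 : ℂ), ∀ i ∈ s, ∀ j ∈ s, ∀ m ∈ Finset.Icc (-2 : ℤ) 2,
      w - (z i + z j + m * β) ∉ lattice δ := by
    simp only [eventually_all_finset]
    exact fun i _ j _ m _ => eventually_notMem_lattice_sub hδ 0 _
  obtain ⟨w, hw⟩ := hev.exists
  refine ⟨w, fun u i hi j hj hij m hm => ?_⟩
  have hm_neg : -m ∈ Finset.Icc (-2 : ℤ) 2 := by rw [Finset.mem_Icc] at hm ⊢; omega
  by_cases hiu : i ∈ u <;> by_cases hju : j ∈ u <;> simp only [Finset.piecewise, hiu, hju, if_true,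
    if_false]
  · rw [sub_sub_sub_cancel_left]
    exact hz j hj i hi hij.symm m hm
  · convert hw i hi j hj (-m) hm_neg using 2
    push_cast
    ring
  · rw [← neg_mem_iff]
    convert hw i hi j hj m hm using 2
    ring
  · exact hz i hi j hj hij m hm

-- The difference is independent of each variable by Liouville, hence unchanged when all the `z_i`
-- are replaced by `w - z_i`; but this reflection changes its sign.
theorem splitDiff_eq_zero (c : ℕ → ℂ) {s : Finset ι} {z : ι → ℂ} (hz : Generic δ β s z) :
    splitDiff v c s z = 0 := by
  induction s using Finset.strongInduction generalizing c z with
  | H s ih =>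
    obtain ⟨w, hw⟩ := exists_generic_piecewise_const_sub hδ hz
    have hmove := hv.splitDiff_piecewise hδ hβ hβ_two (fun t ht c _ => ih t ht c) c hw
      (Finset.Subset.refl s)
    have hreflect : splitDiff v c s (s.piecewise (fun i => w - z i) z) = -splitDiff v c s z := by
      have hcongr : ∀ i ∈ s, s.piecewise (fun i => w - z i) z i = w - z i := fun i hi =>
        Finset.piecewise_eq_of_mem s _ _ hi
      rw [← splitDiff_const_sub v c w, splitDiff, splitDiff, splitSum_congr _ c hcongr,
        splitSum_congr _ c hcongr]
    exact self_eq_neg.mp (hmove.symm.trans hreflect)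

end IsTwoPole

end SplitSum

/-! ### The differentiated identity -/

/-- The elliptic function `f(x + γ) f(x + β - γ) / (f(x) f(x + β))`; the derivative at `β = 0` of
its splitting identity is the one that governs the bracket. -/
def twoPole (f : ℂ → ℂ) (γ β x : ℂ) : ℂ := f (x + γ) * f (x + β - γ) / (f x * f (x + β))

/-- The second difference `f'/f(x - γ) + f'/f(x + γ) - 2 f'/f(x)` of a logarithmic derivative. -/
def logDerivDiff (f : ℂ → ℂ) (γ x : ℂ) : ℂ :=
  logDeriv f (x - γ) + logDeriv f (x + γ) - 2 * logDeriv f x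

/-- The product `∏_{i ≠ j} h(z_i - z_j)` over ordered pairs of distinct elements of `I`. -/
def pairProd {ι : Type*} [DecidableEq ι] (h : ℂ → ℂ) (z : ι → ℂ) (I : Finset ι) : ℂ :=
  ∏ i ∈ I, ∏ j ∈ I, if i = j then 1 else h (z i - z j)

/-- The factor `f(x) / f(x + γ)` of the integration kernel. -/
def shiftRatio (f : ℂ → ℂ) (γ x : ℂ) : ℂ := f x / f (x + γ)

lemma hasDerivAt_prod_of_hasDerivAt_mul {𝕜 α : Type*} [NontriviallyNormedField 𝕜] (s : Finset α)
    {g : α → 𝕜 → 𝕜} {d : α → 𝕜} {x : 𝕜} (h : ∀ a ∈ s, HasDerivAt (g a) (g a x * d a) x) :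
    HasDerivAt (fun y => ∏ a ∈ s, g a y) ((∏ a ∈ s, g a x) * ∑ a ∈ s, d a) x := by
  classical
  induction s using Finset.induction_on with
  | empty => simpa using hasDerivAt_const x (1 : 𝕜)
  | insert a s ha ih =>
    simp only [Finset.prod_insert ha, Finset.sum_insert ha]
    exact ((h a (Finset.mem_insert_self _ _)).fun_mul
      (ih fun b hb => h b (Finset.mem_insert_of_mem hb))).congr_deriv (by ring)

lemma logDeriv_neg_of_odd {f : ℂ → ℂ} (hf : f.Odd) (x : ℂ) : logDeriv f (-x) = -logDeriv f x := by
  have hderiv : deriv (fun y => f (-y)) x = deriv (fun y => -f y) x := by simp only [hf _]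
  rw [deriv_comp_neg, deriv.fun_neg, neg_inj] at hderiv
  rw [logDeriv_apply, logDeriv_apply, hf, hderiv, div_neg]

lemma pairProd_eq_mul_mul {ι : Type*} [DecidableEq ι] (h : ℂ → ℂ) (z : ι → ℂ) {s I : Finset ι}
    (hI : I ⊆ s) : pairProd h z s = pairProd h z I * pairProd h z (s \ I) *
      ∏ i ∈ I, ∏ j ∈ s \ I, (h (z i - z j) * h (z j - z i)) := by
  have hne : ∀ i ∈ I, ∀ j ∈ s \ I, i ≠ j := fun i hi j hj =>
    ne_of_mem_of_not_mem hi (Finset.mem_sdiff.mp hj).2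
  have hout : ∏ i ∈ I, ∏ j ∈ s \ I, (if i = j then 1 else h (z i - z j)) =
      ∏ i ∈ I, ∏ j ∈ s \ I, h (z i - z j) :=
    Finset.prod_congr rfl fun i hi => Finset.prod_congr rfl fun j hj => if_neg (hne i hi j hj)
  have hin : ∏ j ∈ s \ I, ∏ i ∈ I, (if j = i then 1 else h (z j - z i)) =
      ∏ i ∈ I, ∏ j ∈ s \ I, h (z j - z i) := by
    rw [Finset.prod_comm]
    exact Finset.prod_congr rfl fun i hi => Finset.prod_congr rfl fun j hj =>
      if_neg (hne i hi j hj).symm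
  simp only [pairProd, ← Finset.prod_sdiff hI, Finset.prod_mul_distrib, hout, hin]
  ring

namespace IsOddTheta

variable {δ : ℂ} {f : ℂ → ℂ} (hf : IsOddTheta δ f)
include hf

lemma periodic_twoPole_tau (γ β : ℂ) : (twoPole f γ β).Periodic δ := by
  intro x
  have hfactor : e (x + γ) * e (x + β - γ) = e x * e (x + β) := by
    rw [← e_add, ← e_add]
    ring_nf
  rw [twoPole, add_right_comm x δ γ, add_right_comm x δ β, add_sub_right_comm (x + β) δ γ]
  simp only [hf.add_tau, neg_mul_neg]
  set C := cexp (-(Real.pi * I * δ))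
  have hC : C ≠ 0 := Complex.exp_ne_zero _
  have hmul : ∀ a b u v : ℂ, C * a⁻¹ * u * (C * b⁻¹ * v) = C ^ 2 * (a * b)⁻¹ * (u * v) := by
    intro a b u v
    rw [mul_inv]
    ring
  rw [hmul, hmul, hfactor, mul_div_mul_left _ _ (mul_ne_zero (pow_ne_zero 2 hC)
    (inv_ne_zero (mul_ne_zero (e_ne_zero _) (e_ne_zero _)))), twoPole]

lemma tendsto_mul_twoPole (γ : ℂ) {β : ℂ} (hβ : β ∉ lattice δ) :
    Tendsto (fun x => x * twoPole f γ β x) (𝓝[≠] 0)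
      (𝓝 ((deriv f 0)⁻¹ * (f γ * f (β - γ) / f β))) := by
  have hcont : ContinuousAt (fun x => f (x + γ) * f (x + β - γ) / f (x + β)) 0 := by
    have := hf.differentiable.continuous
    refine ContinuousAt.div (by fun_prop) (by fun_prop) ?_
    rw [zero_add]
    exact hf.ne_zero hβ
  have h := hf.tendsto_mul_inv.mul (hcont.tendsto.mono_left nhdsWithin_le_nhds)
  simp only [zero_add] at h
  refine h.congr fun x => ?_
  rw [twoPole, div_eq_mul_inv, div_eq_mul_inv, mul_inv]
  ring

lemma isTwoPole (γ : ℂ) {β : ℂ} (hβ : β ∉ lattice δ) :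
    IsTwoPole δ β ((deriv f 0)⁻¹ * (f γ * f (β - γ) / f β)) (twoPole f γ β) where
  periodic_one x := by
    rw [twoPole, add_right_comm x 1 γ, add_right_comm x 1 β, add_sub_right_comm (x + β) 1 γ]
    simp only [hf.antiperiodic _, neg_mul_neg]
    rw [twoPole]
  periodic_tau := hf.periodic_twoPole_tau γ β
  differentiableAt x hx hxβ := by
    have := hf.differentiable
    unfold twoPole
    exact DifferentiableAt.div (by fun_prop) (by fun_prop)
      (mul_ne_zero (hf.ne_zero hx) (hf.ne_zero hxβ))
  reflect x := by
    have hnum : -x - β + γ = -(x + β - γ) := by ring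
    have hden : -x - β = -(x + β) := by ring
    rw [twoPole, twoPole, sub_add_cancel, hnum, hden, ← neg_add', hf.odd, hf.odd, hf.odd, hf.odd,
      neg_mul_neg, neg_mul_neg, mul_comm, mul_comm (f (x + β))]
  tendsto_zero := hf.tendsto_mul_twoPole γ hβ

lemma twoPole_zero_neg (γ x : ℂ) : twoPole f γ 0 (-x) = twoPole f γ 0 x := by
  rw [twoPole, twoPole, add_zero, add_zero, ← sub_neg_eq_add, ← neg_add', ← neg_add', hf.odd,
    hf.odd, hf.odd, neg_mul_neg, neg_mul_neg, mul_comm, ← sub_eq_add_neg]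

lemma hasDerivAt_twoPole {γ x : ℂ} (hx : x ∉ lattice δ) (hxγ : x - γ ∉ lattice δ) :
    HasDerivAt (fun β => twoPole f γ β x)
      (twoPole f γ 0 x * (logDeriv f (x - γ) - logDeriv f x)) 0 := by
  have hfx := hf.ne_zero hx
  have hfxγ := hf.ne_zero hxγ
  have hnum : HasDerivAt (fun β : ℂ => f (x + β - γ)) (deriv f (x - γ)) 0 := by
    have h := (hf.differentiable (x - γ + 0)).hasDerivAt.comp_const_add (x - γ) 0
    simpa only [add_zero, sub_add_eq_add_sub] using h
  have hden : HasDerivAt (fun β : ℂ => f (x + β)) (deriv f x) 0 := by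
    simpa only [add_zero] using (hf.differentiable (x + 0)).hasDerivAt.comp_const_add x 0
  refine ((hnum.const_mul (f (x + γ))).div (hden.const_mul (f x))
    (by rw [add_zero]; exact mul_ne_zero hfx hfx)).congr_deriv ?_
  simp only [twoPole, add_zero, logDeriv_apply]
  field_simp

lemma hasDerivAt_twoPole_neg {γ x : ℂ} (hx : -x ∉ lattice δ) (hxγ : -x - γ ∉ lattice δ) :
    HasDerivAt (fun β => twoPole f γ β (-x))
      (twoPole f γ 0 (-x) * (logDeriv f x - logDeriv f (x + γ))) 0 := by
  refine (hf.hasDerivAt_twoPole hx hxγ).congr_deriv ?_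
  rw [← neg_add', logDeriv_neg_of_odd hf.odd, logDeriv_neg_of_odd hf.odd, neg_sub_neg]

section Splittings

variable {ι : Type*} {s : Finset ι} {z : ι → ℂ}
  (hz : ∀ i ∈ s, ∀ j ∈ s, i ≠ j → z i - z j ∉ lattice δ)
include hz

lemma eventually_generic : ∀ᶠ β in 𝓝 (0 : ℂ), Generic δ β s z := by
  simp only [Generic, eventually_all_finset, eventually_imp_distrib_left]
  intro i hi j hj hij m _
  have hcont : Continuous fun β : ℂ => f (z i - z j + m * β) :=
    hf.differentiable.continuous.comp (by fun_prop)
  have hzero : f (z i - z j + m * 0) ≠ 0 := by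
    rw [mul_zero, add_zero]
    exact hf.ne_zero (hz i hi j hj hij)
  filter_upwards [hcont.continuousAt.eventually_ne hzero] with β hβ
  exact (hf.eq_zero_iff _).not.mp hβ

variable [DecidableEq ι] (hδ : δ.im ≠ 0)
include hδ

lemma eventually_splitDiff_twoPole_eq_zero (γ : ℂ) (c : ℕ → ℂ) :
    ∀ᶠ β in 𝓝 (0 : ℂ), splitDiff (twoPole f γ β) c s z = 0 := by
  have hdouble : Tendsto (fun β : ℂ => 2 * β) (𝓝[≠] 0) (𝓝[≠] 0) := by
    have h : Tendsto (fun β : ℂ => 2 * β) (𝓝[≠] 0) (𝓝[≠] (2 * 0)) :=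
      ((Homeomorph.mulLeft₀ (2 : ℂ) two_ne_zero).map_punctured_nhds_eq 0).le
    rwa [mul_zero] at h
  have hpunctured : ∀ᶠ β in 𝓝[≠] (0 : ℂ), splitDiff (twoPole f γ β) c s z = 0 := by
    filter_upwards [eventually_notMem_lattice hδ 0,
      hdouble.eventually (eventually_notMem_lattice hδ 0),
      nhdsWithin_le_nhds (hf.eventually_generic hz)] with β hβ hβ_two hgeneric
    exact (hf.isTwoPole γ hβ).splitDiff_eq_zero hδ hβ hβ_two c hgeneric
  filter_upwards [eventually_nhdsWithin_iff.mp hpunctured] with β hβ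
  rcases eq_or_ne β 0 with rfl | hne
  · simp only [splitDiff, hf.twoPole_zero_neg, sub_self]
  · exact hβ hne

variable {γ : ℂ} (hzγ : ∀ i ∈ s, ∀ j ∈ s, z i - z j - γ ∉ lattice δ)
include hzγ

lemma sum_splitProd_mul_logDerivDiff (c : ℕ → ℂ) :
    ∑ I ∈ s.powerset, c I.card * (splitProd (twoPole f γ 0) z s I *
      ∑ i ∈ I, ∑ j ∈ s \ I, logDerivDiff f γ (z i - z j)) = 0 := by
  have hne : ∀ I ∈ s.powerset, ∀ i ∈ I, ∀ j ∈ s \ I, i ∈ s ∧ j ∈ s ∧ i ≠ j := by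
    intro I hI i hi j hj
    rw [Finset.mem_sdiff] at hj
    exact ⟨Finset.mem_powerset.mp hI hi, hj.1, ne_of_mem_of_not_mem hi hj.2⟩
  have hderiv : ∀ I ∈ s.powerset, HasDerivAt (fun β => c I.card * splitProd (twoPole f γ β) z s I)
      (c I.card * (splitProd (twoPole f γ 0) z s I * ∑ i ∈ I, ∑ j ∈ s \ I,
        (logDeriv f (z i - z j - γ) - logDeriv f (z i - z j)))) 0 := fun I hI =>
    (hasDerivAt_prod_of_hasDerivAt_mul I fun i hi => hasDerivAt_prod_of_hasDerivAt_mul _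
      fun j hj => by
        obtain ⟨his, hjs, hij⟩ := hne I hI i hi j hj
        exact hf.hasDerivAt_twoPole (hz i his j hjs hij) (hzγ i his j hjs)).const_mul _
  have hderiv_neg : ∀ I ∈ s.powerset,
      HasDerivAt (fun β => c I.card * splitProd (fun x => twoPole f γ β (-x)) z s I)
      (c I.card * (splitProd (fun x => twoPole f γ 0 (-x)) z s I * ∑ i ∈ I, ∑ j ∈ s \ I,
        (logDeriv f (z i - z j) - logDeriv f (z i - z j + γ)))) 0 := fun I hI =>
    (hasDerivAt_prod_of_hasDerivAt_mul I fun i hi => hasDerivAt_prod_of_hasDerivAt_mul _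
      fun j hj => by
        obtain ⟨his, hjs, hij⟩ := hne I hI i hi j hj
        exact hf.hasDerivAt_twoPole_neg (by rw [neg_sub]; exact hz j hjs i his hij.symm)
          (by rw [neg_sub]; exact hzγ j hjs i his)).const_mul _
  simp only [hf.twoPole_zero_neg] at hderiv_neg
  have hzero : HasDerivAt (fun β => splitDiff (twoPole f γ β) c s z) 0 0 :=
    (hasDerivAt_const (0 : ℂ) (0 : ℂ)).congr_of_eventuallyEq
      (hf.eventually_splitDiff_twoPole_eq_zero hz hδ γ c)
  refine Eq.trans ?_
    (((HasDerivAt.fun_sum hderiv).sub (HasDerivAt.fun_sum hderiv_neg)).unique hzero)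
  simp only [← Finset.sum_sub_distrib, ← mul_sub, logDerivDiff]
  congr! 5
  ring

omit hδ in
lemma prod_shiftRatio_mul_splitProd {I : Finset ι} (hI : I ⊆ s) :
    (∏ i ∈ I, ∏ j ∈ s \ I, (shiftRatio f γ (z i - z j) * shiftRatio f γ (z j - z i))) *
      splitProd (twoPole f γ 0) z s I = 1 := by
  simp only [splitProd, ← Finset.prod_mul_distrib]
  refine Finset.prod_eq_one fun i hi => Finset.prod_eq_one fun j hj => ?_
  obtain ⟨hjs, hjI⟩ := Finset.mem_sdiff.mp hj
  have hne := hf.ne_zero (hz i (hI hi) j hjs (ne_of_mem_of_not_mem hi hjI))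
  have hne_left := hf.ne_zero (hzγ i (hI hi) j hjs)
  have hne_right := hf.ne_zero (hzγ j hjs i (hI hi))
  have hplus : ∀ a b : ℂ, f (a - b + γ) = -f (b - a - γ) := fun a b => by
    rw [← hf.odd]
    ring_nf
  have hswap : f (z j - z i) = -f (z i - z j) := by rw [← hf.odd, neg_sub]
  rw [shiftRatio, shiftRatio, twoPole, add_zero, hplus, hplus, hswap]
  field_simp

theorem sum_pairProd_mul_logDerivDiff (c : ℕ → ℂ) :
    ∑ I ∈ s.powerset, c I.card * (pairProd (shiftRatio f γ) z I *
      pairProd (shiftRatio f γ) z (s \ I) *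
        ∑ i ∈ I, ∑ j ∈ s \ I, logDerivDiff f γ (z i - z j)) = 0 := by
  rw [← mul_zero (pairProd (shiftRatio f γ) z s),
    ← hf.sum_splitProd_mul_logDerivDiff hz hδ hzγ c, Finset.mul_sum]
  refine Finset.sum_congr rfl fun I hI => ?_
  rw [Finset.mem_powerset] at hI
  rw [pairProd_eq_mul_mul _ _ hI]
  linear_combination (-c I.card * pairProd (shiftRatio f γ) z I *
    pairProd (shiftRatio f γ) z (s \ I) *
      ∑ i ∈ I, ∑ j ∈ s \ I, logDerivDiff f γ (z i - z j)) *
        hf.prod_shiftRatio_mul_splitProd hz hzγ hI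

end Splittings

end IsOddTheta

/-! ### The regularised kernel of the bracket -/

lemma notMem_lattice_of_im {δ x : ℂ} (hpos : 0 < x.im) (hlt : x.im < δ.im) : x ∉ lattice δ := by
  intro hx
  obtain ⟨m, n, rfl⟩ := mem_lattice.mp hx
  have him : ((m : ℂ) + n * δ).im = n * δ.im := by simp
  rw [him] at hpos hlt
  have hδ : 0 < δ.im := hpos.trans hlt |>.trans_eq rfl
  have hn_pos : (0 : ℝ) < n := pos_of_mul_pos_left hpos hδ.le
  have hn_lt : (n : ℝ) < 1 := lt_of_mul_lt_mul_right (by rwa [one_mul]) hδ.le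
  norm_cast at hn_pos hn_lt
  omega

lemma ofReal_mem_lattice_iff {δ : ℂ} (hδ : δ.im ≠ 0) {u : ℝ} :
    (u : ℂ) ∈ lattice δ ↔ e u = 1 := by
  rw [e_eq_one_iff]
  constructor
  · intro h
    obtain ⟨m, n, hmn⟩ := mem_lattice.mp h
    have hn : n = 0 := by simpa [hδ] using congrArg Complex.im hmn
    exact ⟨m, by rw [← hmn, hn, Int.cast_zero, zero_mul, add_zero]⟩
  · rintro ⟨n, h⟩
    rw [h]
    exact int_mem_lattice δ n

lemma norm_inv_e_ofReal (u : ℝ) : ‖(e u)⁻¹‖ = 1 := by rw [norm_inv, norm_e_ofReal, inv_one]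

lemma logDeriv_e (x : ℂ) : logDeriv e x = 2 * Real.pi * I := by
  rw [logDeriv_apply, (hasDerivAt_e x).deriv, mul_div_cancel_right₀ _ (e_ne_zero x)]

lemma logDeriv_const_div_e {a : ℂ} (ha : a ≠ 0) (x : ℂ) :
    logDeriv (fun y => a / e y) x = -(2 * Real.pi * I) := by
  rw [logDeriv_div x ha (e_ne_zero x) (differentiableAt_const a) differentiable_e.differentiableAt,
    logDeriv_const, Pi.zero_apply, logDeriv_e, zero_sub]

lemma logDeriv_qPochhammer_comp {p : ℂ} (hp : ‖p‖ < 1) {g : ℂ → ℂ} {x : ℂ}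
    (hg : DifferentiableAt ℂ g x) (hgx : g x ≠ 0) (hq : qPochhammer p (g x) ≠ 0) :
    logDeriv (fun y => qPochhammer p (g y)) x = -(lambertSeries p (g x) * logDeriv g x) := by
  have hcomp := logDeriv_comp (differentiable_qPochhammer hp (g x)) hg
  rw [Function.comp_def] at hcomp
  rw [hcomp, ← neg_mul, ← mul_logDeriv_qPochhammer hp hq, logDeriv_apply g]
  field_simp

lemma logDeriv_theta_eq_lambertSeries {δ x : ℂ} (hδ : 0 < δ.im) (hx : x ∉ lattice δ) :
    logDeriv (theta δ) x = 2 * Real.pi * I *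
      (-(1 / 2) - lambertSeries (e δ) (e x) + lambertSeries (e δ) (e δ / e x)) := by
  have hp := norm_e_lt_one hδ
  have hdiff : DifferentiableAt ℂ (fun y => e δ / e y) x :=
    (differentiableAt_const _).div differentiable_e.differentiableAt (e_ne_zero x)
  have hne := (isOddTheta_oddProd hδ).ne_zero hx
  rw [oddProd] at hne
  have hright := right_ne_zero_of_mul hne
  have hleft := right_ne_zero_of_mul (left_ne_zero_of_mul hne)
  have hexp : HasDerivAt (fun y : ℂ => cexp (-(Real.pi * I * y)))
      (cexp (-(Real.pi * I * x)) * -(Real.pi * I * 1)) x :=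
    (((hasDerivAt_id x).const_mul (Real.pi * I : ℂ)).neg).cexp
  have hlogDeriv_exp : logDeriv (fun y : ℂ => cexp (-(Real.pi * I * y))) x = -(Real.pi * I) := by
    rw [logDeriv_apply, hexp.deriv, mul_one, mul_div_cancel_left₀ _ (Complex.exp_ne_zero _)]
  have hdiff_left : DifferentiableAt ℂ (fun y => qPochhammer (e δ) (e y)) x :=
    ((differentiable_qPochhammer hp).comp differentiable_e).differentiableAt
  have hdiff_right : DifferentiableAt ℂ (fun y => qPochhammer (e δ) (e δ / e y)) x :=
    (differentiable_qPochhammer hp _).comp x hdiff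
  rw [logDeriv_theta hδ, funext (oddProd.eq_1 δ),
    logDeriv_mul (f := fun y => cexp (-(Real.pi * I * y)) * qPochhammer (e δ) (e y)) x
      (left_ne_zero_of_mul hne) hright (hexp.differentiableAt.mul hdiff_left) hdiff_right,
    logDeriv_mul (f := fun y => cexp (-(Real.pi * I * y))) x (Complex.exp_ne_zero _) hleft
      hexp.differentiableAt hdiff_left, hlogDeriv_exp,
    logDeriv_qPochhammer_comp hp differentiable_e.differentiableAt (e_ne_zero x) hleft,
    logDeriv_qPochhammer_comp hp hdiff (div_ne_zero (e_ne_zero δ) (e_ne_zero x)) hright,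
    logDeriv_e, logDeriv_const_div_e (e_ne_zero δ)]
  ring

/-- The generating series `∑_{n ≥ 1} c_n z^n` of the structure constants. Since `c_n → 1`, splitting
off the geometric series makes sense of it on the closed unit disc without the point `1`. -/
def bracketSeries (γ δ z : ℂ) : ℂ :=
  z / (1 - z) + ∑' n : ℕ, (structConst γ δ (n + 1 : ℕ) - 1) * z ^ (n + 1)

/-- The Abel regularisation of the kernel `∑_{n ≠ 0} c_n e^{-2πinu}` of the bracket, in closed
form. -/
def regKernel (γ δ : ℂ) (r u : ℝ) : ℂ :=
  bracketSeries γ δ (r * (e u)⁻¹) - bracketSeries γ δ (r * e u)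

lemma regKernel_neg (γ δ : ℂ) (r u : ℝ) : regKernel γ δ r (-u) = -regKernel γ δ r u := by
  rw [regKernel, regKernel, neg_sub, ofReal_neg, e_neg, inv_inv]

lemma structConst_zero (γ δ : ℂ) : structConst γ δ 0 = 0 := by simp [structConst]

lemma structConst_eq_e (γ δ : ℂ) (n : ℤ) :
    structConst γ δ n = (1 - e γ ^ n) * (1 - e δ ^ n * e γ ^ (-n)) / (1 - e δ ^ n) := by
  simp only [structConst, e_eq_cexp]

lemma norm_ofReal_mul_of_norm_eq_one {r : ℝ} (hr : 0 ≤ r) {z : ℂ} (hz : ‖z‖ = 1) :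
    ‖(r : ℂ) * z‖ = r := by
  rw [norm_mul, hz, mul_one, norm_real, Real.norm_of_nonneg hr]

lemma norm_one_sub_le_two_mul {r : ℝ} (hr : 0 ≤ r) (hr_le : r ≤ 1) {z : ℂ} (hz : ‖z‖ = 1) :
    ‖1 - z‖ ≤ 2 * ‖1 - r * z‖ := by
  have htriangle := norm_sub_le_norm_sub_add_norm_sub (1 : ℂ) (r * z) z
  have hradial : ‖(r : ℂ) * z - z‖ = 1 - r := by
    rw [← sub_one_mul, norm_mul, hz, mul_one, ← ofReal_one, ← ofReal_sub, norm_real,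
      Real.norm_of_nonpos (by linarith), neg_sub]
  have hdist : 1 - r ≤ ‖1 - r * z‖ := by
    have h := norm_sub_norm_le (1 : ℂ) (r * z)
    rwa [norm_one, norm_ofReal_mul_of_norm_eq_one hr hz] at h
  linarith

lemma norm_one_sub_mul_norm_geom_le {r : ℝ} (hr : 0 ≤ r) (hr_lt : r < 1) {z : ℂ} (hz : ‖z‖ = 1) :
    ‖1 - z‖ * ‖r * z / (1 - r * z)‖ ≤ 2 := by
  have hnorm := norm_ofReal_mul_of_norm_eq_one hr hz
  have hpos : 0 < ‖1 - r * z‖ := by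
    rw [norm_pos_iff, sub_ne_zero]
    rintro h
    exact hr_lt.ne (by rw [← hnorm, ← h, norm_one])
  rw [norm_div, hnorm, mul_div_assoc', div_le_iff₀ hpos]
  exact (mul_le_of_le_one_right (norm_nonneg _) hr_lt.le).trans
    (norm_one_sub_le_two_mul hr hr_lt.le hz)

section

variable {γ δ : ℂ} (hγ : 0 < γ.im) (hγδ : γ.im < δ.im)
include hγ hγδ

omit hγ hγδ in
lemma structConst_succ_sub_one (hδ : 0 < δ.im) (n : ℕ) :
    structConst γ δ (n + 1 : ℕ) - 1 = 2 * (e δ ^ (n + 1) / (1 - e δ ^ (n + 1))) -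
      e γ ^ (n + 1) / (1 - e δ ^ (n + 1)) - (e δ / e γ) ^ (n + 1) / (1 - e δ ^ (n + 1)) := by
  have hden : 1 - e δ ^ (n + 1) ≠ 0 := by
    refine sub_ne_zero.mpr fun h => ?_
    have hlt := pow_lt_one₀ (norm_nonneg _) (norm_e_lt_one hδ) n.succ_ne_zero
    rw [← norm_pow, ← h, norm_one] at hlt
    exact hlt.false
  have hγ_ne : e γ ^ (n + 1) ≠ 0 := pow_ne_zero _ (e_ne_zero γ)
  rw [structConst_eq_e, zpow_neg, zpow_natCast, zpow_natCast, div_pow]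
  field_simp
  ring

lemma hasSum_structConst_sub_one {z : ℂ} (hz : ‖z‖ ≤ 1) :
    HasSum (fun n : ℕ => (structConst γ δ (n + 1 : ℕ) - 1) * z ^ (n + 1))
      (2 * lambertSeries (e δ) (e δ * z) - lambertSeries (e δ) (e γ * z) -
        lambertSeries (e δ) (e δ / e γ * z)) := by
  have hp := norm_e_lt_one (hγ.trans hγδ)
  have hratio : ‖e δ / e γ‖ < 1 := by
    rw [← e_sub]
    exact norm_e_lt_one (by simpa)
  have hmul : ∀ {w : ℂ}, ‖w‖ < 1 → ‖w * z‖ < 1 := fun hw => by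
    rw [norm_mul]
    exact (mul_le_of_le_one_right (norm_nonneg _) hz).trans_lt hw
  refine ((((hasSum_lambertSeries hp (hmul hp)).mul_left 2).sub
    (hasSum_lambertSeries hp (hmul (norm_e_lt_one hγ)))).sub
      (hasSum_lambertSeries hp (hmul hratio))).congr_fun fun n => ?_
  rw [structConst_succ_sub_one (hγ.trans hγδ), mul_pow, mul_pow, mul_pow]
  ring

lemma summable_norm_structConst_sub_one :
    Summable fun n : ℕ => ‖structConst γ δ (n + 1 : ℕ) - 1‖ := by
  simpa using (hasSum_structConst_sub_one hγ hγδ (z := 1) (by simp)).summable.norm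

omit hγ hγδ in
lemma norm_structConst_sub_one_mul_pow_le {z : ℂ} (hz : ‖z‖ ≤ 1) (n : ℕ) :
    ‖(structConst γ δ (n + 1 : ℕ) - 1) * z ^ (n + 1)‖ ≤ ‖structConst γ δ (n + 1 : ℕ) - 1‖ := by
  rw [norm_mul, norm_pow]
  exact mul_le_of_le_one_right (norm_nonneg _) (pow_le_one₀ (norm_nonneg _) hz)

lemma continuousOn_bracketSeries :
    ContinuousOn (bracketSeries γ δ) (Metric.closedBall 0 1 \ {1}) := by
  refine ContinuousOn.add (ContinuousOn.div (by fun_prop) (by fun_prop)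
    fun z hz => sub_ne_zero.mpr (Ne.symm hz.2)) ?_
  exact continuousOn_tsum (fun n => by fun_prop) (summable_norm_structConst_sub_one hγ hγδ)
    fun n z hz => norm_structConst_sub_one_mul_pow_le (mem_closedBall_zero_iff.mp hz.1) n

lemma hasSum_bracketSeries {z : ℂ} (hz : ‖z‖ < 1) :
    HasSum (fun n : ℕ => structConst γ δ (n + 1 : ℕ) * z ^ (n + 1)) (bracketSeries γ δ z) := by
  have hgeom : HasSum (fun n : ℕ => z ^ (n + 1)) (z / (1 - z)) := by
    simpa only [pow_succ', div_eq_mul_inv] using (hasSum_geometric_of_norm_lt_one hz).mul_left z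
  refine (hgeom.add (hasSum_structConst_sub_one hγ hγδ hz.le).summable.hasSum).congr_fun
    fun n => ?_
  ring

lemma logDerivDiff_theta {u : ℝ} (hu : e u ≠ 1) :
    logDerivDiff (theta δ) γ u = 2 * Real.pi * I *
      (bracketSeries γ δ (e u) - bracketSeries γ δ (e u)⁻¹) := by
  have hδ : 0 < δ.im := hγ.trans hγδ
  have hmem : (u : ℂ) ∉ lattice δ := (ofReal_mem_lattice_iff hδ.ne').not.mpr hu
  have hmem_add : (u : ℂ) + γ ∉ lattice δ := notMem_lattice_of_im (by simpa) (by simpa)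
  have hmem_sub : γ - (u : ℂ) ∉ lattice δ := notMem_lattice_of_im (by simpa) (by simpa)
  have hu_sub : 1 - e u ≠ 0 := sub_ne_zero.mpr hu.symm
  have hu_ne := e_ne_zero u
  have hgeom : (e (u : ℂ))⁻¹ / (1 - (e u)⁻¹) = -1 - e u / (1 - e u) := by
    have : e (u : ℂ) - 1 ≠ 0 := sub_ne_zero.mpr hu
    field_simp
    ring
  rw [bracketSeries, bracketSeries,
    (hasSum_structConst_sub_one hγ hγδ (norm_e_ofReal u).le).tsum_eq,
    (hasSum_structConst_sub_one hγ hγδ (norm_inv_e_ofReal u).le).tsum_eq, hgeom,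
    logDerivDiff, ← neg_sub γ (u : ℂ), logDeriv_neg_of_odd (theta_odd δ),
    logDeriv_theta_eq_lambertSeries hδ hmem, logDeriv_theta_eq_lambertSeries hδ hmem_add,
    logDeriv_theta_eq_lambertSeries hδ hmem_sub,
    lambertSeries_eq_div_add (norm_e_lt_one hδ) (e u), e_add, e_sub, div_div_eq_mul_div,
    mul_comm (e (u : ℂ)) (e γ), ← div_div (e δ) (e γ), mul_div_right_comm (e δ) (e (u : ℂ)) (e γ)]
  simp only [div_eq_mul_inv _ (e (u : ℂ))]
  ring

lemma exists_norm_one_sub_mul_norm_bracketSeries_le : ∃ C : ℝ, ∀ r : ℝ, 0 ≤ r → r < 1 →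
    ∀ z : ℂ, ‖z‖ = 1 → ‖1 - z‖ * ‖bracketSeries γ δ (r * z)‖ ≤ C := by
  refine ⟨2 + 2 * ∑' n : ℕ, ‖structConst γ δ (n + 1 : ℕ) - 1‖, fun r hr hr_lt z hz => ?_⟩
  rw [bracketSeries]
  set S := ∑' n : ℕ, (structConst γ δ (n + 1 : ℕ) - 1) * (r * z) ^ (n + 1)
  have hrz : ‖(r : ℂ) * z‖ ≤ 1 := (norm_ofReal_mul_of_norm_eq_one hr hz).trans_le hr_lt.le
  have hregular : ‖S‖ ≤ ∑' n : ℕ, ‖structConst γ δ (n + 1 : ℕ) - 1‖ :=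
    tsum_of_norm_bounded (summable_norm_structConst_sub_one hγ hγδ).hasSum
      (norm_structConst_sub_one_mul_pow_le hrz)
  have htwo : ‖1 - z‖ ≤ 2 := (norm_sub_le _ _).trans (by rw [norm_one, hz, one_add_one_eq_two])
  calc ‖1 - z‖ * ‖r * z / (1 - r * z) + S‖
      ≤ ‖1 - z‖ * (‖r * z / (1 - r * z)‖ + ‖S‖) := by gcongr; exact norm_add_le _ _
    _ = ‖1 - z‖ * ‖r * z / (1 - r * z)‖ + ‖1 - z‖ * ‖S‖ := mul_add _ _ _
    _ ≤ 2 + 2 * ∑' n : ℕ, ‖structConst γ δ (n + 1 : ℕ) - 1‖ := by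
      gcongr
      exact norm_one_sub_mul_norm_geom_le hr hr_lt hz

lemma exists_norm_one_sub_mul_norm_regKernel_le : ∃ C : ℝ, ∀ r : ℝ, 0 ≤ r → r < 1 →
    ∀ u : ℝ, ‖1 - e u‖ * ‖regKernel γ δ r u‖ ≤ C := by
  obtain ⟨C, hC⟩ := exists_norm_one_sub_mul_norm_bracketSeries_le hγ hγδ
  refine ⟨C + C, fun r hr hr_lt u => ?_⟩
  have hinv : ‖1 - (e u)⁻¹‖ = ‖1 - e u‖ := by
    rw [← norm_neg, neg_sub, ← mul_one ‖_ - _‖, ← norm_e_ofReal u, ← norm_mul, sub_mul,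
      inv_mul_cancel₀ (e_ne_zero _), one_mul]
  calc ‖1 - e u‖ * ‖regKernel γ δ r u‖
      ≤ ‖1 - e u‖ * (‖bracketSeries γ δ (r * (e u)⁻¹)‖ + ‖bracketSeries γ δ (r * e u)‖) := by
        gcongr
        exact norm_sub_le _ _
    _ = ‖1 - (e u)⁻¹‖ * ‖bracketSeries γ δ (r * (e u)⁻¹)‖ +
        ‖1 - e u‖ * ‖bracketSeries γ δ (r * e u)‖ := by rw [hinv, mul_add]
    _ ≤ C + C := add_le_add (hC r hr hr_lt _ (norm_inv_e_ofReal u))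
        (hC r hr hr_lt _ (norm_e_ofReal u))

lemma tendsto_bracketSeries_ofReal_mul {z : ℂ} (hz : ‖z‖ = 1) (hz_ne : z ≠ 1) :
    Tendsto (fun r : ℝ => bracketSeries γ δ (r * z)) (𝓝[<] 1) (𝓝 (bracketSeries γ δ z)) := by
  have hpath : Tendsto (fun r : ℝ => (r : ℂ) * z) (𝓝[<] 1)
      (𝓝[Metric.closedBall 0 1 \ {1}] z) := by
    refine tendsto_nhdsWithin_iff.mpr ⟨?_, ?_⟩
    · exact Continuous.tendsto' (by fun_prop) _ _ (by simp) |>.mono_left nhdsWithin_le_nhds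
    · filter_upwards [self_mem_nhdsWithin, nhdsWithin_le_nhds (eventually_ge_nhds one_pos)]
        with r hr_lt hr
      have hnorm := norm_ofReal_mul_of_norm_eq_one hr hz
      refine ⟨mem_closedBall_zero_iff.mpr (hnorm.trans_le (le_of_lt hr_lt)), fun h => ?_⟩
      exact (Set.mem_Iio.mp hr_lt).ne
        (hnorm.symm.trans (by rw [Set.mem_singleton_iff.mp h, norm_one]))
  exact (continuousOn_bracketSeries hγ hγδ z
    ⟨mem_closedBall_zero_iff.mpr hz.le, hz_ne⟩).tendsto.comp hpath

lemma tendsto_regKernel {u : ℝ} (hu : e u ≠ 1) :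
    Tendsto (fun r => regKernel γ δ r u) (𝓝[<] 1)
      (𝓝 (-(2 * Real.pi * I)⁻¹ * logDerivDiff (theta δ) γ u)) := by
  rw [logDerivDiff_theta hγ hγδ hu, neg_mul, inv_mul_cancel_left₀ Complex.two_pi_I_ne_zero,
    neg_sub]
  exact (tendsto_bracketSeries_ofReal_mul hγ hγδ (norm_inv_e_ofReal u) (inv_ne_one.mpr hu)).sub
    (tendsto_bracketSeries_ofReal_mul hγ hγδ (norm_e_ofReal u) hu)

variable {r : ℝ} (hr : 0 ≤ r) (hr_lt : r < 1)
include hr hr_lt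

lemma continuous_regKernel : Continuous (regKernel γ δ r) := by
  have hcont : ∀ {g : ℝ → ℂ}, Continuous g → (∀ u, ‖g u‖ = 1) →
      Continuous fun u => bracketSeries γ δ (r * g u) := by
    intro g hg hnorm
    refine (continuousOn_bracketSeries hγ hγδ).comp_continuous (continuous_const.mul hg)
      fun u => ?_
    have hlt : ‖(r : ℂ) * g u‖ < 1 :=
      (norm_ofReal_mul_of_norm_eq_one hr (hnorm u)).trans_lt hr_lt
    exact ⟨mem_closedBall_zero_iff.mpr hlt.le, fun h => hlt.ne (by rw [h, norm_one])⟩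
  have he : Continuous fun u : ℝ => e u := differentiable_e.continuous.comp continuous_ofReal
  exact (hcont (he.inv₀ fun u => e_ne_zero u) norm_inv_e_ofReal).sub (hcont he norm_e_ofReal)

lemma hasSum_regKernel (u : ℝ) :
    HasSum (fun n : Mode => structConst γ δ n * (r : ℂ) ^ (n : ℤ).natAbs * e (-((n : ℤ) * u)))
      (regKernel γ δ r u) := by
  let f : ℤ → ℂ := fun n => structConst γ δ n * (r : ℂ) ^ n.natAbs * e (-(n * u))
  have hf : ∀ n, f n = structConst γ δ n * (r : ℂ) ^ n.natAbs * e (-(n * u)) := fun _ => rfl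
  have hzero : f 0 = 0 := by rw [hf, structConst_zero, zero_mul, zero_mul]
  have hsum : ∀ {z : ℂ}, ‖z‖ = 1 → HasSum
      (fun n : ℕ => structConst γ δ (n + 1 : ℕ) * (r * z) ^ (n + 1)) (bracketSeries γ δ (r * z)) :=
    fun hz => hasSum_bracketSeries hγ hγδ
      ((norm_ofReal_mul_of_norm_eq_one hr hz).trans_lt hr_lt)
  have hpos : ∀ n : ℕ, f (n + 1) = structConst γ δ (n + 1 : ℕ) * (r * (e u)⁻¹) ^ (n + 1) := by
    intro n
    rw [hf, ← Nat.cast_succ, Int.natAbs_natCast, Int.cast_natCast, ← mul_neg, e_nat_mul, e_neg,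
      mul_pow, mul_assoc]
  have hneg : ∀ n : ℕ, f (-(n + 1)) = -(structConst γ δ (n + 1 : ℕ) * (r * e u) ^ (n + 1)) := by
    intro n
    rw [hf, ← Nat.cast_succ, structConst_neg, Int.natAbs_neg, Int.natAbs_natCast, Int.cast_neg,
      Int.cast_natCast, neg_mul, neg_mul, neg_mul, neg_neg, e_nat_mul, mul_pow, mul_assoc]
  have hint := HasSum.of_add_one_of_neg_add_one
    ((hsum (norm_inv_e_ofReal u)).congr_fun hpos) ((hsum (norm_e_ofReal u)).neg.congr_fun hneg)
  rw [hzero, add_zero, ← sub_eq_add_neg] at hint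
  refine (hasSum_subtype_iff_of_support_subset fun n hn => ?_).mpr hint
  rintro rfl
  exact hn hzero

lemma summable_norm_structConst_mul_pow :
    Summable fun n : Mode => ‖structConst γ δ n * (r : ℂ) ^ (n : ℤ).natAbs‖ := by
  simpa [e_zero] using (hasSum_regKernel hγ hγδ hr hr_lt 0).summable.norm

end

/-! ### Coefficients of products of the field `η` -/

lemma finsum_eq_finsum_succ {M : Type*} [AddCommMonoid M] {g : ℕ → M} (hg : g 0 = 0) :
    ∑ᶠ d, g d = ∑ᶠ d, g (d + 1) := by
  rw [← finsum_mem_range Nat.succ_injective (f := g), ← finsum_mem_univ]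
  refine finsum_mem_inter_support_eq' g _ _ fun d hd => ⟨fun _ => ?_, fun _ => Set.mem_univ d⟩
  exact Nat.range_succ ▸ Nat.pos_of_ne_zero fun h => hd (h ▸ hg)

section ChainRule

variable {σ R : Type*} [CommRing R] {a : MvPowerSeries σ R}

lemma coeff_subst_mul (ha : PowerSeries.HasSubst a) (f : PowerSeries R) (b : MvPowerSeries σ R)
    (m : σ →₀ ℕ) : MvPowerSeries.coeff m (f.subst a * b) =
      ∑ᶠ d, PowerSeries.coeff d f * MvPowerSeries.coeff m (a ^ d * b) := by
  classical
  have hterm : ∀ (d : ℕ) (x : (σ →₀ ℕ) × (σ →₀ ℕ)),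
      PowerSeries.coeff d f * (MvPowerSeries.coeff x.1 (a ^ d) * MvPowerSeries.coeff x.2 b) =
        PowerSeries.coeff d f • MvPowerSeries.coeff x.1 (a ^ d) * MvPowerSeries.coeff x.2 b :=
    fun d x => by rw [smul_eq_mul, mul_assoc]
  simp only [MvPowerSeries.coeff_mul, PowerSeries.coeff_subst ha, Finset.mul_sum, hterm]
  rw [finsum_sum_comm]
  · exact Finset.sum_congr rfl fun x _ => finsum_mul' _ _ (PowerSeries.coeff_subst_finite ha f x.1)
  · exact fun x _ => (PowerSeries.coeff_subst_finite ha f x.1).subset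
      (Function.support_mul_subset_left _ _)

lemma pderiv_subst (ha : PowerSeries.HasSubst a) (f : PowerSeries R) (i : σ) :
    MvPowerSeries.pderiv R i (f.subst a) =
      (PowerSeries.derivative R f).subst a * MvPowerSeries.pderiv R i a := by
  ext m
  rw [coeff_subst_mul ha, MvPowerSeries.coeff_pderiv, PowerSeries.coeff_subst ha,
    finsum_mul' _ _ (PowerSeries.coeff_subst_finite ha f _), finsum_eq_finsum_succ]
  · refine finsum_congr fun d => ?_
    rw [smul_mul_assoc, ← MvPowerSeries.coeff_pderiv, Derivation.leibniz_pow,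
      PowerSeries.coeff_derivative, Nat.add_sub_cancel, map_nsmul, nsmul_eq_mul, smul_eq_mul,
      smul_eq_mul, mul_assoc, Nat.cast_succ]
  · rw [smul_mul_assoc, ← MvPowerSeries.coeff_pderiv, pow_zero, MvPowerSeries.pderiv_one, map_zero,
      smul_zero]

end ChainRule

lemma constantCoeff_logField (x : ℝ) : MvPowerSeries.constantCoeff (logField x) = 0 :=
  coeff_logField_of_ne x fun _ h => one_ne_zero (Finsupp.single_eq_zero.mp h.symm)

lemma pderiv_logField (n : Mode) (x : ℝ) :
    MvPowerSeries.pderiv ℂ n (logField x) = MvPowerSeries.C (e (-((n : ℤ) * x))) := by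
  classical
  ext m
  rw [MvPowerSeries.coeff_pderiv, MvPowerSeries.coeff_C]
  by_cases hm : m = 0
  · subst hm
    rw [zero_add, coeff_logField_single, if_pos rfl, Finsupp.zero_apply, Nat.cast_zero, zero_add,
      mul_one, e_eq_cexp]
    ring_nf
  · rw [if_neg hm, coeff_logField_of_ne, zero_mul]
    intro k hk
    have hdegree := congrArg Finsupp.degree hk
    rw [map_add, Finsupp.degree_single, Finsupp.degree_single, add_eq_right,
      Finsupp.degree_eq_zero_iff] at hdegree
    exact hm hdegree

section Field

variable (ε : ℂ)

lemma constantCoeff_eta (x : ℝ) : MvPowerSeries.constantCoeff (eta ε x) = ε := by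
  rw [eta, ← MvPowerSeries.coeff_zero_eq_constantCoeff_apply, map_smul,
    MvPowerSeries.coeff_zero_eq_constantCoeff_apply,
    PowerSeries.constantCoeff_subst (hasSubst_logField x), finsum_eq_single _ 0]
  · simp
  · intro d hd
    rw [map_pow, constantCoeff_logField, zero_pow hd, smul_zero]

lemma pderiv_eta (n : Mode) (x : ℝ) :
    MvPowerSeries.pderiv ℂ n (eta ε x) = e (-((n : ℤ) * x)) • eta ε x := by
  rw [eta, Derivation.map_smul, pderiv_subst (hasSubst_logField x), PowerSeries.derivative_exp,
    pderiv_logField, smul_comm, mul_comm, MvPowerSeries.smul_eq_C_mul _ (e _)]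

lemma pderiv_prod_eta {ι : Type*} (n : Mode) (z : ι → ℝ) (s : Finset ι) :
    MvPowerSeries.pderiv ℂ n (∏ i ∈ s, eta ε (z i)) =
      (∑ i ∈ s, e (-((n : ℤ) * z i))) • ∏ i ∈ s, eta ε (z i) := by
  classical
  induction s using Finset.induction_on with
  | empty => simp
  | insert a s ha ih =>
    rw [Finset.prod_insert ha, Finset.sum_insert ha, Derivation.leibniz, ih, pderiv_eta, add_smul,
      smul_eq_mul, smul_eq_mul, mul_smul_comm, mul_smul_comm, mul_comm (∏ i ∈ s, eta ε (z i)),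
      add_comm]

end Field

lemma monomial_induction {σ : Type*} {P : (σ →₀ ℕ) → Prop} (m : σ →₀ ℕ) (zero : P 0)
    (add_single : ∀ m n, P m → P (m + Finsupp.single n 1)) : P m := by
  classical
  have hmultiset : ∀ s : Multiset σ, P (Multiset.toFinsupp s) := fun s => by
    induction s using Multiset.induction with
    | empty => simpa using zero
    | cons n s ih =>
      rw [← Multiset.singleton_add, map_add, Multiset.toFinsupp_singleton, add_comm]
      exact add_single _ n ih
  simpa using hmultiset (Finsupp.toMultiset m)

section Coefficients

variable {ι : Type*} [Fintype ι]

/-- The power sum `∑ i, exp (-2πi n z i)`, the eigenvalue of `∂/∂λₙ` on `∏ i, η (z i)`. -/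
def modeSum (n : ℤ) (z : ι → ℝ) : ℂ := ∑ i, e (-(n * z i))

/-- The coefficient of the monomial `m` in `∏ i, η (z i)`, as a function of the points `z i`. -/
def etaCoeff (ε : ℂ) (m : Mode →₀ ℕ) (z : ι → ℝ) : ℂ :=
  MvPowerSeries.coeff m (∏ i, eta ε (z i))

lemma continuous_modeSum (n : ℤ) : Continuous (modeSum n : (ι → ℝ) → ℂ) :=
  continuous_finsetSum _ fun _ _ => differentiable_e.continuous.comp (by fun_prop)

lemma norm_modeSum_le (n : ℤ) (z : ι → ℝ) : ‖modeSum n z‖ ≤ Fintype.card ι := by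
  have hterm : ∀ i, ‖e (-(n * z i))‖ = 1 := fun i => by
    simpa only [ofReal_neg, ofReal_mul, ofReal_intCast] using norm_e_ofReal (-(n * z i))
  exact (norm_sum_le _ _).trans (by simp [hterm])

variable (ε : ℂ)

lemma etaCoeff_zero (z : ι → ℝ) : etaCoeff ε 0 z = ε ^ Fintype.card ι := by
  rw [etaCoeff, MvPowerSeries.coeff_zero_eq_constantCoeff_apply, map_prod]
  simp only [constantCoeff_eta, Finset.prod_const, Finset.card_univ]

lemma etaCoeff_add_single_mul (n : Mode) (m : Mode →₀ ℕ) (z : ι → ℝ) :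
    etaCoeff ε (m + Finsupp.single n 1) z * (m n + 1) = modeSum n z * etaCoeff ε m z := by
  rw [etaCoeff, ← MvPowerSeries.coeff_pderiv, pderiv_prod_eta, map_smul, smul_eq_mul, modeSum,
    etaCoeff]

lemma etaCoeff_add_single (n : Mode) (m : Mode →₀ ℕ) (z : ι → ℝ) :
    etaCoeff ε (m + Finsupp.single n 1) z = modeSum n z * etaCoeff ε m z / (m n + 1) :=
  eq_div_of_mul_eq (Nat.cast_add_one_ne_zero _) (etaCoeff_add_single_mul ε n m z)

lemma continuous_etaCoeff (m : Mode →₀ ℕ) : Continuous (etaCoeff ε m : (ι → ℝ) → ℂ) := by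
  induction m using monomial_induction with
  | zero =>
    rw [funext (etaCoeff_zero ε)]
    exact continuous_const
  | add_single m n ih =>
    rw [funext (etaCoeff_add_single ε n m)]
    exact ((continuous_modeSum n).mul ih).div_const _

lemma exists_norm_etaCoeff_le (m : Mode →₀ ℕ) :
    ∃ C : ℝ, ∀ z : ι → ℝ, ‖etaCoeff ε m z‖ ≤ C := by
  induction m using monomial_induction with
  | zero => exact ⟨‖ε ^ Fintype.card ι‖, fun z => by rw [etaCoeff_zero]⟩
  | add_single m n ih =>
    obtain ⟨C, hC⟩ := ih
    refine ⟨Fintype.card ι * C / ‖(m n + 1 : ℂ)‖, fun z => ?_⟩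
    rw [etaCoeff_add_single, norm_div, norm_mul]
    gcongr
    · exact norm_modeSum_le _ _
    · exact hC z

lemma etaCoeff_comp_perm (m : Mode →₀ ℕ) (σ : Equiv.Perm ι) (z : ι → ℝ) :
    etaCoeff ε m (z ∘ σ) = etaCoeff ε m z := by
  rw [etaCoeff, etaCoeff, ← Equiv.prod_comp σ fun i => eta ε (z i)]
  rfl

lemma etaCoeff_sum {κ : Type*} [Fintype κ] (m : Mode →₀ ℕ) (z : ι ⊕ κ → ℝ) :
    etaCoeff ε m z = ∑ ab ∈ Finset.HasAntidiagonal.antidiagonal m,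
      etaCoeff ε ab.1 (z ∘ Sum.inl) * etaCoeff ε ab.2 (z ∘ Sum.inr) := by
  simp only [etaCoeff, Fintype.prod_sum_type, MvPowerSeries.coeff_mul, Function.comp_apply]

end Coefficients

/-! ### Periodic Lipschitz functions -/

lemma norm_e_sub_e (s t : ℝ) : ‖e s - e t‖ = ‖1 - e ((s - t : ℝ) : ℂ)‖ := by
  rw [ofReal_sub, ← neg_sub (t : ℂ), e_neg, e_sub, inv_div, one_sub_div (e_ne_zero t), norm_div,
    norm_e_ofReal, div_one, norm_sub_rev]

lemma norm_e_sub_sub_e_sub_le (a b c d : ℝ) :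
    ‖e ((a - b : ℝ) : ℂ) - e ((c - d : ℝ) : ℂ)‖ ≤ ‖e a - e c‖ + ‖e b - e d‖ := by
  have hsplit : ((a - b) - (c - d) : ℝ) = (a - c) - (b - d) := by ring
  have hdist : ‖e ((a - c : ℝ) : ℂ) - e ((b - d : ℝ) : ℂ)‖ ≤
      ‖1 - e ((a - c : ℝ) : ℂ)‖ + ‖1 - e ((b - d : ℝ) : ℂ)‖ := by
    rw [← sub_sub_sub_cancel_left (e _) (e _) 1, add_comm]
    exact norm_sub_le _ _
  rwa [norm_e_sub_e, hsplit, ← norm_e_sub_e, norm_e_sub_e a c, norm_e_sub_e b d]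

lemma four_mul_abs_le_norm_one_sub_e {w : ℝ} (hw : |w| ≤ 1 / 2) : 4 * |w| ≤ ‖1 - e w‖ := by
  have he : e (w : ℂ) = cexp (I * ((2 * (Real.pi * w) : ℝ) : ℂ)) := by
    rw [e_eq_cexp]
    push_cast
    ring_nf
  have habs : |Real.pi * w| = Real.pi * |w| := by rw [abs_mul, abs_of_pos Real.pi_pos]
  have hsin := Real.mul_abs_le_abs_sin (x := Real.pi * w) (by
    rw [habs, div_eq_mul_one_div]
    exact mul_le_mul_of_nonneg_left hw Real.pi_pos.le)
  rw [habs, ← mul_assoc, div_mul_cancel₀ _ Real.pi_ne_zero] at hsin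
  rw [norm_sub_rev, he, Complex.norm_exp_I_mul_ofReal_sub_one, norm_mul, Real.norm_eq_abs,
    Real.norm_eq_abs, abs_two, mul_div_cancel_left₀ _ two_ne_zero]
  linarith

section Periodic

variable {E : Type*} [NormedAddCommGroup E] {g : ℝ → E} {T : ℝ}

lemma exists_norm_le_of_periodic (hg : Continuous g) (hper : g.Periodic T) (hT : T ≠ 0) :
    ∃ M, ∀ s, ‖g s‖ ≤ M := by
  obtain ⟨M, hM⟩ := (hper.isBounded_of_continuous hT hg).exists_norm_le
  exact ⟨M, fun s => hM _ (Set.mem_range_self s)⟩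

variable [NormedSpace ℝ E]

lemma periodic_deriv (hper : g.Periodic T) : (deriv g).Periodic T := fun s => by
  rw [← deriv_comp_add_const, funext hper]

lemma exists_norm_sub_le_of_periodic (hg : ContDiff ℝ 1 g) (hper : g.Periodic 1) :
    ∃ C, 0 ≤ C ∧ ∀ s t, ‖g s - g t‖ ≤ C * ‖e s - e t‖ := by
  obtain ⟨D, hD⟩ :=
    exists_norm_le_of_periodic (hg.continuous_deriv le_rfl) (periodic_deriv hper) one_ne_zero
  have hD_nonneg : 0 ≤ D := (norm_nonneg _).trans (hD 0)
  have hlipschitz : ∀ s t, ‖g s - g t‖ ≤ D * |s - t| := fun s t =>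
    convex_univ.norm_image_sub_le_of_norm_deriv_le
      (fun x _ => hg.differentiable one_ne_zero x) (fun x _ => hD x) trivial trivial
  refine ⟨D / 4, by positivity, fun s t => ?_⟩
  let n := round (s - t)
  have hclose : |s - n - t| ≤ 1 / 2 := by
    rw [sub_right_comm]
    exact abs_sub_round _
  have hshift : e ((s - t : ℝ) : ℂ) = e ((s - n - t : ℝ) : ℂ) := by
    rw [sub_right_comm, ofReal_sub (s - t), ofReal_intCast, e_sub, e_int, div_one]
  calc ‖g s - g t‖ = ‖g (s - n) - g t‖ := by rw [← mul_one (n : ℝ), hper.sub_int_mul_eq]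
    _ ≤ D * |s - n - t| := hlipschitz _ _
    _ = D / 4 * (4 * |s - n - t|) := by ring
    _ ≤ D / 4 * ‖e s - e t‖ := by
      rw [norm_e_sub_e, hshift]
      gcongr
      exact four_mul_abs_le_norm_one_sub_e hclose

end Periodic

section SwapLipschitz

variable {ι : Type*} [DecidableEq ι]

/-- Bounded functions of the points `z` which change under the swap of `z i` and `z j` by at most a
constant times the chordal distance of `z i` and `z j`. The difference between such a function and
its swap cancels a simple pole at `z i = z j`. -/
structure SwapLipschitz (i j : ι) (F : (ι → ℝ) → ℂ) : Prop where
  bounded : ∃ M, ∀ z, ‖F z‖ ≤ M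
  lipschitz : ∃ C, ∀ z, ‖F (z ∘ Equiv.swap i j) - F z‖ ≤ C * ‖e (z i) - e (z j)‖

lemma norm_e_comp_swap_sub_e_le (i j : ι) (z : ι → ℝ) (a : ι) :
    ‖e ((z ∘ Equiv.swap i j) a) - e (z a)‖ ≤ ‖e (z i) - e (z j)‖ := by
  rw [Function.comp_apply, Equiv.swap_apply_def]
  split_ifs with hi hj
  · rw [hi, norm_sub_rev]
  · rw [hj]
  · rw [sub_self, norm_zero]
    exact norm_nonneg _

namespace SwapLipschitz

variable {i j : ι} {F G : (ι → ℝ) → ℂ}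

lemma const (c : ℂ) : SwapLipschitz i j fun _ => c :=
  ⟨⟨‖c‖, fun _ => le_rfl⟩, 0, fun z => by simp⟩

lemma mul (hF : SwapLipschitz i j F) (hG : SwapLipschitz i j G) :
    SwapLipschitz i j fun z => F z * G z := by
  obtain ⟨⟨M, hM⟩, C, hC⟩ := hF
  obtain ⟨⟨N, hN⟩, D, hD⟩ := hG
  have hM_nonneg : 0 ≤ M := (norm_nonneg _).trans (hM 0)
  refine ⟨⟨M * N, fun z => ?_⟩, M * D + C * N, fun z => ?_⟩
  · rw [norm_mul]
    exact mul_le_mul (hM z) (hN z) (norm_nonneg _) hM_nonneg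
  · let y := z ∘ Equiv.swap i j
    calc ‖F y * G y - F z * G z‖ = ‖F y * (G y - G z) + (F y - F z) * G z‖ := by ring_nf
      _ ≤ ‖F y‖ * ‖G y - G z‖ + ‖F y - F z‖ * ‖G z‖ :=
        (norm_add_le _ _).trans_eq (by rw [norm_mul, norm_mul])
      _ ≤ M * (D * ‖e (z i) - e (z j)‖) + C * ‖e (z i) - e (z j)‖ * N :=
        add_le_add (mul_le_mul (hM y) (hD z) (norm_nonneg _) hM_nonneg)
          (mul_le_mul (hC z) (hN z) (norm_nonneg _) ((norm_nonneg _).trans (hC z)))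
      _ = (M * D + C * N) * ‖e (z i) - e (z j)‖ := by ring

lemma add (hF : SwapLipschitz i j F) (hG : SwapLipschitz i j G) :
    SwapLipschitz i j fun z => F z + G z := by
  obtain ⟨⟨M, hM⟩, C, hC⟩ := hF
  obtain ⟨⟨N, hN⟩, D, hD⟩ := hG
  refine ⟨⟨M + N, fun z => norm_add_le_of_le (hM z) (hN z)⟩, C + D, fun z => ?_⟩
  rw [add_sub_add_comm, add_mul]
  exact norm_add_le_of_le (hC z) (hD z)

lemma prod {α : Type*} (s : Finset α) {F : α → (ι → ℝ) → ℂ}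
    (hF : ∀ a ∈ s, SwapLipschitz i j (F a)) : SwapLipschitz i j fun z => ∏ a ∈ s, F a z := by
  classical
  induction s using Finset.induction_on with
  | empty => simpa using const 1
  | insert a s ha ih =>
    simp only [Finset.prod_insert ha]
    exact (hF a (Finset.mem_insert_self _ _)).mul
      (ih fun b hb => hF b (Finset.mem_insert_of_mem hb))

lemma sum {α : Type*} (s : Finset α) {F : α → (ι → ℝ) → ℂ}
    (hF : ∀ a ∈ s, SwapLipschitz i j (F a)) : SwapLipschitz i j fun z => ∑ a ∈ s, F a z := by
  classical
  induction s using Finset.induction_on with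
  | empty => simpa using const 0
  | insert a s ha ih =>
    simp only [Finset.sum_insert ha]
    exact (hF a (Finset.mem_insert_self _ _)).add
      (ih fun b hb => hF b (Finset.mem_insert_of_mem hb))

lemma comp_sub {g : ℝ → ℂ} (hg : ContDiff ℝ 1 g) (hper : g.Periodic 1) (a b : ι) :
    SwapLipschitz i j fun z => g (z a - z b) := by
  obtain ⟨M, hM⟩ := exists_norm_le_of_periodic hg.continuous hper one_ne_zero
  obtain ⟨C, hC_nonneg, hC⟩ := exists_norm_sub_le_of_periodic hg hper
  refine ⟨⟨M, fun z => hM _⟩, C * 2, fun z => ?_⟩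
  refine (hC _ _).trans ?_
  rw [mul_assoc, two_mul]
  exact mul_le_mul_of_nonneg_left ((norm_e_sub_sub_e_sub_le _ _ _ _).trans
    (add_le_add (norm_e_comp_swap_sub_e_le i j z a) (norm_e_comp_swap_sub_e_le i j z b))) hC_nonneg

end SwapLipschitz

end SwapLipschitz

/-! ### Lebesgue measure on a box -/

section Box

variable (ι : Type*) [Fintype ι]

/-- Lebesgue measure on the box `(-1/2, 1/2]^ι`, as a product measure. -/
def boxMeasure : Measure (ι → ℝ) :=
  Measure.pi fun _ => (volume : Measure ℝ).restrict (Set.Ioc (-1 / 2) (1 / 2))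

lemma boxMeasure_eq : boxMeasure ι =
    (volume : Measure (ι → ℝ)).restrict (Set.univ.pi fun _ => Set.Ioc (-1 / 2) (1 / 2)) := by
  rw [boxMeasure, volume_pi, Measure.restrict_pi_pi]

instance : IsFiniteMeasure (boxMeasure ι) := by
  unfold boxMeasure
  infer_instance

variable {ι}

lemma integrable_boxMeasure {E : Type*} [NormedAddCommGroup E] {F : (ι → ℝ) → E}
    (hF : Continuous F) : Integrable F (boxMeasure ι) := by
  have hclosed : IntegrableOn F (Set.Icc (fun _ => -1 / 2) (fun _ => 1 / 2)) :=
    hF.continuousOn.integrableOn_Icc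
  rw [boxMeasure_eq]
  exact hclosed.mono_set fun x hx =>
    ⟨fun i => (hx i trivial).1.le, fun i => (hx i trivial).2⟩

lemma integral_boxMeasure_comp_perm {E : Type*} [NormedAddCommGroup E] [NormedSpace ℝ E]
    (σ : Equiv.Perm ι) (F : (ι → ℝ) → E) :
    ∫ z, F (z ∘ σ) ∂boxMeasure ι = ∫ z, F z ∂boxMeasure ι := by
  have hpreserving := measurePreserving_piCongrLeft
    (fun _ : ι => (volume : Measure ℝ).restrict (Set.Ioc (-1 / 2) (1 / 2))) σ.symm
  rw [boxMeasure, ← hpreserving.integral_comp (MeasurableEquiv.measurableEmbedding _) F]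
  refine integral_congr_ae (Eventually.of_forall fun z => congrArg F (funext fun i => ?_))
  simpa using (MeasurableEquiv.piCongrLeft_apply_apply (β := fun _ => ℝ) σ.symm z (σ i)).symm

lemma integral_boxMeasure_sum_mul {κ : Type*} [Fintype κ] (F : (ι → ℝ) → ℂ) (G : (κ → ℝ) → ℂ) :
    ∫ z, F (z ∘ Sum.inl) * G (z ∘ Sum.inr) ∂boxMeasure (ι ⊕ κ) =
      (∫ x, F x ∂boxMeasure ι) * ∫ y, G y ∂boxMeasure κ := by
  rw [← integral_prod_mul]
  exact (measurePreserving_sumPiEquivProdPi (X := fun _ : ι ⊕ κ => ℝ)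
    fun _ => (volume : Measure ℝ).restrict (Set.Ioc (-1 / 2) (1 / 2))).integral_comp
      (MeasurableEquiv.measurableEmbedding _) fun p : (ι → ℝ) × (κ → ℝ) => F p.1 * G p.2

lemma volume_setOf_sub_eq {i j : ι} (hij : i ≠ j) (c : ℝ) :
    volume {z : ι → ℝ | z i - z j = c} = 0 := by
  classical
  let φ : (ι → ℝ) →ₗ[ℝ] ℝ := LinearMap.proj (R := ℝ) (φ := fun _ => ℝ) i - LinearMap.proj j
  have hφ : ∀ z, φ z = z i - z j := fun _ => rfl
  have hker : LinearMap.ker φ ≠ ⊤ := fun htop => by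
    have hmem : Pi.single i 1 ∈ LinearMap.ker φ := htop ▸ Submodule.mem_top
    simp [hφ, hij.symm] at hmem
  have hhyperplane : {z : ι → ℝ | z i - z j = c} =
      (· + Pi.single i (-c)) ⁻¹' (LinearMap.ker φ : Set (ι → ℝ)) := by
    ext z
    simp only [Set.mem_ofPred_eq, Set.mem_preimage, SetLike.mem_coe, LinearMap.mem_ker, hφ,
      Pi.add_apply, Pi.single_eq_same, Pi.single_eq_of_ne hij.symm]
    constructor <;> intro h <;> linarith
  rw [hhyperplane, measure_preimage_add_right]
  exact Measure.addHaar_submodule volume _ hker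

lemma ae_boxMeasure_e_sub_ne_one :
    ∀ᵐ z ∂boxMeasure ι, ∀ i j, i ≠ j → e ((z i - z j : ℝ) : ℂ) ≠ 1 := by
  rw [boxMeasure_eq]
  refine ae_restrict_of_ae (ae_all_iff.mpr fun i => ae_all_iff.mpr fun j => ?_)
  by_cases hij : i = j
  · exact Eventually.of_forall fun _ hne => absurd hij hne
  have hne_int : ∀ᵐ z : ι → ℝ, ∀ n : ℤ, z i - z j ≠ n :=
    ae_all_iff.mpr fun n => measure_eq_zero_iff_ae_notMem.mp (volume_setOf_sub_eq hij n)
  filter_upwards [hne_int] with z hz _ h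
  obtain ⟨n, hn⟩ := e_eq_one_iff.mp h
  exact hz n (by exact_mod_cast hn)

end Box

/-! ### Symmetrisation over splittings of the variables -/

section Splittings

variable {ι : Type*} [DecidableEq ι]

lemma map_swap_map_swap (i j : ι) (I : Finset ι) :
    (I.map (Equiv.swap i j).toEmbedding).map (Equiv.swap i j).toEmbedding = I := by
  ext a
  simp only [Finset.mem_map_equiv, Equiv.symm_swap, Equiv.swap_apply_self]

lemma pairProd_comp_perm (h : ℂ → ℂ) (σ : Equiv.Perm ι) (I : Finset ι) (z : ι → ℂ) :
    pairProd h (z ∘ σ) I = pairProd h z (I.map σ.toEmbedding) := by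
  simp only [pairProd, Finset.prod_map, Equiv.coe_toEmbedding, σ.injective.eq_iff, Function.comp]

variable [Fintype ι]

/-- The product of the pair kernels `h (z i - z j)` within the block `I` and within its complement,
the part of the integrand of `{I_k, I_l}` not involving the bracket. -/
def splitWeight (h : ℂ → ℂ) (I : Finset ι) (z : ι → ℝ) : ℂ :=
  pairProd h (fun i => (z i : ℂ)) I * pairProd h (fun i => (z i : ℂ)) (Finset.univ \ I)

/-- The sum of `K (z i - z j)` over `i ∈ I` and `j ∉ I`, through which the bracket of two products
of fields couples their variables. -/
def crossSum (K : ℝ → ℂ) (I : Finset ι) (z : ι → ℝ) : ℂ :=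
  ∑ i ∈ I, ∑ j ∈ Finset.univ \ I, K (z i - z j)

/-- The sum of the weights of all blocks of size `k` which contain `i` but not `j`. -/
def separatingWeight (h : ℂ → ℂ) (k : ℕ) (i j : ι) (z : ι → ℝ) : ℂ :=
  ∑ I ∈ Finset.univ.powersetCard k with i ∈ I ∧ j ∉ I, splitWeight h I z

lemma map_univ_sdiff (σ : Equiv.Perm ι) (I : Finset ι) :
    (Finset.univ \ I).map σ.toEmbedding = Finset.univ \ I.map σ.toEmbedding := by
  ext i
  simp only [Finset.mem_map_equiv, Finset.mem_sdiff, Finset.mem_univ, true_and]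

omit [Fintype ι] [DecidableEq ι] in
lemma exists_perm_map_eq {I J : Finset ι} (hcard : I.card = J.card) :
    ∃ σ : Equiv.Perm ι, I.map σ.toEmbedding = J := by
  classical
  have := Set.powersetCard.isPretransitive (α := ι) (n := J.card)
  obtain ⟨σ, hσ⟩ := MulAction.exists_smul_eq (Equiv.Perm ι)
    (⟨I, hcard⟩ : Set.powersetCard ι J.card) ⟨J, rfl⟩
  refine ⟨σ, ?_⟩
  rw [Finset.map_eq_image]
  exact congrArg Subtype.val hσ

lemma crossSum_comp_perm (K : ℝ → ℂ) (σ : Equiv.Perm ι) (I : Finset ι) (z : ι → ℝ) :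
    crossSum K I (z ∘ σ) = crossSum K (I.map σ.toEmbedding) z := by
  rw [crossSum, crossSum, ← map_univ_sdiff]
  simp only [Finset.sum_map, Equiv.coe_toEmbedding, Function.comp]

lemma crossSum_eq_sum_univ (K : ℝ → ℂ) (I : Finset ι) (z : ι → ℝ) :
    crossSum K I z = ∑ i, ∑ j, if i ∈ I ∧ j ∉ I then K (z i - z j) else 0 := by
  simp only [crossSum, ite_and, Finset.sdiff_eq_filter, Finset.sum_filter, Finset.sum_ite_irrel,
    Finset.sum_const_zero, Finset.sum_ite_mem, Finset.univ_inter]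

variable (h : ℂ → ℂ)

lemma splitWeight_comp_perm (σ : Equiv.Perm ι) (I : Finset ι) (z : ι → ℝ) :
    splitWeight h I (z ∘ σ) = splitWeight h (I.map σ.toEmbedding) z := by
  have hcomp : (fun i => (((z ∘ σ) i : ℝ) : ℂ)) = (fun i => (z i : ℂ)) ∘ σ := rfl
  rw [splitWeight, hcomp, pairProd_comp_perm, pairProd_comp_perm, map_univ_sdiff, splitWeight]

lemma separatingWeight_comp_swap (k : ℕ) (i j : ι) (z : ι → ℝ) :
    separatingWeight h k i j (z ∘ Equiv.swap i j) = separatingWeight h k j i z := by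
  simp only [separatingWeight, splitWeight_comp_perm]
  refine Finset.sum_bij' (fun I _ => I.map (Equiv.swap i j).toEmbedding)
    (fun I _ => I.map (Equiv.swap i j).toEmbedding) ?_ ?_ (fun I _ => map_swap_map_swap i j I)
    (fun I _ => map_swap_map_swap i j I) fun I _ => rfl
  all_goals
    intro I hI
    simpa only [Finset.mem_filter, Finset.mem_powersetCard, Finset.subset_univ, true_and,
      Finset.card_map, Finset.mem_map_equiv, Equiv.symm_swap, Equiv.swap_apply_left,
      Equiv.swap_apply_right] using hI

lemma sum_splitWeight_mul_crossSum (k : ℕ) (K : ℝ → ℂ) (z : ι → ℝ) :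
    ∑ I ∈ Finset.univ.powersetCard k, splitWeight h I z * crossSum K I z =
      ∑ i, ∑ j, K (z i - z j) * separatingWeight h k i j z := by
  simp only [crossSum_eq_sum_univ, separatingWeight, Finset.mul_sum, Finset.sum_filter]
  rw [Finset.sum_comm]
  refine Finset.sum_congr rfl fun i _ => ?_
  rw [Finset.sum_comm]
  refine Finset.sum_congr rfl fun j _ => Finset.sum_congr rfl fun I _ => ?_
  rw [mul_ite, mul_ite, mul_zero, mul_zero, mul_comm]

lemma two_mul_sum_splitWeight_mul_crossSum (k : ℕ) {K : ℝ → ℂ} (hK : K.Odd) (z : ι → ℝ) :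
    2 * ∑ I ∈ Finset.univ.powersetCard k, splitWeight h I z * crossSum K I z =
      ∑ i, ∑ j, K (z i - z j) * (separatingWeight h k i j z - separatingWeight h k j i z) := by
  rw [sum_splitWeight_mul_crossSum, two_mul]
  nth_rewrite 2 [Finset.sum_comm]
  simp only [← Finset.sum_add_distrib]
  refine Finset.sum_congr rfl fun i _ => Finset.sum_congr rfl fun j _ => ?_
  rw [← neg_sub (z i) (z j), hK]
  ring

end Splittings

section Bounds

variable {ι : Type*} [DecidableEq ι] {h : ℂ → ℂ}

lemma continuous_pairProd (hh : Continuous fun u : ℝ => h u) (I : Finset ι) :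
    Continuous fun z : ι → ℝ => pairProd h (fun i => (z i : ℂ)) I := by
  refine continuous_finsetProd _ fun a _ => continuous_finsetProd _ fun b _ => ?_
  by_cases hab : a = b
  · simpa only [if_pos hab] using continuous_const
  · have hsub : Continuous fun z : ι → ℝ => z a - z b := by fun_prop
    simpa only [if_neg hab, ofReal_sub, Function.comp_def] using hh.comp hsub

lemma continuous_splitWeight [Fintype ι] (hh : Continuous fun u : ℝ => h u) (I : Finset ι) :
    Continuous (splitWeight h I : (ι → ℝ) → ℂ) :=
  (continuous_pairProd hh I).mul (continuous_pairProd hh _)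

lemma continuous_crossSum [Fintype ι] {K : ℝ → ℂ} (hK : Continuous K) (I : Finset ι) :
    Continuous (crossSum K I : (ι → ℝ) → ℂ) :=
  continuous_finsetSum _ fun _ _ => continuous_finsetSum _ fun _ _ => hK.comp (by fun_prop)

variable (hh : ContDiff ℝ 1 fun u : ℝ => h u) (hper : (fun u : ℝ => h u).Periodic 1)
include hh hper

lemma swapLipschitz_pairProd (i j : ι) (I : Finset ι) :
    SwapLipschitz i j fun z : ι → ℝ => pairProd h (fun i => (z i : ℂ)) I := by
  refine SwapLipschitz.prod _ fun a _ => SwapLipschitz.prod _ fun b _ => ?_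
  by_cases hab : a = b
  · simpa only [if_pos hab] using SwapLipschitz.const 1
  · simpa only [if_neg hab, ofReal_sub] using SwapLipschitz.comp_sub hh hper a b

variable [Fintype ι]

lemma exists_norm_separatingWeight_sub_le (k : ℕ) (i j : ι) : ∃ C, ∀ z : ι → ℝ,
    ‖separatingWeight h k i j z - separatingWeight h k j i z‖ ≤ C * ‖e (z i) - e (z j)‖ := by
  have hswap : SwapLipschitz i j (separatingWeight h k i j) := SwapLipschitz.sum _ fun I _ =>
    (swapLipschitz_pairProd hh hper i j I).mul (swapLipschitz_pairProd hh hper i j _)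
  obtain ⟨C, hC⟩ := hswap.lipschitz
  refine ⟨C, fun z => ?_⟩
  rw [norm_sub_rev, ← separatingWeight_comp_swap]
  exact hC z

/- After antisymmetrising in `i` and `j`, the pole of `K` at `z i = z j` is cancelled by the zero of
`separatingWeight h k i j z - separatingWeight h k j i z`. -/
lemma exists_norm_sum_splitWeight_mul_crossSum_le (k : ℕ) (B : ℝ) : ∃ C : ℝ, ∀ K : ℝ → ℂ,
    K.Odd → (∀ u : ℝ, ‖1 - e u‖ * ‖K u‖ ≤ B) → ∀ z : ι → ℝ,
      ‖∑ I ∈ Finset.univ.powersetCard k, splitWeight h I z * crossSum K I z‖ ≤ C := by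
  choose C hC using fun i j : ι => exists_norm_separatingWeight_sub_le hh hper k i j
  refine ⟨(∑ i, ∑ j, |C i j| * B) / 2, fun K hK hB z => ?_⟩
  have hterm : ∀ i j, ‖K (z i - z j) *
      (separatingWeight h k i j z - separatingWeight h k j i z)‖ ≤ |C i j| * B := fun i j => by
    have hchord := hC i j z
    rw [norm_e_sub_e] at hchord
    calc ‖K (z i - z j) * (separatingWeight h k i j z - separatingWeight h k j i z)‖
        ≤ ‖K (z i - z j)‖ * (|C i j| * ‖1 - e ((z i - z j : ℝ) : ℂ)‖) := by
          rw [norm_mul]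
          gcongr
          refine hchord.trans ?_
          gcongr
          exact le_abs_self _
      _ = |C i j| * (‖1 - e ((z i - z j : ℝ) : ℂ)‖ * ‖K (z i - z j)‖) := by ring
      _ ≤ |C i j| * B := by
        gcongr
        exact hB _
  rw [le_div_iff₀' two_pos, ← Complex.norm_two, ← norm_mul,
    two_mul_sum_splitWeight_mul_crossSum h k hK]
  exact norm_sum_le_of_le _ fun i _ => norm_sum_le_of_le _ fun j _ => hterm i j

end Bounds

/-! ### Vanishing of the regularised integrals in the limit -/

section Limit

variable {γ δ : ℂ} (hγ : 0 < γ.im) (hγδ : γ.im < δ.im)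
include hγ hγδ

lemma contDiff_shiftRatio_theta : ContDiff ℝ 1 fun u : ℝ => shiftRatio (theta δ) γ u := by
  have hθ := isOddTheta_theta (hγ.trans hγδ)
  have hθ_smooth : ContDiff ℝ 1 (theta δ) :=
    (hθ.differentiable.contDiff (n := 1)).restrict_scalars ℝ
  have hcoe : ContDiff ℝ 1 fun u : ℝ => (u : ℂ) := ofRealCLM.contDiff
  simp only [shiftRatio, div_eq_mul_inv]
  exact (hθ_smooth.comp hcoe).mul ((hθ_smooth.comp (hcoe.add contDiff_const)).inv fun u =>
    hθ.ne_zero (notMem_lattice_of_im (by simpa) (by simpa)))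

omit hγ hγδ in
lemma periodic_shiftRatio_theta : (fun u : ℝ => shiftRatio (theta δ) γ u).Periodic 1 := fun u => by
  simp only [shiftRatio, ofReal_add, ofReal_one]
  rw [add_right_comm, theta_antiperiodic, theta_antiperiodic, neg_div_neg_eq]

variable {ι : Type*} [Fintype ι] [DecidableEq ι]

lemma sum_splitWeight_mul_crossSum_logDerivDiff (k : ℕ) {z : ι → ℝ}
    (hz : ∀ i j, i ≠ j → e ((z i - z j : ℝ) : ℂ) ≠ 1) :
    ∑ I ∈ Finset.univ.powersetCard k, splitWeight (shiftRatio (theta δ) γ) I z *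
      crossSum (fun u => logDerivDiff (theta δ) γ u) I z = 0 := by
  have hδ : 0 < δ.im := hγ.trans hγδ
  have hz_lattice : ∀ i ∈ Finset.univ, ∀ j ∈ Finset.univ, i ≠ j → (z i : ℂ) - z j ∉ lattice δ :=
    fun i _ j _ hij hmem => hz i j hij ((ofReal_mem_lattice_iff hδ.ne').mp (by simpa using hmem))
  have hzγ : ∀ i ∈ Finset.univ, ∀ j ∈ Finset.univ, (z i : ℂ) - z j - γ ∉ lattice δ :=
    fun i _ j _ hmem => by
      rw [← neg_mem_iff, neg_sub] at hmem
      exact notMem_lattice_of_im (by simpa) (by simpa) hmem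
  have hidentity := (isOddTheta_theta hδ).sum_pairProd_mul_logDerivDiff hz_lattice hδ.ne' hzγ
    fun n => if n = k then 1 else 0
  simpa only [Finset.powersetCard_eq_filter, Finset.sum_filter, ite_mul, one_mul, zero_mul,
    splitWeight, crossSum, ofReal_sub] using hidentity

lemma tendsto_sum_splitWeight_mul_crossSum (k : ℕ) {z : ι → ℝ}
    (hz : ∀ i j, i ≠ j → e ((z i - z j : ℝ) : ℂ) ≠ 1) :
    Tendsto (fun r => ∑ I ∈ Finset.univ.powersetCard k, splitWeight (shiftRatio (theta δ) γ) I z *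
      crossSum (regKernel γ δ r) I z) (𝓝[<] 1) (𝓝 0) := by
  have hcross : ∀ J : Finset ι, Tendsto (fun r => crossSum (regKernel γ δ r) J z) (𝓝[<] 1)
      (𝓝 (-(2 * Real.pi * I)⁻¹ * crossSum (fun u => logDerivDiff (theta δ) γ u) J z)) := fun J => by
    simp only [crossSum, Finset.mul_sum]
    refine tendsto_finsetSum _ fun i hi => tendsto_finsetSum _ fun j hj =>
      tendsto_regKernel hγ hγδ (hz i j ?_)
    rintro rfl
    exact (Finset.mem_sdiff.mp hj).2 hi
  have hsum := tendsto_finsetSum (Finset.univ.powersetCard k) fun J _ =>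
    (hcross J).const_mul (splitWeight (shiftRatio (theta δ) γ) J z)
  simp only [mul_left_comm _ (-(2 * Real.pi * I)⁻¹), ← Finset.mul_sum] at hsum
  rwa [sum_splitWeight_mul_crossSum_logDerivDiff hγ hγδ k hz, mul_zero] at hsum

omit hγ hγδ in
lemma eventually_nonneg_and_lt_one : ∀ᶠ r : ℝ in 𝓝[<] 1, 0 ≤ r ∧ r < 1 := by
  have hnonneg : ∀ᶠ r : ℝ in 𝓝[<] 1, 0 ≤ r := nhdsWithin_le_nhds (eventually_ge_nhds one_pos)
  exact hnonneg.and self_mem_nhdsWithin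

variable (ε : ℂ) (m : Mode →₀ ℕ)

lemma continuous_splitWeight_mul_crossSum_mul_etaCoeff {r : ℝ} (hr : 0 ≤ r) (hr_lt : r < 1)
    (J : Finset ι) : Continuous fun z => splitWeight (shiftRatio (theta δ) γ) J z *
      crossSum (regKernel γ δ r) J z * etaCoeff ε m z :=
  ((continuous_splitWeight (contDiff_shiftRatio_theta hγ hγδ).continuous J).mul
    (continuous_crossSum (continuous_regKernel hγ hγδ hr hr_lt) J)).mul (continuous_etaCoeff ε m)

lemma tendsto_integral_sum_splitWeight (k : ℕ) :
    Tendsto (fun r => ∫ z : ι → ℝ, ∑ J ∈ Finset.univ.powersetCard k,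
      splitWeight (shiftRatio (theta δ) γ) J z * crossSum (regKernel γ δ r) J z * etaCoeff ε m z
        ∂boxMeasure ι) (𝓝[<] 1) (𝓝 0) := by
  obtain ⟨B, hB⟩ := exists_norm_one_sub_mul_norm_regKernel_le hγ hγδ
  obtain ⟨C, hC⟩ := exists_norm_sum_splitWeight_mul_crossSum_le (ι := ι)
    (contDiff_shiftRatio_theta hγ hγδ) periodic_shiftRatio_theta k B
  obtain ⟨D, hD⟩ := exists_norm_etaCoeff_le (ι := ι) ε m
  rw [← integral_zero (ι → ℝ) ℂ (μ := boxMeasure ι)]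
  refine tendsto_integral_filter_of_dominated_convergence (fun _ => C * D) ?_ ?_
    (integrable_const _) ?_
  · filter_upwards [eventually_nonneg_and_lt_one] with r hr
    exact (continuous_finsetSum _ fun J _ => continuous_splitWeight_mul_crossSum_mul_etaCoeff
      hγ hγδ ε m hr.1 hr.2 J).aestronglyMeasurable
  · filter_upwards [eventually_nonneg_and_lt_one] with r hr
    refine Eventually.of_forall fun z => ?_
    have hbound := hC (regKernel γ δ r) (regKernel_neg γ δ r) (hB r hr.1 hr.2) z
    rw [← Finset.sum_mul, norm_mul]
    exact mul_le_mul hbound (hD z) (norm_nonneg _) ((norm_nonneg _).trans hbound)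
  · filter_upwards [ae_boxMeasure_e_sub_ne_one] with z hz
    simpa only [Finset.sum_mul, zero_mul] using
      (tendsto_sum_splitWeight_mul_crossSum hγ hγδ k hz).mul_const (etaCoeff ε m z)

omit hγ hγδ in
lemma integral_splitWeight_congr_card (h : ℂ → ℂ) (K : ℝ → ℂ) {J J' : Finset ι}
    (hcard : J.card = J'.card) :
    ∫ z, splitWeight h J z * crossSum K J z * etaCoeff ε m z ∂boxMeasure ι =
      ∫ z, splitWeight h J' z * crossSum K J' z * etaCoeff ε m z ∂boxMeasure ι := by
  obtain ⟨σ, rfl⟩ := exists_perm_map_eq hcard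
  rw [← integral_boxMeasure_comp_perm σ]
  simp only [splitWeight_comp_perm, crossSum_comp_perm, etaCoeff_comp_perm]

/- All blocks of the same size contribute equally, so each contribution is the average of the sum
over blocks. -/
lemma tendsto_integral_splitWeight (J : Finset ι) :
    Tendsto (fun r => ∫ z, splitWeight (shiftRatio (theta δ) γ) J z *
      crossSum (regKernel γ δ r) J z * etaCoeff ε m z ∂boxMeasure ι) (𝓝[<] 1) (𝓝 0) := by
  let N : ℂ := ((Finset.univ : Finset ι).powersetCard J.card).card
  have hN : N ≠ 0 := Nat.cast_ne_zero.mpr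
    (Finset.card_ne_zero.mpr ⟨J, Finset.mem_powersetCard.mpr ⟨Finset.subset_univ _, rfl⟩⟩)
  have haverage := (tendsto_integral_sum_splitWeight (ι := ι) hγ hγδ ε m J.card).const_mul N⁻¹
  rw [mul_zero] at haverage
  refine haverage.congr' ?_
  filter_upwards [eventually_nonneg_and_lt_one] with r hr
  rw [integral_finsetSum _ fun J' _ => integrable_boxMeasure
      (continuous_splitWeight_mul_crossSum_mul_etaCoeff hγ hγδ ε m hr.1 hr.2 J'),
    Finset.sum_congr rfl fun J' hJ' => integral_splitWeight_congr_card ε m _ _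
      (Finset.mem_powersetCard.mp hJ').2, Finset.sum_const, nsmul_eq_mul,
    inv_mul_cancel_left₀ hN]

end Limit

/-! ### The bracket of two Hamiltonians as a limit of regularised integrals -/

section Kernel

lemma shiftRatio_mul_shiftRatio_neg {f : ℂ → ℂ} (hf : f.Odd) (γ x : ℂ) :
    shiftRatio f γ x * shiftRatio f γ (-x) = f x ^ 2 / (f (x + γ) * f (x - γ)) := by
  have hshift : f (-x + γ) = -f (x - γ) := by rw [← hf, neg_sub, neg_add_eq_sub]
  rw [shiftRatio, shiftRatio, hf, hshift, neg_div_neg_eq, div_mul_div_comm, ← sq]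

lemma pairProd_univ {ι : Type*} [Fintype ι] [DecidableEq ι] (h : ℂ → ℂ) (z : ι → ℂ) :
    pairProd h z Finset.univ = ∏ i, ∏ j ∈ {i}ᶜ, h (z i - z j) := by
  refine Finset.prod_congr rfl fun i _ => ?_
  rw [Fintype.prod_eq_mul_prod_compl i, if_pos rfl, one_mul]
  refine Finset.prod_congr rfl fun j hj => if_neg fun hij => ?_
  exact Finset.mem_compl.mp hj (Finset.mem_singleton.mpr hij.symm)

lemma pairProd_map {ι κ : Type*} [DecidableEq ι] [DecidableEq κ] (h : ℂ → ℂ) (φ : ι ↪ κ)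
    (z : κ → ℂ) (s : Finset ι) : pairProd h z (s.map φ) = pairProd h (z ∘ φ) s := by
  simp only [pairProd, Finset.prod_map, φ.injective.eq_iff, Function.comp]

lemma kernel_eq_pairProd (γ δ : ℂ) {n : ℕ} (x : Fin n → ℝ) :
    kernel γ δ x = pairProd (shiftRatio (theta δ) γ) (fun i => (x i : ℂ)) Finset.univ := by
  rw [pairProd_univ,
    ← Finset.prod_prod_Ioi_mul_eq_prod_prod_off_diag
      fun a b => shiftRatio (theta δ) γ (x b - x a), kernel]
  refine Finset.prod_congr rfl fun i _ => Finset.prod_congr rfl fun j _ => ?_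
  rw [← neg_sub (x i : ℂ) (x j), shiftRatio_mul_shiftRatio_neg (theta_odd δ)]

lemma continuous_kernel {γ δ : ℂ} (hγ : 0 < γ.im) (hγδ : γ.im < δ.im) (n : ℕ) :
    Continuous fun x : Fin n → ℝ => kernel γ δ x := by
  simp only [kernel_eq_pairProd]
  exact continuous_pairProd (contDiff_shiftRatio_theta hγ hγδ).continuous _

lemma coeff_pderiv_hamiltonianSeries (γ δ ε : ℂ) (k : ℕ) (n : Mode) (a : Mode →₀ ℕ) :
    MvPowerSeries.coeff a (MvPowerSeries.pderiv ℂ n (hamiltonianSeries γ δ ε k)) =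
      prefactor γ δ k *
        ∫ x, kernel γ δ x * modeSum n x * etaCoeff ε a x ∂boxMeasure (Fin k) := by
  rw [MvPowerSeries.coeff_pderiv, boxMeasure_eq]
  change prefactor γ δ k * (∫ x : Fin k → ℝ in Set.univ.pi fun _ => Set.Ioc (-1 / 2 : ℝ) (1 / 2),
    kernel γ δ x * etaCoeff ε (a + Finsupp.single n 1) x) * _ = _
  rw [mul_assoc, ← integral_mul_const]
  simp only [mul_assoc, etaCoeff_add_single_mul]

end Kernel

section LeftVars

variable {k l : ℕ}

/-- The block formed by the variables of `I_k` among those of `I_k` and `I_l`. -/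
def leftVars (k l : ℕ) : Finset (Fin k ⊕ Fin l) := Finset.univ.map Function.Embedding.inl

lemma univ_sdiff_leftVars :
    Finset.univ \ leftVars k l = Finset.univ.map Function.Embedding.inr := by
  ext i
  cases i <;> simp [leftVars]

lemma splitWeight_leftVars (γ δ : ℂ) (z : Fin k ⊕ Fin l → ℝ) :
    splitWeight (shiftRatio (theta δ) γ) (leftVars k l) z =
      kernel γ δ (z ∘ Sum.inl) * kernel γ δ (z ∘ Sum.inr) := by
  rw [splitWeight, univ_sdiff_leftVars, leftVars, pairProd_map, pairProd_map, kernel_eq_pairProd,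
    kernel_eq_pairProd]
  rfl

lemma crossSum_leftVars_mode (a : ℂ) (n : ℤ) (z : Fin k ⊕ Fin l → ℝ) :
    crossSum (fun u => a * e (-(n * u))) (leftVars k l) z =
      a * (modeSum n (z ∘ Sum.inl) * modeSum (-n) (z ∘ Sum.inr)) := by
  rw [crossSum, univ_sdiff_leftVars, leftVars, modeSum, modeSum, Finset.sum_mul_sum]
  simp only [Finset.sum_map, Finset.mul_sum, Function.comp, ← e_add]
  refine Finset.sum_congr rfl fun i _ => Finset.sum_congr rfl fun j _ => ?_
  congr 2
  push_cast [Function.Embedding.inl_apply, Function.Embedding.inr_apply]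
  ring

variable {γ δ : ℂ} (hγ : 0 < γ.im) (hγδ : γ.im < δ.im) (ε : ℂ) (m : Mode →₀ ℕ)
include hγ hγδ

lemma integral_splitWeight_mul_crossSum_mode (a : ℂ) (n : Mode) :
    ∫ z, splitWeight (shiftRatio (theta δ) γ) (leftVars k l) z *
        crossSum (fun u => a * e (-((n : ℤ) * u))) (leftVars k l) z * etaCoeff ε m z
          ∂boxMeasure (Fin k ⊕ Fin l) =
      a * ∑ ab ∈ Finset.HasAntidiagonal.antidiagonal m,
        (∫ x, kernel γ δ x * modeSum n x * etaCoeff ε ab.1 x ∂boxMeasure (Fin k)) *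
          ∫ y, kernel γ δ y * modeSum n.opp y * etaCoeff ε ab.2 y ∂boxMeasure (Fin l) := by
  have hcont (q : ℕ) (n : ℤ) (b : Mode →₀ ℕ) :
      Continuous fun x : Fin q → ℝ => kernel γ δ x * modeSum n x * etaCoeff ε b x :=
    ((continuous_kernel hγ hγδ q).mul (continuous_modeSum n)).mul (continuous_etaCoeff ε b)
  simp only [← integral_boxMeasure_sum_mul]
  rw [← integral_finsetSum, ← integral_const_mul]
  · congr 1 with z
    simp only [splitWeight_leftVars, crossSum_leftVars_mode, etaCoeff_sum ε m z, Finset.mul_sum,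
      Mode.coe_opp]
    exact Finset.sum_congr rfl fun ab _ => by ring
  · intro ab _
    refine integrable_boxMeasure (((hcont k n ab.1).comp ?_).mul ((hcont l n.opp ab.2).comp ?_))
    all_goals exact continuous_pi fun i => continuous_apply _

lemma bracketTerm_hamiltonianSeries_mul (n : Mode) (t : ℂ) :
    structConst γ δ n * MvPowerSeries.coeff m
        (MvPowerSeries.pderiv ℂ n (hamiltonianSeries γ δ ε k) *
          MvPowerSeries.pderiv ℂ n.opp (hamiltonianSeries γ δ ε l)) * t =
      prefactor γ δ k * prefactor γ δ l *
        ∫ z, splitWeight (shiftRatio (theta δ) γ) (leftVars k l) z *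
          crossSum (fun u => structConst γ δ n * t * e (-((n : ℤ) * u))) (leftVars k l) z *
            etaCoeff ε m z ∂boxMeasure (Fin k ⊕ Fin l) := by
  rw [integral_splitWeight_mul_crossSum_mode hγ hγδ, MvPowerSeries.coeff_mul]
  simp only [coeff_pderiv_hamiltonianSeries, Finset.mul_sum, Finset.sum_mul]
  exact Finset.sum_congr rfl fun ab _ => by ring

end LeftVars

section AbelSummation

lemma hasSum_integral_crossSum {ι : Type*} [Fintype ι] [DecidableEq ι] {a : Mode → ℂ}
    (ha : Summable fun n => ‖a n‖) {K : ℝ → ℂ}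
    (hK : ∀ u : ℝ, HasSum (fun n : Mode => a n * e (-((n : ℤ) * u))) (K u))
    {F G : (ι → ℝ) → ℂ} (hF : Continuous F) (hG : Continuous G) (J : Finset ι) :
    HasSum (fun n : Mode =>
        ∫ z, F z * crossSum (fun u => a n * e (-((n : ℤ) * u))) J z * G z ∂boxMeasure ι)
      (∫ z, F z * crossSum K J z * G z ∂boxMeasure ι) := by
  let A : Mode → ℝ := fun n => ∑ _i ∈ J, ∑ _j ∈ Finset.univ \ J, ‖a n‖
  have hA : Summable A := summable_sum fun _ _ => summable_sum fun _ _ => ha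
  have hnorm_mode (n : Mode) (u : ℝ) : ‖a n * e (-((n : ℤ) * u))‖ = ‖a n‖ := by
    have h := norm_e_ofReal (-((n : ℤ) * u))
    push_cast at h
    rw [norm_mul, h, mul_one]
  have hcross_le (n : Mode) (z : ι → ℝ) :
      ‖crossSum (fun u => a n * e (-((n : ℤ) * u))) J z‖ ≤ A n :=
    (norm_sum_le _ _).trans <| Finset.sum_le_sum fun i _ =>
      (norm_sum_le _ _).trans <| Finset.sum_le_sum fun j _ => (hnorm_mode n _).le
  have hcross_cont (n : Mode) :
      Continuous (crossSum (fun u => a n * e (-((n : ℤ) * u))) J : (ι → ℝ) → ℂ) :=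
    continuous_crossSum
      ((differentiable_e.continuous.comp (by fun_prop)).const_mul _) J
  refine hasSum_integral_of_dominated_convergence (fun n z => A n * ‖F z * G z‖)
    (fun n => ((hF.mul (hcross_cont n)).mul hG).aestronglyMeasurable)
    (fun n => Eventually.of_forall fun z => ?_)
    (Eventually.of_forall fun z => hA.mul_right _) ?_ (Eventually.of_forall fun z => ?_)
  · rw [mul_right_comm, norm_mul, mul_comm]
    exact mul_le_mul_of_nonneg_right (hcross_le n z) (norm_nonneg _)
  · simp only [tsum_mul_right]
    exact (integrable_boxMeasure (hF.mul hG)).norm.const_mul _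
  · exact ((hasSum_sum fun i _ => hasSum_sum fun j _ => hK _).mul_left _).mul_right _

lemma tendsto_sum_mul_pow_finsum {κ : Type*} {T : κ → ℂ} (hT : (Function.support T).Finite)
    (d : κ → ℕ) :
    Tendsto (fun r : ℝ => ∑ n ∈ hT.toFinset, T n * (r : ℂ) ^ d n) (𝓝[<] 1) (𝓝 (∑ᶠ n, T n)) := by
  have hcont : Continuous fun r : ℝ => ∑ n ∈ hT.toFinset, T n * (r : ℂ) ^ d n := by fun_prop
  simpa only [ofReal_one, one_pow, mul_one, finsum_eq_sum T hT] using
    (hcont.tendsto 1).mono_left nhdsWithin_le_nhds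

variable {γ δ : ℂ} (hγ : 0 < γ.im) (hγδ : γ.im < δ.im) (ε : ℂ) {k l : ℕ} (m : Mode →₀ ℕ)
include hγ hγδ

lemma hasSum_bracketTerm_mul_pow {r : ℝ} (hr : 0 ≤ r) (hr_lt : r < 1) :
    HasSum (fun n : Mode => structConst γ δ n * MvPowerSeries.coeff m
        (MvPowerSeries.pderiv ℂ n (hamiltonianSeries γ δ ε k) *
          MvPowerSeries.pderiv ℂ n.opp (hamiltonianSeries γ δ ε l)) * (r : ℂ) ^ (n : ℤ).natAbs)
      (prefactor γ δ k * prefactor γ δ l *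
        ∫ z, splitWeight (shiftRatio (theta δ) γ) (leftVars k l) z *
          crossSum (regKernel γ δ r) (leftVars k l) z * etaCoeff ε m z
            ∂boxMeasure (Fin k ⊕ Fin l)) := by
  simp only [bracketTerm_hamiltonianSeries_mul hγ hγδ]
  exact (hasSum_integral_crossSum (summable_norm_structConst_mul_pow hγ hγδ hr hr_lt)
    (hasSum_regKernel hγ hγδ hr hr_lt)
    (continuous_splitWeight (contDiff_shiftRatio_theta hγ hγδ).continuous _)
    (continuous_etaCoeff ε m) _).mul_left _

lemma finsum_bracketTerm_eq_zero :
    ∑ᶠ n : Mode, structConst γ δ n * MvPowerSeries.coeff m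
      (MvPowerSeries.pderiv ℂ n (hamiltonianSeries γ δ ε k) *
        MvPowerSeries.pderiv ℂ n.opp (hamiltonianSeries γ δ ε l)) = 0 := by
  have hfin := finite_support_bracketTerm γ δ (hamiltonian γ δ ε k).2
    (hamiltonianSeries γ δ ε l) m
  have hintegral := (tendsto_integral_splitWeight hγ hγδ ε m (leftVars k l)).const_mul
    (prefactor γ δ k * prefactor γ δ l)
  rw [mul_zero] at hintegral
  refine tendsto_nhds_unique (tendsto_sum_mul_pow_finsum hfin fun n => (n : ℤ).natAbs)
    (hintegral.congr' ?_)
  filter_upwards [eventually_nonneg_and_lt_one] with r hr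
  refine (hasSum_bracketTerm_mul_pow hγ hγδ ε m hr.1 hr.2).unique
    (hasSum_sum_of_ne_finset_zero fun n hn => mul_eq_zero_of_left ?_ _)
  by_contra hne
  exact hn (hfin.mem_toFinset.mpr hne)

end AbelSummation

end EllipticILW

end

theorem mainTheorem3 (γ δ ε : ℂ) (hγ : 0 < γ.im) (hγδ : γ.im < δ.im) (k l : ℕ)
    (hk : 0 < k) (hl : 0 < l) :
    EllipticILW.poissonBracket γ δ (EllipticILW.hamiltonian γ δ ε k)
      (EllipticILW.hamiltonian γ δ ε l) = 0 := by
  ext m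
  rw [EllipticILW.coe_poissonBracket, EllipticILW.coeff_bracketFun, ZeroMemClass.coe_zero, map_zero]
  exact EllipticILW.finsum_bracketTerm_eq_zero hγ hγδ ε m
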